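/- Let $d\ge 1$, let $\ell\ge 2$ be even, $\Lambda_\ell=\{0,1,\dots,\ell-1\}^d$, let $S\in\{\tfrac12,1,\tfrac32,\dots\}$ and $\beta\ge 0$. On $\mathcal H=\bigotimes_{x\in\Lambda_\ell}\mathbb C^{2S+1}$ let $S_x^{(1)},S_x^{(2)},S_x^{(3)}$ be the standard spin-$S$ operators at the site $x$. Let $J^{(1)},J^{(2)},J^{(3)}:\mathbb Z^d\to\mathbb R$ satisfy $J^{(3)}_x\ge J^{(1)}_x\ge -J^{(2)}_x\ge 0$ for all $x\in\mathbb Z^d$. Assume moreover that each of $J^{(1)},-J^{(2)},J^{(3)}$ is a (finite) convex combination of pointwise nonnegative interactions of the following forms, where $a,c\in\mathbb R$ unless stated otherwise; the forms and the parameters may depend on $i$: - nearest neighbour: $J_x=a$ if $\|x\|_1=1$ and $J_x=0$ otherwise; - Yukawa: $J_x=a\,e^{-b\|x\|_1}$ with $b>0$; - power law: $J_x=a\|x\|_1^{-s}$ for $x\ne0$, with $s>d$; - random walk: $J_x=c\sum_{w:0\to x}\bigl(\tfrac{\lambda}{2d}\bigr)^{|w|}$ with $\lambda\in[0,1)$,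 the sum being over nearest-neighbour walks in $\mathbb Z^d$ from $0$ to $x$, of length $|w|$; or the same with walks in the finer lattice $\tfrac1m\mathbb Z^d$, $m\ge 1$ an integer; - the Euclidean interactions obtained from these walks as $m\to\infty$: $J_x=a\int_0^\infty s^{-d/2}e^{-cs}e^{-d\|x\|_2^2/(2s)}\,ds$ for $x\neq0$, with $c>0$; and $J_x=a\|x\|_2^{-s}$ for $x\ne0$, with $s>d$. (Where a formula is restricted to $x\ne0$, the value $J_0$ is arbitrary.) Put $J^{(i)}_{x,\mathrm{per}}=\sum_{z\in\mathbb Z^d}J^{(i)}_{x+\ell z}$. For $v\in\mathbb R^{\Lambda_\ell}$ let $(\Delta v)_x=\sum_{y\in\Lambda_\ell}J^{(3)}_{x-y,\mathrm{per}}(v_y-v_x)$, let $(u,v)=\sum_{x\in\Lambda_\ell}u_xv_x$, and $$H(v)=-\sum_{i=1}^3\sum_{x,y\in\Lambda_\ell}J^{(i)}_{x-y,\mathrm{per}}S^{(i)}_xS^{(i)}_y-\sum_{x\in\Lambda_\ell}(\Delta v)_x\,S_x^{(3)},\qquad Z(v)=\operatorname{Tr}e^{-\beta H(v)},\qquad \tilde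 Z(v)=e^{\frac14\beta(v,\Delta v)}Z(v).$$ Then $\tilde Z(v)\le\tilde Z(0)$ for all $v\in\mathbb R^{\Lambda_\ell}$. -/

import Mathlib

/-! Quantum spin systems on the discrete torus `{0, …, ℓ-1}^d` with periodised couplings. -/

namespace QuantumSpin

noncomputable section

/-! ### Couplings on `ℤ^d` -/

/-- The `ℓ¹` norm on `ℤ^d`. -/
def norm1 {d : ℕ} (x : Fin d → ℤ) : ℤ := ∑ i, |x i|

/-- The Euclidean norm on `ℤ^d`. -/
def norm2 {d : ℕ} (x : Fin d → ℤ) : ℝ := Real.sqrt (∑ i, (x i : ℝ) ^ 2)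

/-- The nearest-neighbour graph of `ℤ^d`. -/
def latticeGraph (d : ℕ) : SimpleGraph (Fin d → ℤ) where
  Adj x y := norm1 (x - y) = 1
  symm := ⟨fun x y h => by
    have e : norm1 (y - x) = norm1 (x - y) :=
      Finset.sum_congr rfl fun i _ => abs_sub_comm (y i) (x i)
    exact e.trans h⟩
  loopless := ⟨fun x h => by simp [norm1] at h⟩

/-- `∑_{w : 0 → x} (lam / 2d)^{|w|}`, the sum over all nearest-neighbour walks in `ℤ^d`
from `0` to `x`. -/
def walkSum (d : ℕ) (lam : ℝ) (x : Fin d → ℤ) : ℝ :=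
  ∑' w : (latticeGraph d).Walk 0 x, (lam / (2 * d)) ^ w.length

/-- The listed interactions `J : ℤ^d → ℝ`. Where the formula is singular at the origin
(power laws, and the continuum limit of random walks), `J 0` is arbitrary. -/
inductive Listed (d : ℕ) : ((Fin d → ℤ) → ℝ) → Prop
  /-- Nearest-neighbour interactions. -/
  | nearestNeighbour (a : ℝ) : Listed d (fun x => if norm1 x = 1 then a else 0)
  /-- Yukawa interactions `a e^{-b ‖x‖₁}`. -/
  | yukawa (a b : ℝ) (hb : 0 < b) :
      Listed d (fun x => a * Real.exp (-b * (norm1 x : ℝ)))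
  /-- Power laws `a ‖x‖₁^{-s}` with `s > d`. -/
  | powerLaw (a s : ℝ) (hs : (d : ℝ) < s) (J : (Fin d → ℤ) → ℝ)
      (hJ : ∀ x, x ≠ 0 → J x = a * (norm1 x : ℝ) ^ (-s)) : Listed d J
  /-- Nearest-neighbour random walks on `ℤ^d`. -/
  | randomWalk (c lam : ℝ) (h0 : 0 ≤ lam) (h1 : lam < 1) :
      Listed d (fun x => c * walkSum d lam x)
  /-- Nearest-neighbour random walks on the finer lattice `m⁻¹ ℤ^d`: rescaled by `m`, these are
  walks in `ℤ^d` from `0` to `m x`. -/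
  | meshWalk (m : ℕ) (hm : 1 ≤ m) (c lam : ℝ) (h0 : 0 ≤ lam) (h1 : lam < 1) :
      Listed d (fun x => c * walkSum d lam ((m : ℤ) • x))
  /-- The limit of random walks with mesh tending to `0`:
  `a ∫_0^∞ s^{-d/2} e^{-c s} e^{-d ‖x‖₂² / (2 s)} ds` with `c > 0`. -/
  | continuumWalk (a c : ℝ) (hc : 0 < c) (J : (Fin d → ℤ) → ℝ)
      (hJ : ∀ x, x ≠ 0 → J x = a * ∫ s in Set.Ioi (0 : ℝ),
        s ^ (-(d : ℝ) / 2) * Real.exp (-c * s) * Real.exp (-(d / (2 * s)) * norm2 x ^ 2)) :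
      Listed d J
  /-- Euclidean power laws `a ‖x‖₂^{-s}` with `s > d`. -/
  | euclideanPowerLaw (a s : ℝ) (hs : (d : ℝ) < s) (J : (Fin d → ℤ) → ℝ)
      (hJ : ∀ x, x ≠ 0 → J x = a * norm2 x ^ (-s)) : Listed d J

/-- Convex combinations of nonnegative listed interactions. -/
def Ferromagnetic (d : ℕ) : Set ((Fin d → ℤ) → ℝ) :=
  convexHull ℝ {J | Listed d J ∧ ∀ x, 0 ≤ J x}

/-- The assumptions on the couplings `J⁽¹⁾ = J 0`, `J⁽²⁾ = J 1`, `J⁽³⁾ = J 2`: up to the sign of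
`J⁽²⁾` each is a listed interaction or a convex combination of such interactions of the same sign,
and `J⁽³⁾ ≥ J⁽¹⁾ ≥ -J⁽²⁾ ≥ 0` pointwise. -/
structure Admissible {d : ℕ} (J : Fin 3 → (Fin d → ℤ) → ℝ) : Prop where
  mem_one : J 0 ∈ Ferromagnetic d
  mem_two : -J 1 ∈ Ferromagnetic d
  mem_three : J 2 ∈ Ferromagnetic d
  one_le_three : ∀ x, J 0 x ≤ J 2 x
  neg_two_le_one : ∀ x, -J 1 x ≤ J 0 x
  neg_two_nonneg : ∀ x, 0 ≤ -J 1 x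

/-! ### The torus -/

/-- The box `Λ_ℓ = {0, …, ℓ-1}^d`. -/
abbrev Box (d ℓ : ℕ) : Type := Fin d → Fin ℓ

/-- The difference `x - y ∈ ℤ^d` of two sites of the box. -/
def diff {d ℓ : ℕ} (x y : Box d ℓ) : Fin d → ℤ := fun i => ((x i : ℕ) : ℤ) - ((y i : ℕ) : ℤ)

/-- The periodised coupling `J_{x,per} = ∑_{z ∈ ℤ^d} J_{x + ℓ z}`. -/
def periodise {d : ℕ} (ℓ : ℕ) (J : (Fin d → ℤ) → ℝ) (x : Fin d → ℤ) : ℝ :=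
  ∑' z : Fin d → ℤ, J (x + (ℓ : ℤ) • z)

/-- The discrete Laplacian `(Δ v)_x = ∑_y J_{x-y,per} (v_y - v_x)` of a coupling. -/
def laplacian {d ℓ : ℕ} (J : (Fin d → ℤ) → ℝ) (v : Box d ℓ → ℝ) : Box d ℓ → ℝ :=
  fun x => ∑ y, periodise ℓ J (diff x y) * (v y - v x)

/-! ### Spin operators

A single spin has state space `ℂ^n` with `n = 2S + 1`; the basis vector `k ∈ {0, …, n-1}` is the
eigenvector of the third spin operator with eigenvalue `S - k`. -/

/-- The raising operator: `k ↦ √(k (n - k)) · (k - 1)`. -/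
def spinRaise (n : ℕ) : Matrix (Fin n) (Fin n) ℂ :=
  Matrix.of fun j k =>
    if (j : ℕ) + 1 = (k : ℕ) then ((Real.sqrt ((k : ℝ) * ((n : ℝ) - (k : ℝ))) : ℝ) : ℂ) else 0

/-- The spin matrices `S⁽¹⁾, S⁽²⁾, S⁽³⁾` of spin `S = (n-1)/2` (half the Pauli matrices
for `n = 2`). -/
def spin (n : ℕ) : Fin 3 → Matrix (Fin n) (Fin n) ℂ
  | 0 => (1 / 2 : ℂ) • (spinRaise n + (spinRaise n).conjTranspose)
  | 1 => (1 / (2 * Complex.I) : ℂ) • (spinRaise n - (spinRaise n).conjTranspose)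
  | 2 => Matrix.diagonal fun k => ((n : ℂ) - 1) / 2 - (k : ℂ)

/-- Operators on `⊗_{x ∈ Λ} ℂ^n`, as matrices in the basis of classical configurations
`σ : Λ → {0, …, n-1}`. -/
abbrev Operator (d ℓ n : ℕ) : Type := Matrix (Box d ℓ → Fin n) (Box d ℓ → Fin n) ℂ

/-- `A ⊗ Id_{Λ \ {x}}`: the single-spin operator `A` acting at the site `x`. -/
def atSite {d ℓ n : ℕ} (x : Box d ℓ) (A : Matrix (Fin n) (Fin n) ℂ) : Operator d ℓ n :=
  Matrix.of fun σ τ => if ∀ y, y ≠ x → σ y = τ y then A (σ x) (τ x) else 0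

/-- The spin operator `S_x⁽ⁱ⁾`. -/
def spinAt {d ℓ : ℕ} (n : ℕ) (x : Box d ℓ) (i : Fin 3) : Operator d ℓ n := atSite x (spin n i)

/-! ### Hamiltonians and partition functions -/

/-- The Hamiltonian with periodic boundary conditions and zero field,
`- ∑_i ∑_{x,y} J⁽ⁱ⁾_{x-y,per} S_x⁽ⁱ⁾ S_y⁽ⁱ⁾`, the sum being over ordered pairs `(x, y)`. -/
def periodicHamiltonian {d : ℕ} (ℓ n : ℕ) (J : Fin 3 → (Fin d → ℤ) → ℝ) : Operator d ℓ n :=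
  -∑ i : Fin 3, ∑ x : Box d ℓ, ∑ y : Box d ℓ,
    ((periodise ℓ (J i) (diff x y) : ℝ) : ℂ) • (spinAt n x i * spinAt n y i)

/-- The Hamiltonian `H(v)` with local magnetic field `h = Δ v`, the Laplacian being that
of `J⁽³⁾`. -/
def fieldHamiltonian {d ℓ : ℕ} (n : ℕ) (J : Fin 3 → (Fin d → ℤ) → ℝ) (v : Box d ℓ → ℝ) :
    Operator d ℓ n :=
  periodicHamiltonian ℓ n J - ∑ x : Box d ℓ, ((laplacian (J 2) v x : ℝ) : ℂ) • spinAt n x 2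

/-- The partition function `Z(v) = Tr e^{-β H(v)}` (a real number, as `H(v)` is hermitian). -/
def partitionFunction {d ℓ : ℕ} (n : ℕ) (J : Fin 3 → (Fin d → ℤ) → ℝ) (β : ℝ)
    (v : Box d ℓ → ℝ) : ℝ :=
  (Matrix.trace (NormedSpace.exp (-(β : ℂ) • fieldHamiltonian n J v))).re

/-- The modified partition function `e^{β (v, Δ v) / 4} Z(v)`. -/
def modifiedPartitionFunction {d ℓ : ℕ} (n : ℕ) (J : Fin 3 → (Fin d → ℤ) → ℝ) (β : ℝ)
    (v : Box d ℓ → ℝ) : ℝ :=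
  Real.exp (1 / 4 * β * ∑ x, v x * laplacian (J 2) v x) * partitionFunction n J β v

end

end QuantumSpin

/-! Completing the square with the shifted spins `T_x = S_x^(3) + v_x/2` turns `-βH(v) + (β/4)(v,
Δv)` into a quadratic form in the `T`'s plus single-site terms. The field thus enters only through
real shifts attached to individual sites.

Cut the torus into two mirror halves. Since `S^(1)`, `S^(3)` and the shifts are real while `S^(2)`
is imaginary, the exponent becomes `A ⊗ 1 + 1 ⊗ B̄ + ∑ C_k ⊗ D̄_k`, provided that the matrices of
`J^(1)`, `-J^(2)`, `J^(3)` between one half and its mirror image are positive semidefinite. Here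
`A`, `C` see the field on the left only, and `B`, `D` the field on the right. Expanding a
Trotter-type product makes the trace a limit of `∑_w tr(E_w) conj(tr F_w)` over words, so
Cauchy–Schwarz gives `Z̃(v)² ≤ Z̃(v_L) Z̃(v_R)`, where `v_L`, `v_R` arise by copying one half onto
the other (`trace_exp_exponent_sq_le`).

The inequality is iterated combinatorially (`le_of_reflections`). Among the finitely many fields
with values in the range of `v`, take a maximiser of `Z̃` with the most agreeing nearest-neighbour
bonds. If a bond disagreed, both copies under the reflection across it would again be maximisers and
one would have more agreements. So the maximiser is constant, and `Δ` kills constants.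

It remains to see that the listed interactions are reflection positive, also after periodisation.
Each is a positive mixture of kernels that decay exponentially in the height above the plane, hence
factorise there, times a positive definite kernel in the transverse variables: sums of rank-one
kernels for `ℓ¹` exponentials, the mixed Fourier representation of the Green function for walks, a
Gaussian Fourier transform for the continuum walk, and Gamma integrals for the two power laws.
Nearest neighbours give a diagonal kernel. For the torus, the sum over images in the normal
direction is positive term by term, and that over transverse images by Fejér averaging
(`ReflectionPositive.sum_periodise_nonneg`). -/

namespace QuantumSpin

open Filter Topology Matrix
open scoped Kronecker

/-! ### Powers converging to the exponential -/

section ExpLimit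

variable {𝔸 : Type*} [NormedRing 𝔸] [NormOneClass 𝔸]

/-- Telescoping. The sharper factor `M ^ (n - 1)` is not needed: in use `M = exp (K / n)`, so `M ^
n` is the constant `exp K`. -/
theorem norm_pow_sub_pow_le {a b : 𝔸} {M : ℝ} (ha : ‖a‖ ≤ M) (hb : ‖b‖ ≤ M) (hM : 1 ≤ M)
    (n : ℕ) : ‖a ^ n - b ^ n‖ ≤ n * M ^ n * ‖a - b‖ := by
  induction n with
  | zero => simp
  | succ n ih =>
    have e : a ^ (n + 1) - b ^ (n + 1) = a * (a ^ n - b ^ n) + (a - b) * b ^ n := by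
      rw [pow_succ', pow_succ']; noncomm_ring
    have h1 : ‖b ^ n‖ ≤ M ^ n := (norm_pow_le b n).trans (by gcongr)
    have hM0 : 0 ≤ M := by linarith
    calc ‖a ^ (n + 1) - b ^ (n + 1)‖ ≤ ‖a‖ * ‖a ^ n - b ^ n‖ + ‖a - b‖ * ‖b ^ n‖ := by
          rw [e]
          exact (norm_add_le _ _).trans (add_le_add (norm_mul_le _ _) (norm_mul_le _ _))
      _ ≤ M * (n * M ^ n * ‖a - b‖) + ‖a - b‖ * M ^ (n + 1) := by
          gcongr
          exact h1.trans (pow_le_pow_right₀ hM n.le_succ)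
      _ = ((n + 1 : ℕ) : ℝ) * M ^ (n + 1) * ‖a - b‖ := by push_cast; ring

/-- Compare the base with `exp (X / N)`: the two differ by `o(1 / N)`, and telescoping multiplies
this by at most `N * exp K`. The term in `Y` leaves room for the second-order error of a base that
is exactly a sum of tensor products. -/
theorem tendsto_one_add_smul_add_smul_pow_exp [NormedAlgebra ℂ 𝔸] [CompleteSpace 𝔸] (X Y : 𝔸) :
    Tendsto (fun N : ℕ => (1 + (N : ℂ)⁻¹ • X + ((N : ℂ)⁻¹) ^ 2 • Y) ^ N) atTop
      (𝓝 (NormedSpace.exp X)) := by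
  -- The summand `1` absorbs the remainder of `exp (X / N)`, eventually at most `1 / N`.
  set K : ℝ := ‖X‖ + ‖Y‖ + 1
  have hK : 0 ≤ K := by positivity
  set a : ℕ → 𝔸 := fun N => 1 + (N : ℂ)⁻¹ • X + ((N : ℂ)⁻¹) ^ 2 • Y
  set b : ℕ → 𝔸 := fun N => NormedSpace.exp ((N : ℂ)⁻¹ • X)
  have hinv : Tendsto (fun N : ℕ => (N : ℂ)⁻¹) atTop (𝓝 0) := tendsto_inv_atTop_nhds_zero_nat
  -- The derivative of `t ↦ exp (t X)` at `0`, read along `t = 1 / N`.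
  have hderiv : Tendsto (fun N : ℕ => (N : ℂ) • (b N - 1 - (N : ℂ)⁻¹ • X)) atTop (𝓝 0) := by
    have h := (hasDerivAt_exp_smul_const (𝕂 := ℂ) X (0 : ℂ)).tendsto_slope_zero
    have hinv' : Tendsto (fun N : ℕ => (N : ℂ)⁻¹) atTop (𝓝[≠] 0) := by
      refine tendsto_nhdsWithin_iff.2 ⟨hinv, ?_⟩
      filter_upwards [eventually_ge_atTop 1] with N hN
      simpa using (by omega : N ≠ 0)
    have h2 := (h.comp hinv').sub_const X
    simp only [zero_smul, NormedSpace.exp_zero, one_mul, sub_self] at h2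
    refine h2.congr' ?_
    filter_upwards [eventually_ge_atTop 1] with N hN
    have hN' : (N : ℂ) ≠ 0 := by exact_mod_cast (by omega : N ≠ 0)
    simp only [Function.comp, b, zero_add, inv_inv]
    rw [smul_sub (N : ℂ) _ ((N : ℂ)⁻¹ • X), smul_smul, mul_inv_cancel₀ hN', one_smul]
  have hdiff : Tendsto (fun N : ℕ => (N : ℝ) * ‖a N - b N‖) atTop (𝓝 0) := by
    have h2 : Tendsto (fun N : ℕ => (N : ℂ)⁻¹ • Y - (N : ℂ) • (b N - 1 - (N : ℂ)⁻¹ • X)) atTop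
        (𝓝 0) := by simpa using (hinv.smul_const Y).sub hderiv
    refine (h2.norm.congr' ?_).trans (by simp)
    filter_upwards [eventually_ge_atTop 1] with N hN
    have hN' : (N : ℂ) ≠ 0 := by exact_mod_cast (by omega : N ≠ 0)
    have e : (N : ℂ)⁻¹ • Y - (N : ℂ) • (b N - 1 - (N : ℂ)⁻¹ • X) = (N : ℂ) • (a N - b N) := by
      simp only [a, smul_sub, smul_add, smul_smul]
      rw [mul_inv_cancel₀ hN', pow_two, mul_inv_cancel_left₀ hN']
      abel
    rw [e, norm_smul]; simp
  have hpow : Tendsto (fun N : ℕ => a N ^ N - b N ^ N) atTop (𝓝 0) := by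
    rw [tendsto_zero_iff_norm_tendsto_zero]
    refine squeeze_zero' (Eventually.of_forall fun _ => norm_nonneg _) ?_
      (by simpa using hdiff.const_mul (Real.exp K))
    have hev : ∀ᶠ N : ℕ in atTop, ‖(N : ℂ) • (b N - 1 - (N : ℂ)⁻¹ • X)‖ ≤ 1 :=
      (hderiv.norm.eventually (gt_mem_nhds (by simp : ‖(0 : 𝔸)‖ < 1))).mono fun _ h => h.le
    filter_upwards [eventually_ge_atTop 1, hev] with N hN hbN
    have hNr : (1 : ℝ) ≤ N := by exact_mod_cast hN
    have hNi : (N : ℝ)⁻¹ ≤ 1 := inv_le_one_of_one_le₀ hNr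
    have hNi0 : 0 ≤ (N : ℝ)⁻¹ := by positivity
    have h1 : ‖a N‖ ≤ Real.exp (K / N) := by
      calc ‖a N‖ ≤ 1 + (N : ℝ)⁻¹ * ‖X‖ + ((N : ℝ)⁻¹) ^ 2 * ‖Y‖ := by
            refine (norm_add_le _ _).trans (add_le_add ((norm_add_le _ _).trans ?_) ?_)
            · simp [norm_smul]
            · simp [norm_smul]
        _ ≤ 1 + (N : ℝ)⁻¹ * ‖X‖ + (N : ℝ)⁻¹ * ‖Y‖ := by
            gcongr; nlinarith
        _ ≤ K / N + 1 := by simp only [K, div_eq_inv_mul]; nlinarith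
        _ ≤ _ := Real.add_one_le_exp _
    have h2 : ‖b N‖ ≤ Real.exp (K / N) := by
      have e : b N = (b N - 1 - (N : ℂ)⁻¹ • X) + (1 + (N : ℂ)⁻¹ • X) := by abel
      rw [norm_smul, RCLike.norm_natCast] at hbN
      have h3 : ‖b N - 1 - (N : ℂ)⁻¹ • X‖ ≤ (N : ℝ)⁻¹ := by
        rwa [← one_div (N : ℝ), le_div_iff₀' (by positivity : (0 : ℝ) < N)]
      calc ‖b N‖ ≤ (N : ℝ)⁻¹ + (1 + (N : ℝ)⁻¹ * ‖X‖) := by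
            rw [e]
            refine (norm_add_le _ _).trans (add_le_add h3 ((norm_add_le _ _).trans ?_))
            simp [norm_smul]
        _ ≤ K / N + 1 := by
            simp only [K, div_eq_inv_mul]; nlinarith [norm_nonneg Y]
        _ ≤ _ := Real.add_one_le_exp _
    refine (norm_pow_sub_pow_le h1 h2 (Real.one_le_exp (by positivity)) N).trans_eq ?_
    rw [← Real.exp_nat_mul, mul_div_cancel₀ _ (by positivity)]
    ring
  have hb : ∀ᶠ N : ℕ in atTop, b N ^ N = NormedSpace.exp X := by
    filter_upwards [eventually_ge_atTop 1] with N hN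
    have hN' : (N : ℂ) ≠ 0 := by exact_mod_cast (by omega : N ≠ 0)
    simp only [b]
    let := NormedAlgebra.restrictScalars ℚ ℂ 𝔸
    rw [← NormedSpace.exp_nsmul, ← Nat.cast_smul_eq_nsmul ℂ, smul_smul, mul_inv_cancel₀ hN',
      one_smul]
  have := hpow.add (tendsto_const_nhds (x := NormedSpace.exp X))
  rw [zero_add] at this
  refine this.congr' ?_
  filter_upwards [hb] with N hN
  rw [hN]; abel

end ExpLimit

/-! ### Traces of powers of tensor sums, expanded over words -/

section Words

variable {m κ : Type*} [Fintype m] [DecidableEq m]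

/-- The product `E (w 0) * E (w 1) * ⋯` of the matrices listed by a word `w`. -/
def wordProd (E : κ → Matrix m m ℂ) {N : ℕ} (w : Fin N → κ) : Matrix m m ℂ :=
  (List.ofFn fun i => E (w i)).prod

theorem sum_kronecker_pow [Fintype κ] (E F : κ → Matrix m m ℂ) (N : ℕ) :
    (∑ k, E k ⊗ₖ F k) ^ N = ∑ w : Fin N → κ, wordProd E w ⊗ₖ wordProd F w := by
  induction N with
  | zero => simp [wordProd]
  | succ N ih =>
    rw [pow_succ', ih, Finset.sum_mul_sum, ← Fintype.sum_prod_type',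
      ← (Fin.consEquiv fun _ : Fin (N + 1) => κ).sum_comp]
    refine Finset.sum_congr rfl fun x _ => ?_
    simp [wordProd, List.ofFn_succ, Fin.consEquiv, Matrix.mul_kronecker_mul]

/-- Entrywise complex conjugation of matrices. -/
def conjM : Matrix m m ℂ →+* Matrix m m ℂ := (starRingEnd ℂ).mapMatrix

theorem conjM_apply (A : Matrix m m ℂ) (i j : m) :
    conjM A i j = (starRingEnd ℂ) (A i j) := rfl

theorem trace_conjM (A : Matrix m m ℂ) :
    (conjM A).trace = (starRingEnd ℂ) A.trace := by
  simp [Matrix.trace, conjM_apply]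

theorem conjM_smul (c : ℂ) (A : Matrix m m ℂ) :
    conjM (c • A) = (starRingEnd ℂ) c • conjM A := by
  ext i j; simp [conjM_apply]

theorem wordProd_conjM (F : κ → Matrix m m ℂ) {N : ℕ} (w : Fin N → κ) :
    wordProd (fun k => conjM (F k)) w = conjM (wordProd F w) := by
  simp [wordProd, map_list_prod, List.map_ofFn, Function.comp_def]

theorem trace_sum_kronecker_conjM_pow [Fintype κ] (E F : κ → Matrix m m ℂ) (N : ℕ) :
    ((∑ k, E k ⊗ₖ conjM (F k)) ^ N).trace
      = ∑ w : Fin N → κ, (wordProd E w).trace * (starRingEnd ℂ) (wordProd F w).trace := by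
  rw [sum_kronecker_pow E fun k => conjM (F k)]
  simp [Matrix.trace_sum, Matrix.trace_kronecker, wordProd_conjM, trace_conjM]

theorem trace_sum_kronecker_conjM_self_pow_re [Fintype κ] (E : κ → Matrix m m ℂ) (N : ℕ) :
    ((∑ k, E k ⊗ₖ conjM (E k)) ^ N).trace.re
      = ∑ w : Fin N → κ, ‖(wordProd E w).trace‖ ^ 2 := by
  rw [trace_sum_kronecker_conjM_pow, Complex.re_sum]
  refine Finset.sum_congr rfl fun w _ => ?_
  rw [Complex.mul_conj, Complex.normSq_eq_norm_sq, Complex.ofReal_re]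

/-- The trace factorises on tensor products, so the trace of the power is the inner product of the
vectors `(tr E_w)_w` and `(tr F_w)_w` indexed by words. This is Cauchy–Schwarz for them. -/
theorem norm_trace_sum_kronecker_pow_sq_le [Fintype κ] (E F : κ → Matrix m m ℂ) (N : ℕ) :
    ‖((∑ k, E k ⊗ₖ conjM (F k)) ^ N).trace‖ ^ 2 ≤
      ((∑ k, E k ⊗ₖ conjM (E k)) ^ N).trace.re * ((∑ k, F k ⊗ₖ conjM (F k)) ^ N).trace.re := by
  rw [trace_sum_kronecker_conjM_self_pow_re, trace_sum_kronecker_conjM_self_pow_re,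
    trace_sum_kronecker_conjM_pow]
  refine le_trans ?_ (Finset.sum_mul_sq_le_sq_mul_sq _ _ _)
  gcongr
  refine (norm_sum_le _ _).trans (Finset.sum_le_sum fun w _ => ?_)
  simp

end Words

/-! ### Cauchy–Schwarz for traces of exponentials -/

section Trace

variable {m κ : Type*} [Fintype m] [DecidableEq m] [Fintype κ]

/-- The exponent `A ⊗ 1 + 1 ⊗ B̄ + ∑_k C_k ⊗ D̄_k`. -/
def couplingExponent (A B : Matrix m m ℂ) (C D : κ → Matrix m m ℂ) : Matrix (m × m) (m × m) ℂ :=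
  A ⊗ₖ (1 : Matrix m m ℂ) + (1 : Matrix m m ℂ) ⊗ₖ conjM B + ∑ k, C k ⊗ₖ conjM (D k)

/-- The factors whose tensor products sum to the `N`-th approximation of the exponential. -/
noncomputable def trotterFactor (N : ℕ) (A : Matrix m m ℂ) (C : κ → Matrix m m ℂ) :
    Option κ → Matrix m m ℂ
  | none => 1 + (N : ℂ)⁻¹ • A
  | some k => ((Real.sqrt (N : ℝ)⁻¹ : ℝ) : ℂ) • C k

/-- The two factors `1 / √N` multiply to `1 / N`, while `(1 + A/N) ⊗ (1 + B̄/N)` supplies the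
one-sided terms and the only second-order term. -/
theorem sum_trotterFactor (N : ℕ) (A B : Matrix m m ℂ) (C D : κ → Matrix m m ℂ) :
    ∑ k, trotterFactor N A C k ⊗ₖ conjM (trotterFactor N B D k) =
      1 + (N : ℂ)⁻¹ • couplingExponent A B C D + ((N : ℂ)⁻¹) ^ 2 • (A ⊗ₖ conjM B) := by
  have hs : ((Real.sqrt (N : ℝ)⁻¹ : ℝ) : ℂ) * ((Real.sqrt (N : ℝ)⁻¹ : ℝ) : ℂ) = (N : ℂ)⁻¹ := by
    rw [← Complex.ofReal_mul, Real.mul_self_sqrt (by positivity)]; simp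
  rw [Fintype.sum_option]
  simp only [trotterFactor, couplingExponent, map_add, map_one, conjM_smul, map_inv₀, map_natCast,
    Complex.conj_ofReal, Matrix.smul_kronecker, Matrix.kronecker_smul, smul_smul, hs,
    Matrix.add_kronecker, Matrix.kronecker_add, Matrix.one_kronecker_one, smul_add,
    Finset.smul_sum, pow_two]
  abel

theorem tendsto_trace_trotter [Nonempty m] (A B : Matrix m m ℂ) (C D : κ → Matrix m m ℂ) :
    Tendsto (fun N : ℕ => ((∑ k, trotterFactor N A C k ⊗ₖ conjM (trotterFactor N B D k)) ^ N).trace)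
      atTop (𝓝 (NormedSpace.exp (couplingExponent A B C D)).trace) := by
  -- Any submultiplicative norm with `‖1‖ = 1` serves; the latter needs `Nonempty m`.
  let : NormedRing (Matrix (m × m) (m × m) ℂ) := Matrix.linftyOpNormedRing
  let : NormedAlgebra ℂ (Matrix (m × m) (m × m) ℂ) := Matrix.linftyOpNormedAlgebra
  have h := tendsto_one_add_smul_add_smul_pow_exp (couplingExponent A B C D) (A ⊗ₖ conjM B)
  simp only [sum_trotterFactor]
  exact ((continuous_id.matrix_trace).tendsto _).comp h

/-- Reflection positivity of the trace: the Cauchy-Schwarz inequality for `Tr e^{A ⊗ 1 + ⋯}`. -/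
theorem norm_trace_exp_couplingExponent_sq_le [Nonempty m] (A B : Matrix m m ℂ)
    (C D : κ → Matrix m m ℂ) :
    ‖(NormedSpace.exp (couplingExponent A B C D)).trace‖ ^ 2 ≤
      (NormedSpace.exp (couplingExponent A A C C)).trace.re *
        (NormedSpace.exp (couplingExponent B B D D)).trace.re :=
  le_of_tendsto_of_tendsto' ((tendsto_trace_trotter A B C D).norm.pow 2)
    (((Complex.continuous_re.tendsto _).comp (tendsto_trace_trotter A A C C)).mul
      ((Complex.continuous_re.tendsto _).comp (tendsto_trace_trotter B B D D)))
    fun _ => norm_trace_sum_kronecker_pow_sq_le _ _ _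

theorem trace_exp_couplingExponent_self_nonneg [Nonempty m] (A : Matrix m m ℂ)
    (C : κ → Matrix m m ℂ) :
    0 ≤ (NormedSpace.exp (couplingExponent A A C C)).trace.re :=
  ge_of_tendsto' ((Complex.continuous_re.tendsto _).comp (tendsto_trace_trotter A A C C))
    fun _ => by
      simp only [Function.comp, trace_sum_kronecker_conjM_self_pow_re]; positivity

end Trace

end QuantumSpin

namespace QuantumSpin

open Filter Topology Matrix
open scoped Kronecker

noncomputable section

/-! ### Single-site operators on a finite set of sites -/

section SiteOp

variable {I : Type*} [DecidableEq I] [Fintype I] {n : ℕ}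

/-- The single-spin operator `A` acting at the site `x` of an arbitrary finite set of sites. -/
def siteOp (x : I) (A : Matrix (Fin n) (Fin n) ℂ) : Matrix (I → Fin n) (I → Fin n) ℂ :=
  Matrix.of fun σ τ => if ∀ y, y ≠ x → σ y = τ y then A (σ x) (τ x) else 0

theorem siteOp_add (x : I) (A B : Matrix (Fin n) (Fin n) ℂ) :
    siteOp x (A + B) = siteOp x A + siteOp x B := by
  ext σ τ; simp only [siteOp, Matrix.of_apply, Matrix.add_apply]; split_ifs <;> simp

theorem siteOp_smul (x : I) (c : ℂ) (A : Matrix (Fin n) (Fin n) ℂ) :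
    siteOp x (c • A) = c • siteOp x A := by
  ext σ τ; simp only [siteOp, Matrix.of_apply, Matrix.smul_apply]; split_ifs <;> simp

theorem siteOp_one (x : I) : siteOp x (1 : Matrix (Fin n) (Fin n) ℂ) = 1 := by
  ext σ τ
  simp only [siteOp, Matrix.of_apply, Matrix.one_apply]
  by_cases h : σ = τ
  · simp [h]
  · rw [if_neg h]
    split_ifs with h1 h2
    · exact absurd (funext fun y => by by_cases hy : y = x <;> simp_all) h
    · rfl
    · rfl

theorem conjM_siteOp (x : I) (A : Matrix (Fin n) (Fin n) ℂ) :
    conjM (siteOp x A) = siteOp x (conjM A) := by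
  ext σ τ; simp only [conjM_apply, siteOp, Matrix.of_apply]; split_ifs <;> simp

end SiteOp

/-! ### Complex conjugation of the spin matrices -/

/-- The sign by which complex conjugation acts on the spin matrices. -/
def conjSign : Fin 3 → ℝ
  | 0 => 1
  | 1 => -1
  | 2 => 1

theorem conjM_spinRaise (n : ℕ) : conjM (spinRaise n) = spinRaise n := by
  ext i j; simp only [conjM_apply, spinRaise, Matrix.of_apply]; split_ifs <;> simp

theorem conjM_spinRaise_conjTranspose (n : ℕ) :
    conjM (spinRaise n).conjTranspose = (spinRaise n).conjTranspose := by
  ext i j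
  have := congrFun (congrFun (conjM_spinRaise n) j) i
  simp only [conjM_apply, Matrix.conjTranspose_apply, RCLike.star_def] at this ⊢
  rw [this, this]

/-- The first and third spin matrices are real, the second is imaginary. This sign is why `-J^(2)`,
not `J^(2)`, has to be reflection positive. -/
theorem conjM_spin (n : ℕ) (i : Fin 3) : conjM (spin n i) = (conjSign i : ℂ) • spin n i := by
  fin_cases i
  · simp [spin, conjSign, conjM_smul, conjM_spinRaise, conjM_spinRaise_conjTranspose,
      Complex.conj_ofNat]
  · simp [spin, conjSign, conjM_smul, conjM_spinRaise, conjM_spinRaise_conjTranspose,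
      Complex.conj_ofNat]
  · ext i j
    by_cases h : i = j <;> simp [spin, conjSign, conjM_apply, h, Complex.conj_ofNat]

/-- The spin matrices, the third one being shifted by `w / 2`. -/
def shiftedSpin (n : ℕ) (w : ℝ) (i : Fin 3) : Matrix (Fin n) (Fin n) ℂ :=
  spin n i + ((if i = 2 then w / 2 else 0 : ℝ) : ℂ) • (1 : Matrix (Fin n) (Fin n) ℂ)

theorem conjM_shiftedSpin (n : ℕ) (w : ℝ) (i : Fin 3) :
    conjM (shiftedSpin n w i) = (conjSign i : ℂ) • shiftedSpin n w i := by
  rw [shiftedSpin, map_add, conjM_spin, conjM_smul, map_one, Complex.conj_ofReal, smul_add]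
  fin_cases i <;> simp [conjSign]

/-! ### The exponent as a quadratic form in shifted spins -/

section Exponent

variable {d ℓ n : ℕ}

/-- `∑_i ∑_{x,y} c^i_{x,y} T_x^i T_y^i - ∑_{x,y} c^3_{x,y} ((T_x^3)² - (S_x^3)²)`, where
`T_x^3 = S_x^3 + v_x / 2`. -/
def exponent (n : ℕ) (c : Fin 3 → Box d ℓ → Box d ℓ → ℝ) (v : Box d ℓ → ℝ) : Operator d ℓ n :=
  ∑ i, ∑ x, ∑ y, (c i x y : ℂ) •
      (siteOp x (shiftedSpin n (v x) i) * siteOp y (shiftedSpin n (v y) i)) -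
    ∑ x, ∑ y, (c 2 x y : ℂ) • (siteOp x (shiftedSpin n (v x) 2) ^ 2 - siteOp x (spin n 2) ^ 2)

/-- Expanding `T_x T_y - T_x² + S_x²` leaves `S_x S_y`, linear terms that add up to `(v_y - v_x)
S_x` by the symmetry of `c 2`, and the scalar `v_x (v_y - v_x) / 4`. With `c = β J_per` the right
side is `-βH(v) + (β/4)(v, Δv)`. -/
theorem exponent_eq (c : Fin 3 → Box d ℓ → Box d ℓ → ℝ) (hc : ∀ x y, c 2 x y = c 2 y x)
    (v : Box d ℓ → ℝ) :
    exponent n c v =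
      (∑ i, ∑ x, ∑ y, (c i x y : ℂ) • (spinAt n x i * spinAt n y i) +
        ∑ x, ((∑ y, c 2 x y * (v y - v x) : ℝ) : ℂ) • spinAt n x 2) +
        ((1 / 4 * ∑ x, v x * ∑ y, c 2 x y * (v y - v x) : ℝ) : ℂ) • (1 : Operator d ℓ n) := by
  have hS : ∀ (x : Box d ℓ) i, siteOp x (spin n i) = spinAt n x i := fun _ _ => rfl
  have h01 : ∀ w i, i ≠ 2 → shiftedSpin n w i = spin n i := fun w i hi => by
    simp [shiftedSpin, hi]
  have h2 : ∀ x, siteOp x (shiftedSpin n (v x) 2) =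
      spinAt n x 2 + ((v x / 2 : ℝ) : ℂ) • (1 : Operator d ℓ n) := fun x => by
    simp only [shiftedSpin, siteOp_add, siteOp_smul, siteOp_one, hS, if_true]
  have key : ∑ x, ∑ y, (c 2 x y : ℂ) •
      (siteOp x (shiftedSpin n (v x) 2) * siteOp y (shiftedSpin n (v y) 2)) -
      ∑ x, ∑ y, (c 2 x y : ℂ) •
        (siteOp x (shiftedSpin n (v x) 2) ^ 2 - siteOp x (spin n 2) ^ 2) =
      ∑ x, ∑ y, (c 2 x y : ℂ) • (spinAt n x 2 * spinAt n y 2) +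
        ∑ x, ((∑ y, c 2 x y * (v y - v x) : ℝ) : ℂ) • spinAt n x 2 +
        ((1 / 4 * ∑ x, v x * ∑ y, c 2 x y * (v y - v x) : ℝ) : ℂ) • (1 : Operator d ℓ n) := by
    have swap : ∑ x, ∑ y, ((c 2 x y * (v x / 2) : ℝ) : ℂ) • spinAt n y 2 =
        ∑ x, ∑ y, ((c 2 x y * (v y / 2) : ℝ) : ℂ) • spinAt n x 2 := by
      rw [Finset.sum_comm]
      exact Finset.sum_congr rfl fun x _ => Finset.sum_congr rfl fun y _ => by rw [hc]
    have e : ∀ x y, (c 2 x y : ℂ) •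
        (siteOp x (shiftedSpin n (v x) 2) * siteOp y (shiftedSpin n (v y) 2)) -
        (c 2 x y : ℂ) • (siteOp x (shiftedSpin n (v x) 2) ^ 2 - siteOp x (spin n 2) ^ 2) =
        (c 2 x y : ℂ) • (spinAt n x 2 * spinAt n y 2) +
        (((c 2 x y * (v x / 2) : ℝ) : ℂ) • spinAt n y 2 +
          ((c 2 x y * (v y / 2) : ℝ) : ℂ) • spinAt n x 2 -
          ((c 2 x y * v x : ℝ) : ℂ) • spinAt n x 2) +
        ((1 / 4 * (v x * (c 2 x y * (v y - v x))) : ℝ) : ℂ) • (1 : Operator d ℓ n) := by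
      intro x y
      rw [h2, h2, hS, pow_two, pow_two]
      simp only [add_mul, mul_add, smul_mul_assoc, mul_smul_comm, one_mul, mul_one, smul_add,
        smul_sub, smul_smul]
      push_cast
      module
    rw [← Finset.sum_sub_distrib]
    simp only [← Finset.sum_sub_distrib, e]
    simp only [Finset.sum_add_distrib, Finset.sum_sub_distrib, swap]
    congr 1
    · congr 1
      rw [← Finset.sum_add_distrib, ← Finset.sum_sub_distrib]
      refine Finset.sum_congr rfl fun x _ => ?_
      rw [← Finset.sum_add_distrib, ← Finset.sum_sub_distrib, Complex.ofReal_sum,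
        Finset.sum_smul]
      refine Finset.sum_congr rfl fun y _ => ?_
      push_cast; module
    · simp only [← Finset.sum_smul, ← Complex.ofReal_sum, Finset.mul_sum]
  rw [exponent, Fin.sum_univ_three, add_sub_assoc, key, Fin.sum_univ_three]
  simp only [h01 _ 0 (by decide), h01 _ 1 (by decide), hS]
  abel

end Exponent

/-! ### Splitting the sites in two halves -/

section Split

variable {d ℓ n : ℕ} {h : Type*}

/-- Configurations as pairs of configurations on the two halves. -/
def configEquiv (n : ℕ) (e : h ⊕ h ≃ Box d ℓ) :
    (Box d ℓ → Fin n) ≃ (h → Fin n) × (h → Fin n) :=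
  (Equiv.arrowCongr e.symm (Equiv.refl _)).trans (Equiv.sumArrowEquivProdArrow h h (Fin n))

/-- Operators as operators on the tensor product of two copies of the half system. -/
def splitHom [Fintype h] [DecidableEq h] (n : ℕ) (e : h ⊕ h ≃ Box d ℓ) : Operator d ℓ n ≃ₐ[ℂ]
    Matrix ((h → Fin n) × (h → Fin n)) ((h → Fin n) × (h → Fin n)) ℂ :=
  Matrix.reindexAlgEquiv ℂ ℂ (configEquiv n e)

theorem splitHom_apply [Fintype h] [DecidableEq h] (e : h ⊕ h ≃ Box d ℓ) (A : Operator d ℓ n)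
    (s t : (h → Fin n) × (h → Fin n)) :
    splitHom n e A s t = A ((configEquiv n e).symm s) ((configEquiv n e).symm t) := rfl

theorem configEquiv_symm_inl (e : h ⊕ h ≃ Box d ℓ) (s : (h → Fin n) × (h → Fin n)) (a : h) :
    (configEquiv n e).symm s (e (Sum.inl a)) = s.1 a := by
  simp [configEquiv, Equiv.sumArrowEquivProdArrow]

theorem configEquiv_symm_inr (e : h ⊕ h ≃ Box d ℓ) (s : (h → Fin n) × (h → Fin n)) (a : h) :
    (configEquiv n e).symm s (e (Sum.inr a)) = s.2 a := by
  simp [configEquiv, Equiv.sumArrowEquivProdArrow]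

theorem splitHom_siteOp_inl [Fintype h] [DecidableEq h] (e : h ⊕ h ≃ Box d ℓ) (a : h)
    (A : Matrix (Fin n) (Fin n) ℂ) :
    splitHom n e (siteOp (e (Sum.inl a)) A) = siteOp a A ⊗ₖ 1 := by
  ext s t
  rw [splitHom_apply, Matrix.kroneckerMap_apply]
  simp only [siteOp, Matrix.of_apply, configEquiv_symm_inl, Matrix.one_apply]
  have hiff : (∀ y, y ≠ e (Sum.inl a) →
      (configEquiv n e).symm s y = (configEquiv n e).symm t y) ↔
      (∀ b, b ≠ a → s.1 b = t.1 b) ∧ s.2 = t.2 := by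
    rw [← e.forall_congr_right, Sum.forall]
    simp [configEquiv_symm_inl, configEquiv_symm_inr, funext_iff]
  simp only [hiff]
  split_ifs <;> simp_all

theorem splitHom_siteOp_inr [Fintype h] [DecidableEq h] (e : h ⊕ h ≃ Box d ℓ) (a : h)
    (A : Matrix (Fin n) (Fin n) ℂ) :
    splitHom n e (siteOp (e (Sum.inr a)) A) = 1 ⊗ₖ siteOp a A := by
  ext s t
  rw [splitHom_apply, Matrix.kroneckerMap_apply]
  simp only [siteOp, Matrix.of_apply, configEquiv_symm_inr, Matrix.one_apply]
  have hiff : (∀ y, y ≠ e (Sum.inr a) →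
      (configEquiv n e).symm s y = (configEquiv n e).symm t y) ↔
      s.1 = t.1 ∧ (∀ b, b ≠ a → s.2 b = t.2 b) := by
    rw [← e.forall_congr_right, Sum.forall]
    simp [configEquiv_symm_inl, configEquiv_symm_inr, funext_iff]
  simp only [hiff]
  split_ifs <;> simp_all

theorem trace_exp_splitHom [Fintype h] [DecidableEq h] (e : h ⊕ h ≃ Box d ℓ) (A : Operator d ℓ n) :
    (NormedSpace.exp (splitHom n e A)).trace = (NormedSpace.exp A).trace := by
  have h1 : splitHom n e (NormedSpace.exp A) = NormedSpace.exp (splitHom n e A) := by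
    let : NormedRing (Operator d ℓ n) := Matrix.linftyOpNormedRing
    let : NormedAlgebra ℂ (Operator d ℓ n) := Matrix.linftyOpNormedAlgebra
    let : NormedAlgebra ℚ (Operator d ℓ n) := NormedAlgebra.restrictScalars ℚ ℂ _
    let : NormedRing (Matrix ((h → Fin n) × (h → Fin n)) ((h → Fin n) × (h → Fin n)) ℂ) :=
      Matrix.linftyOpNormedRing
    refine NormedSpace.map_exp (splitHom n e) ?_ A
    exact continuous_pi fun s => continuous_pi fun t =>
      (continuous_apply_apply ((configEquiv n e).symm s) ((configEquiv n e).symm t))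
  rw [← h1]
  simp only [Matrix.trace, Matrix.diag_apply, splitHom_apply]
  exact (configEquiv n e).symm.sum_comp fun σ => NormedSpace.exp A σ σ

end Split

/-! ### Reflection positivity of the partition function -/

section Reflection

variable {d ℓ n : ℕ} {h κ : Type*} [Fintype h] [DecidableEq h]

/-- The part of the exponent that only involves the left half. -/
def halfExponent (n : ℕ) (e : h ⊕ h ≃ Box d ℓ) (c : Fin 3 → Box d ℓ → Box d ℓ → ℝ)
    (w : h → ℝ) : Matrix (h → Fin n) (h → Fin n) ℂ :=
  ∑ i, ∑ a, ∑ b, (c i (e (Sum.inl a)) (e (Sum.inl b)) : ℂ) •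
      (siteOp a (shiftedSpin n (w a) i) * siteOp b (shiftedSpin n (w b) i)) -
    ∑ a, ((∑ y, c 2 (e (Sum.inl a)) y : ℝ) : ℂ) •
      (siteOp a (shiftedSpin n (w a) 2) ^ 2 - siteOp a (spin n 2) ^ 2)

/-- The operators of the left half that are coupled to their reflections. -/
def halfCoupling (n : ℕ) (g : Fin 3 → κ → h → ℝ) (w : h → ℝ) (p : Fin 3 × κ) :
    Matrix (h → Fin n) (h → Fin n) ℂ :=
  ((Real.sqrt 2 : ℝ) : ℂ) • ∑ a, (g p.1 p.2 a : ℂ) • siteOp a (shiftedSpin n (w a) p.1)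

theorem conjSign_mul_self (i : Fin 3) : conjSign i * conjSign i = 1 := by
  fin_cases i <;> simp [conjSign]

theorem conjM_siteOp_shiftedSpin (a : h) (w : ℝ) (i : Fin 3) :
    conjM (siteOp a (shiftedSpin n w i)) = (conjSign i : ℂ) • siteOp a (shiftedSpin n w i) := by
  rw [conjM_siteOp, conjM_shiftedSpin, siteOp_smul]

theorem conjM_halfExponent (e : h ⊕ h ≃ Box d ℓ) (c : Fin 3 → Box d ℓ → Box d ℓ → ℝ)
    (w : h → ℝ) : conjM (halfExponent n e c w) = halfExponent n e c w := by
  have h1 : ∀ i, (conjSign i : ℂ) * (conjSign i : ℂ) = 1 := fun i => by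
    rw [← Complex.ofReal_mul, conjSign_mul_self, Complex.ofReal_one]
  have h2 : ∀ a, conjM (siteOp a (spin n 2)) = siteOp (I := h) a (spin n 2) := fun a => by
    rw [conjM_siteOp, conjM_spin]; simp [conjSign]
  simp only [halfExponent, map_sub, map_sum, conjM_smul, Complex.conj_ofReal, map_mul, map_pow,
    conjM_siteOp_shiftedSpin, h2, smul_mul_assoc, mul_smul_comm, smul_smul, h1, mul_one]
  simp [conjSign]

/-- Conjugating the right factor produces `conjSign i`, which cancels the sign in the Gram
factorisation `hg`. The factor `2` counts each cross pair in both orders and is the reason for `√2`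
in `halfCoupling`. -/
theorem sum_halfCoupling_kronecker [Fintype κ] (g : Fin 3 → κ → h → ℝ) (K : Fin 3 → h → h → ℝ)
    (hg : ∀ i a b, conjSign i * K i a b = ∑ k, g i k a * g i k b) (w w' : h → ℝ) :
    ∑ p, halfCoupling n g w p ⊗ₖ conjM (halfCoupling n g w' p) =
      ∑ i, ∑ a, ∑ b, ((2 * K i a b : ℝ) : ℂ) •
        (siteOp a (shiftedSpin n (w a) i) ⊗ₖ siteOp b (shiftedSpin n (w' b) i)) := by
  have hK : ∀ i a b, 2 * K i a b = ∑ k, 2 * (g i k a * g i k b * conjSign i) := fun i a b => by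
    rw [← Finset.mul_sum, ← Finset.sum_mul, ← hg, mul_right_comm, conjSign_mul_self, one_mul]
  have h2 : ((Real.sqrt 2 : ℝ) : ℂ) * ((Real.sqrt 2 : ℝ) : ℂ) = 2 := by
    rw [← Complex.ofReal_mul, Real.mul_self_sqrt (by norm_num)]; simp
  have hsum : ∀ (s : Finset h) (f : h → Matrix (h → Fin n) (h → Fin n) ℂ)
      (B : Matrix (h → Fin n) (h → Fin n) ℂ), (∑ a ∈ s, f a) ⊗ₖ B = ∑ a ∈ s, f a ⊗ₖ B :=
    fun s f B => map_sum (AddMonoidHom.mk' (fun A => A ⊗ₖ B) fun _ _ => Matrix.add_kronecker ..) f s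
  have hsum' : ∀ (s : Finset h) (f : h → Matrix (h → Fin n) (h → Fin n) ℂ)
      (B : Matrix (h → Fin n) (h → Fin n) ℂ), B ⊗ₖ (∑ a ∈ s, f a) = ∑ a ∈ s, B ⊗ₖ f a :=
    fun s f B => map_sum (AddMonoidHom.mk' (fun A => B ⊗ₖ A) fun _ _ => Matrix.kronecker_add ..) f s
  rw [Fintype.sum_prod_type]
  refine Finset.sum_congr rfl fun i _ => ?_
  simp only [halfCoupling, conjM_smul, map_sum, conjM_siteOp_shiftedSpin,
    Matrix.smul_kronecker, Matrix.kronecker_smul, smul_smul, map_mul, hsum, hsum', Finset.smul_sum]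
  rw [Finset.sum_comm]
  refine Finset.sum_congr rfl fun a _ => ?_
  rw [Finset.sum_comm]
  refine Finset.sum_congr rfl fun b _ => ?_
  rw [← Finset.sum_smul, hK]
  congr 1
  push_cast
  refine Finset.sum_congr rfl fun k _ => ?_
  simp only [Complex.conj_ofReal]
  linear_combination ((g i k b : ℂ) * conjSign i * g i k a) * h2

/-- Terms within one half act on one tensor factor, cross terms become `∑ C ⊗ D̄`. Mirror symmetry
of `c` makes both one-sided parts instances of the same `halfExponent`, evaluated at the two halves
of `v`. -/
theorem splitHom_exponent [Fintype κ] (e : h ⊕ h ≃ Box d ℓ)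
    (c : Fin 3 → Box d ℓ → Box d ℓ → ℝ) (hsymm : ∀ i x y, c i x y = c i y x)
    (hrefl : ∀ i a b, c i (e (Sum.inl a)) (e (Sum.inl b)) = c i (e (Sum.inr a)) (e (Sum.inr b)))
    (g : Fin 3 → κ → h → ℝ)
    (hg : ∀ i a b, conjSign i * c i (e (Sum.inl a)) (e (Sum.inr b)) = ∑ k, g i k a * g i k b)
    (v : Box d ℓ → ℝ) :
    splitHom n e (exponent n c v) =
      couplingExponent (halfExponent n e c fun a => v (e (Sum.inl a)))
        (halfExponent n e c fun a => v (e (Sum.inr a)))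
        (halfCoupling n g fun a => v (e (Sum.inl a)))
        (halfCoupling n g fun a => v (e (Sum.inr a))) := by
  -- A Gram matrix is symmetric in `a` and `b`, and `conjSign i` is nonzero.
  have hcross : ∀ i a b, c i (e (Sum.inr a)) (e (Sum.inl b)) =
      c i (e (Sum.inl a)) (e (Sum.inr b)) := fun i a b => by
    have h1 : conjSign i * c i (e (Sum.inr a)) (e (Sum.inl b)) =
        conjSign i * c i (e (Sum.inl a)) (e (Sum.inr b)) := by
      rw [hsymm, hg, hg]; exact Finset.sum_congr rfl fun k _ => mul_comm _ _
    refine mul_left_cancel₀ (fun h0 => ?_) h1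
    have := conjSign_mul_self i
    simp [h0] at this
  -- The coefficient of the single-site term sums over the whole box, so it needs the cross terms as
  -- well to agree at mirror sites.
  have hdiag : ∀ a, ∑ y, c 2 (e (Sum.inr a)) y = ∑ y, c 2 (e (Sum.inl a)) y := fun a => by
    rw [← e.sum_comp, ← e.sum_comp, Fintype.sum_sum_type, Fintype.sum_sum_type, add_comm]
    simp only [hcross, hrefl]
  have hB : halfExponent n e c (fun a => v (e (Sum.inr a))) =
      ∑ i, ∑ a, ∑ b, (c i (e (Sum.inr a)) (e (Sum.inr b)) : ℂ) •
        (siteOp a (shiftedSpin n (v (e (Sum.inr a))) i) *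
          siteOp b (shiftedSpin n (v (e (Sum.inr b))) i)) -
      ∑ a, ((∑ y, c 2 (e (Sum.inr a)) y : ℝ) : ℂ) •
        (siteOp a (shiftedSpin n (v (e (Sum.inr a))) 2) ^ 2 - siteOp a (spin n 2) ^ 2) := by
    simp only [halfExponent, hdiag, hrefl]
  rw [couplingExponent, conjM_halfExponent, sum_halfCoupling_kronecker g _ hg, hB]
  let φ : Matrix (h → Fin n) (h → Fin n) ℂ →+
      Matrix ((h → Fin n) × (h → Fin n)) ((h → Fin n) × (h → Fin n)) ℂ :=
    AddMonoidHom.mk' (fun A => A ⊗ₖ 1) fun _ _ => Matrix.add_kronecker ..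
  let ψ : Matrix (h → Fin n) (h → Fin n) ℂ →+
      Matrix ((h → Fin n) × (h → Fin n)) ((h → Fin n) × (h → Fin n)) ℂ :=
    AddMonoidHom.mk' (fun A => 1 ⊗ₖ A) fun _ _ => Matrix.kronecker_add ..
  have hφ : ∀ A, A ⊗ₖ (1 : Matrix (h → Fin n) (h → Fin n) ℂ) = φ A := fun _ => rfl
  have hψ : ∀ A, (1 : Matrix (h → Fin n) (h → Fin n) ℂ) ⊗ₖ A = ψ A := fun _ => rfl
  have φs : ∀ (x : ℂ) A, φ (x • A) = x • φ A := fun _ _ => Matrix.smul_kronecker ..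
  have ψs : ∀ (x : ℂ) A, ψ (x • A) = x • ψ A := fun _ _ => Matrix.kronecker_smul ..
  have φm : ∀ A B, φ (A * B) = φ A * φ B := fun A B => by
    simp only [← hφ, ← Matrix.mul_kronecker_mul, mul_one]
  have ψm : ∀ A B, ψ (A * B) = ψ A * ψ B := fun A B => by
    simp only [← hψ, ← Matrix.mul_kronecker_mul, mul_one]
  have φψ : ∀ A B, φ A * ψ B = A ⊗ₖ B := fun A B => by
    simp only [← hφ, ← hψ, ← Matrix.mul_kronecker_mul, mul_one, one_mul]
  have ψφ : ∀ A B, ψ B * φ A = A ⊗ₖ B := fun A B => by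
    simp only [← hφ, ← hψ, ← Matrix.mul_kronecker_mul, mul_one, one_mul]
  have h1 : ∀ i, splitHom n e (∑ x, ∑ y, (c i x y : ℂ) •
      (siteOp x (shiftedSpin n (v x) i) * siteOp y (shiftedSpin n (v y) i))) =
      φ (∑ a, ∑ b, (c i (e (Sum.inl a)) (e (Sum.inl b)) : ℂ) •
        (siteOp a (shiftedSpin n (v (e (Sum.inl a))) i) *
          siteOp b (shiftedSpin n (v (e (Sum.inl b))) i))) +
      ψ (∑ a, ∑ b, (c i (e (Sum.inr a)) (e (Sum.inr b)) : ℂ) •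
        (siteOp a (shiftedSpin n (v (e (Sum.inr a))) i) *
          siteOp b (shiftedSpin n (v (e (Sum.inr b))) i))) +
      ∑ a, ∑ b, ((2 * c i (e (Sum.inl a)) (e (Sum.inr b)) : ℝ) : ℂ) •
        (siteOp a (shiftedSpin n (v (e (Sum.inl a))) i) ⊗ₖ
          siteOp b (shiftedSpin n (v (e (Sum.inr b))) i)) := by
    intro i
    have hswap : ∑ a, ∑ b, (c i (e (Sum.inr a)) (e (Sum.inl b)) : ℂ) •
        (siteOp b (shiftedSpin n (v (e (Sum.inl b))) i) ⊗ₖ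
          siteOp a (shiftedSpin n (v (e (Sum.inr a))) i)) =
        ∑ a, ∑ b, (c i (e (Sum.inl a)) (e (Sum.inr b)) : ℂ) •
        (siteOp a (shiftedSpin n (v (e (Sum.inl a))) i) ⊗ₖ
          siteOp b (shiftedSpin n (v (e (Sum.inr b))) i)) := by
      rw [Finset.sum_comm]
      exact Finset.sum_congr rfl fun a _ => Finset.sum_congr rfl fun b _ => by rw [hsymm]
    simp only [map_sum, ← e.sum_comp, Fintype.sum_sum_type, map_add, map_smul, map_mul,
      splitHom_siteOp_inl,
      splitHom_siteOp_inr, hφ, hψ, φs, ψs, φm, ψm, φψ, ψφ, Finset.sum_add_distrib, hswap,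
      two_mul, Complex.ofReal_add, add_smul]
    abel
  have h2 : splitHom n e (∑ x, ∑ y, (c 2 x y : ℂ) •
      (siteOp x (shiftedSpin n (v x) 2) ^ 2 - siteOp x (spin n 2) ^ 2)) =
      φ (∑ a, ((∑ y, c 2 (e (Sum.inl a)) y : ℝ) : ℂ) •
        (siteOp a (shiftedSpin n (v (e (Sum.inl a))) 2) ^ 2 - siteOp a (spin n 2) ^ 2)) +
      ψ (∑ a, ((∑ y, c 2 (e (Sum.inr a)) y : ℝ) : ℂ) •
        (siteOp a (shiftedSpin n (v (e (Sum.inr a))) 2) ^ 2 - siteOp a (spin n 2) ^ 2)) := by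
    simp only [← Finset.sum_smul, ← Complex.ofReal_sum]
    rw [← e.sum_comp, Fintype.sum_sum_type]
    simp only [map_add, map_sum, map_smul, map_sub, map_mul, pow_two, splitHom_siteOp_inl,
      splitHom_siteOp_inr, hφ, hψ, φs, ψs, φm, ψm]
  rw [exponent, map_sub, h2, map_sum]
  simp only [h1, hφ, hψ, halfExponent, map_sub, map_sum φ, map_sum ψ,
    Finset.sum_add_distrib]
  abel

open scoped MatrixOrder Matrix.Norms.L2Operator in
theorem exists_factor_of_posSemidef {K : Matrix h h ℝ} (hK : K.PosSemidef) :
    ∃ G : h → h → ℝ, ∀ a b, K a b = ∑ k, G k a * G k b := by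
  obtain ⟨G, hG⟩ := CStarAlgebra.nonneg_iff_eq_star_mul_self.1 hK.nonneg
  exact ⟨G, fun a b => by rw [hG]; simp [Matrix.mul_apply, Matrix.star_apply]⟩

/-- **Reflection positivity**: the Cauchy-Schwarz inequality between the two halves. -/
theorem trace_exp_exponent_sq_le (hn : 0 < n) (e : h ⊕ h ≃ Box d ℓ)
    (c : Fin 3 → Box d ℓ → Box d ℓ → ℝ) (hsymm : ∀ i x y, c i x y = c i y x)
    (hrefl : ∀ i a b, c i (e (Sum.inl a)) (e (Sum.inl b)) = c i (e (Sum.inr a)) (e (Sum.inr b)))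
    (hpos : ∀ i, (Matrix.of fun a b : h =>
      conjSign i * c i (e (Sum.inl a)) (e (Sum.inr b))).PosSemidef)
    (v : Box d ℓ → ℝ) :
    ((NormedSpace.exp (exponent n c v)).trace.re ^ 2 ≤
      (NormedSpace.exp
        (exponent n c fun x => v (e (Sum.elim Sum.inl Sum.inl (e.symm x))))).trace.re *
      (NormedSpace.exp
        (exponent n c fun x => v (e (Sum.elim Sum.inr Sum.inr (e.symm x))))).trace.re) ∧
    0 ≤ (NormedSpace.exp
      (exponent n c fun x => v (e (Sum.elim Sum.inl Sum.inl (e.symm x))))).trace.re := by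
  have : Nonempty (h → Fin n) := ⟨fun _ => ⟨0, hn⟩⟩
  choose G hg using fun i => exists_factor_of_posSemidef (hpos i)
  have key := splitHom_exponent (n := n) e c hsymm hrefl G hg
  simp only [← trace_exp_splitHom e, key, Equiv.symm_apply_apply, Sum.elim_inl, Sum.elim_inr]
  refine ⟨le_trans ?_ (norm_trace_exp_couplingExponent_sq_le _ _ _ _),
    trace_exp_couplingExponent_self_nonneg _ _⟩
  rw [← sq_abs]
  gcongr
  exact Complex.abs_re_le_norm _

end Reflection

end

end QuantumSpin

namespace QuantumSpin

open Filter Topology Matrix MeasureTheory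

noncomputable section

/-! ### Reflection positive couplings -/

section Couplings

variable {d : ℕ}

/-- The difference between `x` and the reflection of `y` across the hyperplane at height `-1/2` in
direction `i`. -/
def reflDiff (i : Fin d) (x y : Fin d → ℤ) : Fin d → ℤ :=
  fun j => if j = i then x j + y j + 1 else x j - y j

theorem reflDiff_self (i : Fin d) (x y : Fin d → ℤ) : reflDiff i x y i = x i + y i + 1 := by
  simp [reflDiff]

theorem reflDiff_of_ne {i j : Fin d} (h : j ≠ i) (x y : Fin d → ℤ) :
    reflDiff i x y j = x j - y j := by simp [reflDiff, h]

/-- Positivity of the quadratic form of a coupling between a half-space and its reflection. -/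
def HalfSpacePositive (i : Fin d) (J : (Fin d → ℤ) → ℝ) : Prop :=
  ∀ (ι : Type) [Fintype ι] (p : ι → Fin d → ℤ) (f : ι → ℝ), (∀ a, 0 ≤ p a i) →
    0 ≤ ∑ a, ∑ b, f a * f b * J (reflDiff i (p a) (p b))

/-- Summable couplings that are even in each direction and reflection positive. -/
structure ReflectionPositive (J : (Fin d → ℤ) → ℝ) : Prop where
  summable : Summable J
  flip : ∀ i x, J (Function.update x i (-x i)) = J x
  neg : ∀ x, J (-x) = J x
  pos : ∀ i, HalfSpacePositive i J

/-- A point and a reflected point are at height difference at least `0 + 0 + 1`. In particular `J 0`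
never matters. -/
theorem HalfSpacePositive.congr {i : Fin d} {J K : (Fin d → ℤ) → ℝ} (hK : HalfSpacePositive i K)
    (h : ∀ x, 1 ≤ x i → J x = K x) : HalfSpacePositive i J := by
  intro ι _ p f hp
  refine (hK ι p f hp).trans_eq (Finset.sum_congr rfl fun a _ => Finset.sum_congr rfl fun b _ => ?_)
  rw [h _ (by rw [reflDiff_self]; linarith [hp a, hp b])]

theorem HalfSpacePositive.const_mul {i : Fin d} {K : (Fin d → ℤ) → ℝ}
    (hK : HalfSpacePositive i K) {a : ℝ} (ha : 0 ≤ a) :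
    HalfSpacePositive i (fun x => a * K x) := by
  intro ι _ p f hp
  have := mul_nonneg ha (hK ι p f hp)
  simp only [Finset.mul_sum] at this
  refine this.trans_eq (Finset.sum_congr rfl fun a _ => Finset.sum_congr rfl fun b _ => ?_)
  ring

theorem HalfSpacePositive.add {i : Fin d} {J K : (Fin d → ℤ) → ℝ}
    (hJ : HalfSpacePositive i J) (hK : HalfSpacePositive i K) :
    HalfSpacePositive i (fun x => J x + K x) := by
  intro ι _ p f hp
  have := add_nonneg (hJ ι p f hp) (hK ι p f hp)
  simp only [← Finset.sum_add_distrib] at this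
  refine this.trans_eq (Finset.sum_congr rfl fun a _ => Finset.sum_congr rfl fun b _ => ?_)
  ring

/-- Positivity survives superposition. All couplings given by integrals or walks are reduced through
this to kernels of a simpler kind. -/
theorem HalfSpacePositive.integral {i : Fin d} {α : Type*} [MeasurableSpace α] {μ : Measure α}
    {J : (Fin d → ℤ) → ℝ} {F : α → (Fin d → ℤ) → ℝ} (hF : ∀ᵐ t ∂μ, HalfSpacePositive i (F t))
    (hint : ∀ x, 1 ≤ x i → Integrable (fun t => F t x) μ)
    (hJ : ∀ x, 1 ≤ x i → J x = ∫ t, F t x ∂μ) : HalfSpacePositive i J := by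
  intro ι _ p f hp
  have h1 : ∀ a b, 1 ≤ reflDiff i (p a) (p b) i := fun a b => by
    rw [reflDiff_self]; linarith [hp a, hp b]
  have e : ∑ a, ∑ b, f a * f b * J (reflDiff i (p a) (p b)) =
      ∫ t, ∑ a, ∑ b, f a * f b * F t (reflDiff i (p a) (p b)) ∂μ := by
    rw [integral_finsetSum _ fun a _ => integrable_finsetSum _ fun b _ =>
      (hint _ (h1 a b)).const_mul _]
    refine Finset.sum_congr rfl fun a _ => ?_
    rw [integral_finsetSum _ fun b _ => (hint _ (h1 a b)).const_mul _]
    refine Finset.sum_congr rfl fun b _ => ?_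
    rw [integral_const_mul, hJ _ (h1 a b)]
  rw [e]
  exact integral_nonneg_of_ae (hF.mono fun t ht => ht ι p f hp)

theorem ReflectionPositive.add {J K : (Fin d → ℤ) → ℝ} (hJ : ReflectionPositive J)
    (hK : ReflectionPositive K) : ReflectionPositive (fun x => J x + K x) where
  summable := hJ.summable.add hK.summable
  flip i x := by rw [hJ.flip, hK.flip]
  neg x := by rw [hJ.neg, hK.neg]
  pos i := (hJ.pos i).add (hK.pos i)

theorem ReflectionPositive.const_mul {J : (Fin d → ℤ) → ℝ} (hJ : ReflectionPositive J) {a : ℝ}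
    (ha : 0 ≤ a) : ReflectionPositive (fun x => a * J x) where
  summable := hJ.summable.mul_left a
  flip i x := by rw [hJ.flip]
  neg x := by rw [hJ.neg]
  pos i := (hJ.pos i).const_mul ha

theorem convex_reflectionPositive : Convex ℝ {J : (Fin d → ℤ) → ℝ | ReflectionPositive J} :=
  fun _ hJ _ hK _ _ ha hb _ => (hJ.const_mul ha).add (hK.const_mul hb)

/-- A nonnegative coupling that is, off the origin, a multiple of a nonnegative reflection positive
one is reflection positive. -/
theorem ReflectionPositive.of_eq_mul {J K : (Fin d → ℤ) → ℝ} (hK : ReflectionPositive K)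
    (hK0 : ∀ x, x ≠ 0 → 0 ≤ K x) {a : ℝ} (h : ∀ x, x ≠ 0 → J x = a * K x) (hJ : ∀ x, 0 ≤ J x) :
    ReflectionPositive J := by
  obtain ⟨a, ha, h⟩ : ∃ a : ℝ, 0 ≤ a ∧ ∀ x, x ≠ 0 → J x = a * K x := by
    rcases le_total 0 a with ha | ha
    · exact ⟨a, ha, h⟩
    -- If `a ≤ 0`, then `0 ≤ J x = a * K x ≤ 0` off the origin, so `a` may be replaced by `0`.
    · refine ⟨0, le_rfl, fun x hx => ?_⟩
      rw [zero_mul]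
      refine le_antisymm ?_ (hJ x)
      rw [h x hx]
      exact mul_nonpos_of_nonpos_of_nonneg ha (hK0 x hx)
  have hflip : ∀ (i : Fin d) (x : Fin d → ℤ), x ≠ 0 → Function.update x i (-x i) ≠ 0 :=
      fun i x hx h0 => hx <| by
    funext j
    have := congrFun h0 j
    by_cases hj : j = i
    · subst hj
      rw [Function.update_self] at this
      exact neg_eq_zero.1 this
    · simpa [hj] using this
  refine ⟨?_, fun i x => ?_, fun x => ?_, fun i => ?_⟩
  · refine (hK.summable.mul_left a).congr_cofinite ?_
    refine (Set.finite_singleton (0 : Fin d → ℤ)).subset fun x hx => ?_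
    by_contra h0
    exact hx (h x h0).symm
  · by_cases hx : x = 0
    · subst hx; congr 1; funext j; by_cases hj : j = i <;> simp [Function.update, hj]
    · rw [h _ (hflip i x hx), h x hx, hK.flip]
  · by_cases hx : x = 0
    · simp [hx]
    · rw [h _ (neg_ne_zero.2 hx), h x hx, hK.neg]
  · refine ((hK.pos i).const_mul ha).congr fun x hx => h x fun h0 => ?_
    rw [h0] at hx; simp at hx

/-! ### Summability on the lattice -/

theorem summable_norm_rpow_pi {s : ℝ} (hs : (d : ℝ) < s) :
    Summable fun x : Fin d → ℤ => ‖x‖ ^ (-s) := by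
  let L : Submodule ℤ (Fin d → ℝ) := Submodule.span ℤ (Set.range (Pi.basisFun ℝ (Fin d)))
  have hrank : Module.finrank ℤ L = d := by
    rw [ZLattice.rank ℝ L]; simp
  have h := ZLattice.summable_norm_rpow L (-s) (by rw [hrank]; linarith)
  have hmem : ∀ x : Fin d → ℤ, (fun j => (x j : ℝ)) ∈ L := fun x => by
    exact ((Pi.basisFun ℝ (Fin d)).mem_span_iff_repr_mem ℤ _).2 fun j => ⟨x j, by simp⟩
  let φ : (Fin d → ℤ) → L := fun x => ⟨fun j => (x j : ℝ), hmem x⟩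
  have hφ : Function.Injective φ := fun x y hxy => by
    funext j
    have : (x j : ℝ) = y j := congrFun (congrArg Subtype.val hxy) j
    exact_mod_cast this
  refine (h.comp_injective hφ).congr fun x => ?_
  have : ‖φ x‖ = ‖x‖ := by
    change ‖fun j => (x j : ℝ)‖ = ‖x‖
    rw [Pi.norm_def, Pi.norm_def]
    congr 2
  simp only [Function.comp, this]

theorem summable_of_le_norm_rpow {J : (Fin d → ℤ) → ℝ} {C s : ℝ} (hs : (d : ℝ) < s)
    (h : ∀ x, x ≠ 0 → |J x| ≤ C * ‖x‖ ^ (-s)) : Summable J := by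
  have h1 := (summable_norm_rpow_pi hs).mul_left C
  refine Summable.of_norm_bounded_eventually h1 ?_
  refine (Set.finite_singleton (0 : Fin d → ℤ)).subset fun x hx => ?_
  by_contra h0
  exact hx (h x h0)

theorem norm_le_norm1 (x : Fin d → ℤ) : ‖x‖ ≤ (norm1 x : ℝ) := by
  have h0 : (0 : ℝ) ≤ (norm1 x : ℝ) := by
    exact_mod_cast Finset.sum_nonneg fun i _ => abs_nonneg (x i)
  refine (pi_norm_le_iff_of_nonneg h0).2 fun i => ?_
  rw [Int.norm_eq_abs]
  exact_mod_cast Finset.single_le_sum (f := fun i => |x i|) (fun i _ => abs_nonneg _)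
    (Finset.mem_univ i)

theorem norm_le_norm2 (x : Fin d → ℤ) : ‖x‖ ≤ norm2 x := by
  refine (pi_norm_le_iff_of_nonneg (Real.sqrt_nonneg _)).2 fun i => ?_
  rw [Int.norm_eq_abs]
  refine Real.abs_le_sqrt ?_
  exact Finset.single_le_sum (f := fun i => (x i : ℝ) ^ 2) (fun i _ => sq_nonneg _)
    (Finset.mem_univ i)

theorem norm1_neg (x : Fin d → ℤ) : norm1 (-x) = norm1 x := by simp [norm1]

theorem norm1_flip (i : Fin d) (x : Fin d → ℤ) :
    norm1 (Function.update x i (-x i)) = norm1 x := by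
  refine Finset.sum_congr rfl fun j _ => ?_
  by_cases hj : j = i
  · subst hj; simp
  · simp [hj]

theorem norm2_neg (x : Fin d → ℤ) : norm2 (-x) = norm2 x := by simp [norm2]

theorem norm2_flip (i : Fin d) (x : Fin d → ℤ) :
    norm2 (Function.update x i (-x i)) = norm2 x := by
  rw [norm2, norm2]
  congr 1
  refine Finset.sum_congr rfl fun j _ => ?_
  by_cases hj : j = i
  · subst hj; simp
  · simp [hj]

/-! ### Nearest-neighbour couplings -/

theorem sum_sum_sum_mul {ι γ : Type*} [Fintype ι] (s : Finset γ) (c : γ → ℝ) (u : γ → ι → ℝ) :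
    ∑ a, ∑ b, ∑ z ∈ s, c z * (u z a * u z b) = ∑ z ∈ s, c z * (∑ a, u z a) ^ 2 := by
  refine ((Finset.sum_congr rfl fun a _ => Finset.sum_comm).trans Finset.sum_comm).trans
    (Finset.sum_congr rfl fun z _ => ?_)
  rw [pow_two, Finset.sum_mul_sum]
  simp only [Finset.mul_sum]

/-- A bond crosses the plane only between a site of the bottom layer and its own mirror image, so
the kernel is diagonal. Grouping the indices by their point `z` allows for repetitions in `p` and
gives a sum of squares. -/
theorem reflectionPositive_nearestNeighbour :
    ReflectionPositive (fun x : Fin d → ℤ => if norm1 x = 1 then (1 : ℝ) else 0) where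
  summable := by
    refine summable_of_le_norm_rpow (C := 1) (s := d + 1) (by linarith) fun x hx => ?_
    have hx0 : 0 < ‖x‖ := norm_pos_iff.2 hx
    split_ifs with h
    · have := norm_le_norm1 x
      rw [h] at this
      simp only [abs_one, one_mul]
      exact Real.one_le_rpow_of_pos_of_le_one_of_nonpos hx0 (by simpa using this)
        (by linarith [Nat.cast_nonneg (α := ℝ) d])
    · simp only [abs_zero, one_mul]; positivity
  flip i x := by rw [norm1_flip]
  neg x := by rw [norm1_neg]
  pos i := by
    intro ι _ p f hp
    classical
    let g : ι → ℝ := fun a => if p a i = 0 then f a else 0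
    have key : ∀ a b, f a * f b * (if norm1 (reflDiff i (p a) (p b)) = 1 then (1 : ℝ) else 0) =
        ∑ z ∈ Finset.univ.image p, (if p a = z then g a else 0) * (if p b = z then g b else 0) := by
      intro a b
      have hiff : norm1 (reflDiff i (p a) (p b)) = 1 ↔ p a i = 0 ∧ p a = p b := by
        have e : norm1 (reflDiff i (p a) (p b)) =
            (p a i + p b i + 1) + ∑ j ∈ Finset.univ.erase i, |p a j - p b j| := by
          rw [norm1, ← Finset.add_sum_erase _ _ (Finset.mem_univ i), reflDiff_self,
            abs_of_nonneg (by linarith [hp a, hp b])]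
          congr 1
          exact Finset.sum_congr rfl fun j hj => by
            rw [reflDiff_of_ne (Finset.ne_of_mem_erase hj)]
        have hs : 0 ≤ ∑ j ∈ Finset.univ.erase i, |p a j - p b j| :=
          Finset.sum_nonneg fun j _ => abs_nonneg _
        have ha := hp a
        have hb := hp b
        constructor
        · intro h
          have h0 : ∑ j ∈ Finset.univ.erase i, |p a j - p b j| = 0 := by omega
          rw [Finset.sum_eq_zero_iff_of_nonneg fun j _ => abs_nonneg _] at h0
          refine ⟨by omega, funext fun j => ?_⟩
          by_cases hj : j = i
          · subst hj; omega
          · have := abs_eq_zero.1 (h0 j (Finset.mem_erase.2 ⟨hj, Finset.mem_univ j⟩))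
            omega
        · rintro ⟨h1, h2⟩
          rw [e, ← h2, h1]; simp
      rw [Finset.sum_eq_single (p a)]
      · by_cases h1 : p a = p b
        · by_cases h2 : p b i = 0
          · rw [if_pos (hiff.2 ⟨h1 ▸ h2, h1⟩)]; simp [g, h1, h2]
          · rw [if_neg fun h => h2 (h1 ▸ (hiff.1 h).1)]; simp [g, h1, h2]
        · rw [if_neg (by rw [hiff]; tauto), if_neg (fun h : p b = p a => h1 h.symm)]; simp
      · intro z _ hz
        rw [if_neg (Ne.symm hz), zero_mul]
      · intro h; exact absurd (Finset.mem_image_of_mem p (Finset.mem_univ a)) h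
    simp only [key]
    have := sum_sum_sum_mul (Finset.univ.image p) (fun _ => 1) fun z a => if p a = z then g a else 0
    simp only [one_mul] at this
    rw [this]
    exact Finset.sum_nonneg fun z _ => sq_nonneg _

/-! ### Yukawa couplings and power laws -/

/-- Write `-b|m - n| = -bm - bn + 2b min(m, n)`. The first two terms are absorbed in the test
vector, and `exp (2b min(m, n))` is `1` plus the nonnegative increments of `G`, each multiplying the
rank-one kernel `1_{k<m} 1_{k<n}`. -/
theorem posSemidef_exp_neg_abs_sub {b : ℝ} (hb : 0 ≤ b) {ι : Type*} [Fintype ι] (p : ι → ℤ) :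
    (Matrix.of fun x y : ι => Real.exp (-b * |(p x : ℝ) - p y|)).PosSemidef := by
  classical
  -- Only differences matter, so the finitely many points are translated into `{0, …, N}`.
  obtain ⟨M, hM⟩ : ∃ M : ℤ, ∀ x, M ≤ p x := by
    obtain ⟨M, hM⟩ := (Set.finite_range p).bddBelow
    exact ⟨M, fun x => hM ⟨x, rfl⟩⟩
  choose q hq using fun x => Int.eq_ofNat_of_zero_le (sub_nonneg.2 (hM x))
  obtain ⟨N, hN⟩ : ∃ N : ℕ, ∀ x, q x ≤ N := by
    obtain ⟨N, hN⟩ := (Set.finite_range q).bddAbove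
    exact ⟨N, fun x => hN ⟨x, rfl⟩⟩
  have hq' : ∀ x, (p x : ℝ) = M + q x := fun x => by
    have : p x = M + q x := by linarith [hq x]
    rw [this]; push_cast; rfl
  let G : ℕ → ℝ := fun k => Real.exp (2 * b * k)
  have hG : Monotone G := fun k l h => Real.exp_le_exp.2 (by gcongr)
  have hsum : ∀ m n : ℕ, m ≤ N → n ≤ N → Real.exp (2 * b * (min m n : ℕ)) =
      1 + ∑ k ∈ Finset.range N, (G (k + 1) - G k) *
        ((if k < m then 1 else 0) * (if k < n then 1 else 0)) := by
    intro m n hm hn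
    have h1 : ∑ k ∈ Finset.range N, (G (k + 1) - G k) *
        ((if k < m then 1 else 0) * (if k < n then 1 else 0)) =
        ∑ k ∈ Finset.range (min m n), (G (k + 1) - G k) := by
      rw [← Finset.sum_subset (Finset.range_subset_range.2 ((min_le_left m n).trans hm))]
      · refine Finset.sum_congr rfl fun k hk => ?_
        have := Finset.mem_range.1 hk
        rw [if_pos (by omega), if_pos (by omega)]; ring
      · intro k _ hk
        have : ¬ (k < m ∧ k < n) := fun h => hk (Finset.mem_range.2 (lt_min h.1 h.2))
        by_cases h : k < m
        · rw [if_neg (fun h' : k < n => this ⟨h, h'⟩)]; simp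
        · rw [if_neg h]; simp
    rw [h1, Finset.sum_range_sub]; simp [G]
  refine Matrix.PosSemidef.of_dotProduct_mulVec_nonneg ?_ fun f => ?_
  · ext x y; simp [abs_sub_comm]
  let g : ι → ℝ := fun x => f x * Real.exp (-b * q x)
  have key : ∀ x y, f x * (Real.exp (-b * |(p x : ℝ) - p y|) * f y) =
      g x * g y + ∑ k ∈ Finset.range N, (G (k + 1) - G k) *
        ((g x * if k < q x then 1 else 0) * (g y * if k < q y then 1 else 0)) := by
    intro x y
    have e : -b * |(p x : ℝ) - p y| = -b * q x + -b * q y + 2 * b * (min (q x) (q y) : ℕ) := by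
      rw [hq', hq']
      rcases le_total (q x) (q y) with h | h
      · rw [min_eq_left h, abs_of_nonpos]
        · ring
        · have : (q x : ℝ) ≤ q y := by exact_mod_cast h
          linarith
      · rw [min_eq_right h, abs_of_nonneg]
        · ring
        · have : (q y : ℝ) ≤ q x := by exact_mod_cast h
          linarith
    rw [e, Real.exp_add, Real.exp_add, hsum _ _ (hN x) (hN y)]
    simp only [g, mul_add, Finset.mul_sum, Finset.sum_mul, add_mul]
    congr 1
    · ring
    · exact Finset.sum_congr rfl fun k _ => by ring
  have : star f ⬝ᵥ (Matrix.of fun x y : ι => Real.exp (-b * |(p x : ℝ) - p y|)) *ᵥ f =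
      (∑ x, g x) ^ 2 + ∑ k ∈ Finset.range N, (G (k + 1) - G k) *
        (∑ x, g x * if k < q x then 1 else 0) ^ 2 := by
    simp only [dotProduct, mulVec, Pi.star_apply, star_trivial, Matrix.of_apply, Finset.mul_sum,
      key,
      Finset.sum_add_distrib]
    rw [pow_two, Finset.sum_mul_sum, sum_sum_sum_mul (Finset.range N) (fun k => G (k + 1) - G k)
      fun k x => g x * if k < q x then 1 else 0]
  rw [this]
  exact add_nonneg (sq_nonneg _) (Finset.sum_nonneg fun k _ =>
    mul_nonneg (sub_nonneg.2 (hG k.le_succ)) (sq_nonneg _))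

/-- Product over the coordinates, by the Schur product theorem. -/
theorem posSemidef_exp_neg_sum_abs_sub {b : ℝ} (hb : 0 ≤ b) {ι κ : Type*} [Fintype ι]
    (p : ι → κ → ℤ) (s : Finset κ) :
    (Matrix.of fun x y : ι => Real.exp (-b * ∑ j ∈ s, |(p x j : ℝ) - p y j|)).PosSemidef := by
  classical
  induction s using Finset.induction_on with
  | empty =>
    have := Matrix.posSemidef_vecMulVec_self_star (fun _ : ι => (1 : ℝ))
    convert! this using 1
    ext x y; simp [Matrix.vecMulVec_apply]
  | insert j s hj ih =>
    convert! (posSemidef_exp_neg_abs_sub hb fun x => p x j).hadamard ih using 1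
    ext x y
    simp only [Matrix.of_apply, Matrix.hadamard_apply, Finset.sum_insert hj, mul_add, Real.exp_add]

/-- Across the plane the normal distance is `x_i + y_i + 1` without absolute value, so its
exponential factorises into the test vector and only the transverse kernel remains. -/
theorem halfSpacePositive_yukawa {b : ℝ} (hb : 0 ≤ b) (i : Fin d) :
    HalfSpacePositive i fun x => Real.exp (-b * (norm1 x : ℝ)) := by
  intro ι _ p f hp
  have h := (posSemidef_exp_neg_sum_abs_sub hb p (Finset.univ.erase i)).dotProduct_mulVec_nonneg
    fun a => f a * Real.exp (-b * p a i)
  have h2 := mul_nonneg (Real.exp_pos (-b)).le h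
  refine h2.trans_eq ?_
  simp only [dotProduct, mulVec, Pi.star_apply, star_trivial, Matrix.of_apply, Finset.mul_sum]
  refine Finset.sum_congr rfl fun x _ => Finset.sum_congr rfl fun y _ => ?_
  have e : (norm1 (reflDiff i (p x) (p y)) : ℝ) =
      (p x i + p y i + 1) + ∑ j ∈ Finset.univ.erase i, |(p x j : ℝ) - p y j| := by
    rw [norm1, ← Finset.add_sum_erase _ _ (Finset.mem_univ i), reflDiff_self,
      abs_of_nonneg (by linarith [hp x, hp y])]
    push_cast
    congr 1
    exact Finset.sum_congr rfl fun j hj => by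
      rw [reflDiff_of_ne (Finset.ne_of_mem_erase hj)]; push_cast; rfl
  rw [e, ← Finset.mul_sum, mul_add, mul_add, mul_add, Real.exp_add, Real.exp_add, Real.exp_add,
    mul_one]
  ring

theorem reflectionPositive_yukawa {b : ℝ} (hb : 0 < b) :
    ReflectionPositive fun x : Fin d → ℤ => Real.exp (-b * (norm1 x : ℝ)) where
  summable := by
    -- From `exp t ≥ t ^ (d + 1) / (d + 1)!` at `t = b‖x‖`.
    refine summable_of_le_norm_rpow (C := (d + 1).factorial / b ^ (d + 1)) (s := (d + 1 : ℕ))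
      (by push_cast; linarith) fun x hx => ?_
    have hx0 : 0 < ‖x‖ := norm_pos_iff.2 hx
    rw [abs_of_pos (Real.exp_pos _), Real.rpow_neg hx0.le, Real.rpow_natCast]
    have h1 := Real.pow_div_factorial_le_exp (b * ‖x‖) (by positivity) (d + 1)
    have h2 : Real.exp (-b * (norm1 x : ℝ)) ≤ (Real.exp (b * ‖x‖))⁻¹ := by
      rw [← Real.exp_neg]
      refine Real.exp_le_exp.2 ?_
      nlinarith [norm_le_norm1 x]
    refine h2.trans ((inv_anti₀ (by positivity) h1).trans_eq ?_)
    rw [mul_pow]; field_simp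
  flip i x := by rw [norm1_flip]
  neg x := by rw [norm1_neg]
  pos i := halfSpacePositive_yukawa hb.le i

/-- The integral of a non-integrable function is `0` by convention, so the positive value given by
the Gamma function proves integrability. -/
theorem integrableOn_rpow_mul_exp_neg_mul {s r : ℝ} (hs : 0 < s) (hr : 0 < r) :
    IntegrableOn (fun t : ℝ => t ^ (s - 1) * Real.exp (-(r * t))) (Set.Ioi 0) := by
  refine .of_integral_ne_zero ?_
  rw [Real.integral_rpow_mul_exp_neg_mul_Ioi hs hr]
  have := Real.Gamma_pos_of_pos hs
  positivity

theorem rpow_neg_eq_integral {s r : ℝ} (hs : 0 < s) (hr : 0 < r) :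
    r ^ (-s) = ∫ t in Set.Ioi (0 : ℝ), (Real.Gamma s)⁻¹ * (t ^ (s - 1) * Real.exp (-(r * t))) := by
  have := (Real.Gamma_pos_of_pos hs).ne'
  rw [integral_const_mul, Real.integral_rpow_mul_exp_neg_mul_Ioi hs hr, one_div,
    Real.inv_rpow hr.le, Real.rpow_neg hr.le]
  field_simp

/-- The Gamma integral exhibits the power law as a mixture of Yukawa couplings with rates `t > 0`.
Summability does not pass through the mixture and comes directly from `s > d`. -/
theorem reflectionPositive_powerLaw {s : ℝ} (hs : (d : ℝ) < s) :
    ReflectionPositive fun x : Fin d → ℤ => (norm1 x : ℝ) ^ (-s) where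
  summable := by
    refine summable_of_le_norm_rpow (C := 1) hs fun x hx => ?_
    have hx0 : 0 < ‖x‖ := norm_pos_iff.2 hx
    have h1 := norm_le_norm1 x
    rw [one_mul, abs_of_nonneg (Real.rpow_nonneg (hx0.le.trans h1) _)]
    exact Real.rpow_le_rpow_of_nonpos hx0 h1 (by linarith [Nat.cast_nonneg (α := ℝ) d])
  flip i x := by rw [norm1_flip]
  neg x := by rw [norm1_neg]
  pos i := by
    have hs0 : 0 < s := lt_of_le_of_lt (Nat.cast_nonneg d) hs
    have hx0 : ∀ x : Fin d → ℤ, 1 ≤ x i → (0 : ℝ) < norm1 x := fun x hx =>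
      lt_of_lt_of_le (norm_pos_iff.2 fun h => by rw [h] at hx; simp at hx) (norm_le_norm1 x)
    refine HalfSpacePositive.integral (μ := volume.restrict (Set.Ioi 0))
      (F := fun t x => (Real.Gamma s)⁻¹ * (t ^ (s - 1) * Real.exp (-((norm1 x : ℝ) * t))))
      ?_ (fun x hx => (integrableOn_rpow_mul_exp_neg_mul hs0 (hx0 x hx)).const_mul _)
      fun x hx => rpow_neg_eq_integral hs0 (hx0 x hx)
    filter_upwards [ae_restrict_mem measurableSet_Ioi] with t ht
    have ht' : (0 : ℝ) < t := ht
    have hG := Real.Gamma_pos_of_pos hs0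
    refine ((halfSpacePositive_yukawa ht'.le i).const_mul
      (a := (Real.Gamma s)⁻¹ * t ^ (s - 1)) (by positivity)).congr fun x _ => ?_
    rw [mul_assoc]; congr 3; ring

end Couplings

end

end QuantumSpin

namespace QuantumSpin

open Filter Topology Matrix MeasureTheory
open scoped ENNReal

noncomputable section

/-! ### Walks on the lattice -/

section Walks

variable {d : ℕ}

/-- The signed unit vectors of `ℤ^d`. -/
def unitStep (s : Fin d × Bool) : Fin d → ℤ := Pi.single s.1 (if s.2 then 1 else -1)

theorem norm1_unitStep (s : Fin d × Bool) : norm1 (unitStep s) = 1 := by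
  rw [norm1, Finset.sum_eq_single s.1]
  · rw [unitStep, Pi.single_eq_same]; split_ifs <;> simp
  · intro j _ hj; simp [unitStep, Pi.single_eq_of_ne hj]
  · simp

theorem exists_unitStep_eq {z : Fin d → ℤ} (hz : norm1 z = 1) : ∃ s, unitStep s = z := by
  obtain ⟨i, hi⟩ : ∃ i, z i ≠ 0 := by
    by_contra! h
    simp [norm1, h] at hz
  rw [norm1, ← Finset.add_sum_erase _ _ (Finset.mem_univ i)] at hz
  have h1 : 0 < |z i| := abs_pos.2 hi
  have h2 : 0 ≤ ∑ j ∈ Finset.univ.erase i, |z j| := Finset.sum_nonneg fun j _ => abs_nonneg _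
  have h3 : ∑ j ∈ Finset.univ.erase i, |z j| = 0 := by omega
  have h4 : |z i| = 1 := by omega
  rw [Finset.sum_eq_zero_iff_of_nonneg fun j _ => abs_nonneg _] at h3
  have h5 : ∀ j, j ≠ i → z j = 0 := fun j hj =>
    abs_eq_zero.1 (h3 j (Finset.mem_erase.2 ⟨hj, Finset.mem_univ j⟩))
  refine ⟨(i, decide (z i = 1)), funext fun j => ?_⟩
  by_cases hj : j = i
  · subst hj
    rcases eq_or_eq_neg_of_abs_eq h4 with h | h <;> simp [unitStep, h]
  · rw [unitStep, Pi.single_eq_of_ne hj, h5 j hj]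

theorem unitStep_injective : Function.Injective (unitStep (d := d)) := by
  rintro ⟨i, b⟩ ⟨j, c⟩ h
  have hij : i = j := by
    by_contra hne
    have := congrFun h i
    rw [unitStep, unitStep, Pi.single_eq_same, Pi.single_eq_of_ne hne] at this
    split_ifs at this
    all_goals simp at this
  subst hij
  have := congrFun h i
  simp only [unitStep, Pi.single_eq_same] at this
  cases b <;> cases c <;> simp_all

/-- The neighbours of a site are indexed by the signed unit vectors. -/
def neighborEquiv (y : Fin d → ℤ) : Fin d × Bool ≃ {z // (latticeGraph d).Adj y z} :=
  Equiv.ofBijective (fun s => ⟨y + unitStep s, by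
      change norm1 (y - (y + unitStep s)) = 1
      rw [sub_add_cancel_left, norm1_neg, norm1_unitStep]⟩) <| by
    refine ⟨fun s t h => unitStep_injective (add_left_cancel (congrArg Subtype.val h)), ?_⟩
    rintro ⟨z, hz⟩
    have hz' : norm1 (y - z) = 1 := hz
    obtain ⟨s, hs⟩ := exists_unitStep_eq (z := z - y) (by rw [← norm1_neg, neg_sub, hz'])
    exact ⟨s, Subtype.ext (by simp [hs])⟩

/-- The weight of the walks of length `N` from `y` to `x`. -/
def walkWeight (Q : ℝ≥0∞) (N : ℕ) (y x : Fin d → ℤ) : ℝ≥0∞ :=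
  ∑' w : (latticeGraph d).Walk y x, if w.length = N then Q ^ N else 0

theorem walkWeight_zero (Q : ℝ≥0∞) (y x : Fin d → ℤ) :
    walkWeight Q 0 y x = if y = x then 1 else 0 := by
  rw [walkWeight]
  by_cases h : y = x
  · subst h
    rw [if_pos rfl, tsum_eq_single SimpleGraph.Walk.nil]
    · simp
    · intro w hw
      rw [if_neg]
      intro h0
      exact hw (SimpleGraph.Walk.eq_nil_iff_nil.2 (SimpleGraph.Walk.length_eq_zero_iff.1 h0))
  · rw [if_neg h, ENNReal.tsum_eq_zero]
    intro w
    rw [if_neg]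
    intro h0
    exact h (SimpleGraph.Walk.eq_of_length_eq_zero h0)

/-- Decomposition by the first step. Weights in `ℝ≥0∞` make every rearrangement of the sum
legitimate before finiteness is known. -/
theorem walkWeight_succ (Q : ℝ≥0∞) (N : ℕ) (y x : Fin d → ℤ) :
    walkWeight Q (N + 1) y x = Q * ∑ s, walkWeight Q N (y + unitStep s) x := by
  let φ : (Σ z : {z // (latticeGraph d).Adj y z}, (latticeGraph d).Walk z.1 x) →
      (latticeGraph d).Walk y x := fun p => SimpleGraph.Walk.cons p.1.2 p.2
  have hφ : Function.Injective φ := by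
    rintro ⟨⟨z, hz⟩, p⟩ ⟨⟨z', hz'⟩, p'⟩ h
    simp only [φ, SimpleGraph.Walk.cons.injEq] at h
    obtain ⟨h1, h2⟩ := h
    subst h1
    rw [eq_of_heq h2]
  rw [walkWeight, ← hφ.tsum_eq, ENNReal.tsum_sigma', ← (neighborEquiv y).tsum_eq, tsum_fintype,
    Finset.mul_sum]
  · refine Finset.sum_congr rfl fun s _ => ?_
    rw [walkWeight, ← ENNReal.tsum_mul_left]
    refine tsum_congr fun w => ?_
    simp only [φ, SimpleGraph.Walk.length_cons, add_left_inj, mul_ite, mul_zero, pow_succ']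
    rfl
  · intro w hw
    cases w with
    | nil => simp at hw
    | cons h p => exact ⟨⟨⟨_, h⟩, p⟩, rfl⟩

theorem tsum_walkWeight_le (Q : ℝ≥0∞) (N : ℕ) (y : Fin d → ℤ) :
    ∑' x, walkWeight Q N y x ≤ (2 * d * Q) ^ N := by
  induction N generalizing y with
  | zero => simp [walkWeight_zero]
  | succ N ih =>
    simp only [walkWeight_succ]
    rw [ENNReal.tsum_mul_left, Summable.tsum_finsetSum fun _ _ => ENNReal.summable, pow_succ']
    calc Q * ∑ s, ∑' x, walkWeight Q N (y + unitStep s) x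
        ≤ Q * ∑ _s : Fin d × Bool, (2 * d * Q) ^ N := by gcongr; exact ih _
      _ = 2 * d * Q * (2 * d * Q) ^ N := by
          rw [Finset.sum_const, Finset.card_univ, Fintype.card_prod, Fintype.card_fin,
            Fintype.card_bool, nsmul_eq_mul]
          push_cast; ring

/-- The weight of all walks from `y` to `x`. -/
def walkTotal (Q : ℝ≥0∞) (y x : Fin d → ℤ) : ℝ≥0∞ :=
  ∑' w : (latticeGraph d).Walk y x, Q ^ w.length

theorem walkTotal_eq_tsum (Q : ℝ≥0∞) (y x : Fin d → ℤ) :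
    walkTotal Q y x = ∑' N, walkWeight Q N y x := by
  simp only [walkWeight]
  rw [ENNReal.tsum_comm, walkTotal]
  refine tsum_congr fun w => ?_
  rw [tsum_eq_single w.length]
  · simp
  · intro N hN; rw [if_neg hN.symm]

/-- The resolvent equation in the starting point: the empty walk, or a first step. -/
theorem walkTotal_eq (Q : ℝ≥0∞) (y x : Fin d → ℤ) :
    walkTotal Q y x = (if y = x then 1 else 0) + Q * ∑ s, walkTotal Q (y + unitStep s) x := by
  simp only [walkTotal_eq_tsum]
  rw [tsum_eq_zero_add' ENNReal.summable, walkWeight_zero]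
  simp only [walkWeight_succ]
  rw [ENNReal.tsum_mul_left, Summable.tsum_finsetSum fun _ _ => ENNReal.summable]

theorem tsum_walkTotal_le (Q : ℝ≥0∞) (y : Fin d → ℤ) :
    ∑' x, walkTotal Q y x ≤ (1 - 2 * d * Q)⁻¹ := by
  simp only [walkTotal_eq_tsum]
  rw [ENNReal.tsum_comm, ← ENNReal.tsum_geometric]
  exact ENNReal.tsum_le_tsum fun N => tsum_walkWeight_le Q N y

variable {lam : ℝ}

theorem two_mul_mul_ofReal_lt_one (h1 : lam < 1) :
    2 * d * ENNReal.ofReal (lam / (2 * d)) < 1 := by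
  have e : (2 * d : ℝ≥0∞) = ENNReal.ofReal (2 * d) := by
    rw [ENNReal.ofReal_mul (by norm_num)]; simp
  rw [e, ← ENNReal.ofReal_mul (by positivity), ENNReal.ofReal_lt_one]
  rcases Nat.eq_zero_or_pos d with h | h
  · subst h; simp
  · have : (0 : ℝ) < d := by exact_mod_cast h
    rw [mul_div_cancel₀ _ (by positivity)]
    exact h1

theorem tsum_walkTotal_ne_top (h1 : lam < 1) (y : Fin d → ℤ) :
    ∑' x, walkTotal (ENNReal.ofReal (lam / (2 * d))) y x ≠ ∞ := by
  refine ne_top_of_le_ne_top ?_ (tsum_walkTotal_le _ y)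
  rw [ENNReal.inv_ne_top]
  exact (tsub_pos_of_lt (two_mul_mul_ofReal_lt_one h1)).ne'

theorem walkTotal_le (Q : ℝ≥0∞) (y x : Fin d → ℤ) : walkTotal Q y x ≤ (1 - 2 * d * Q)⁻¹ :=
  (ENNReal.le_tsum x).trans (tsum_walkTotal_le Q y)

theorem walkTotal_ne_top (h1 : lam < 1) (y x : Fin d → ℤ) :
    walkTotal (ENNReal.ofReal (lam / (2 * d))) y x ≠ ∞ :=
  ne_top_of_le_ne_top (tsum_walkTotal_ne_top h1 y) (ENNReal.le_tsum x)

theorem walkSum_eq_toReal (h0 : 0 ≤ lam) (x : Fin d → ℤ) :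
    walkSum d lam x = (walkTotal (ENNReal.ofReal (lam / (2 * d))) 0 x).toReal := by
  have hq : 0 ≤ lam / (2 * d) := by positivity
  rw [walkSum, walkTotal, ENNReal.tsum_toReal_eq fun w => ENNReal.pow_ne_top ENNReal.ofReal_ne_top]
  refine tsum_congr fun w => ?_
  rw [ENNReal.toReal_pow, ENNReal.toReal_ofReal hq]

theorem summable_walkSum (h0 : 0 ≤ lam) (h1 : lam < 1) : Summable (walkSum d lam) :=
  (ENNReal.summable_toReal (tsum_walkTotal_ne_top h1 0)).congr fun x =>
    (walkSum_eq_toReal h0 x).symm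

theorem walkSum_nonneg (h0 : 0 ≤ lam) (x : Fin d → ℤ) : 0 ≤ walkSum d lam x := by
  rw [walkSum_eq_toReal h0]; exact ENNReal.toReal_nonneg

/-- A bounded solution of the resolvent equation agrees with the sum over walks. -/
theorem walkSum_eq_of_resolvent (h0 : 0 ≤ lam) (h1 : lam < 1) (hd : 1 ≤ d) {G : (Fin d → ℤ) → ℝ}
    {M : ℝ} (hM : ∀ x, |G x| ≤ M)
    (hG : ∀ x, G x = (if x = 0 then 1 else 0) + lam / (2 * d) * ∑ s, G (x + unitStep s))
    (x : Fin d → ℤ) : walkSum d lam x = G (-x) := by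
  have hd' : (0 : ℝ) < d := by exact_mod_cast hd
  set q : ℝ := lam / (2 * d) with hq
  have hq0 : 0 ≤ q := by positivity
  set Q := ENNReal.ofReal q
  -- As a function of the starting point `y`, both terms solve the resolvent equation with source at
  -- `x`; the claim is `D 0 = 0`.
  let D : (Fin d → ℤ) → ℝ := fun y => (walkTotal Q y x).toReal - G (y - x)
  have hrec : ∀ y, (walkTotal Q y x).toReal =
      (if y = x then 1 else 0) + q * ∑ s, (walkTotal Q (y + unitStep s) x).toReal := by
    intro y
    rw [walkTotal_eq, ENNReal.toReal_add (by split_ifs <;> simp)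
      (ENNReal.mul_ne_top ENNReal.ofReal_ne_top (ENNReal.sum_ne_top.2 fun s _ =>
        walkTotal_ne_top h1 _ _)), ENNReal.toReal_mul, ENNReal.toReal_ofReal hq0,
      ENNReal.toReal_sum fun s _ => walkTotal_ne_top h1 _ _]
    congr 1
    split_ifs <;> simp
  have hD : ∀ y, D y = q * ∑ s, D (y + unitStep s) := by
    intro y
    simp only [D]
    rw [hrec, hG (y - x), Finset.sum_sub_distrib]
    simp only [sub_eq_zero, sub_add_eq_add_sub]
    ring
  obtain ⟨C, hC⟩ : ∃ C, ∀ y, |D y| ≤ C := by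
    refine ⟨((1 - 2 * d * Q)⁻¹).toReal + M, fun y => (abs_sub _ _).trans (add_le_add ?_ (hM _))⟩
    rw [abs_of_nonneg ENNReal.toReal_nonneg]
    refine ENNReal.toReal_mono ?_ (walkTotal_le Q y x)
    rw [ENNReal.inv_ne_top]
    exact (tsub_pos_of_lt (two_mul_mul_ofReal_lt_one h1)).ne'
  -- `D` is bounded and solves the homogeneous equation, whose `2d` neighbours of weight `lam / 2d`
  -- contract the supremum by `lam`.
  have hpow : ∀ N y, |D y| ≤ lam ^ N * C := by
    intro N
    induction N with
    | zero => intro y; simpa using hC y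
    | succ N ih =>
      intro y
      rw [hD, abs_mul, abs_of_nonneg hq0]
      calc q * |∑ s, D (y + unitStep s)| ≤ q * ∑ _s : Fin d × Bool, lam ^ N * C := by
            gcongr
            exact (Finset.abs_sum_le_sum_abs _ _).trans (Finset.sum_le_sum fun s _ => ih _)
        _ = lam ^ (N + 1) * C := by
            rw [Finset.sum_const, Finset.card_univ, Fintype.card_prod, Fintype.card_fin,
              Fintype.card_bool, nsmul_eq_mul, hq]
            push_cast; field_simp; ring
  have hzero : |D 0| ≤ 0 := by
    refine ge_of_tendsto' (x := atTop) ?_ fun N => hpow N 0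
    simpa using (tendsto_pow_atTop_nhds_zero_of_lt_one h0 h1).mul_const C
  have := abs_eq_zero.1 (le_antisymm hzero (abs_nonneg _))
  simp only [D, zero_sub] at this
  rw [walkSum_eq_toReal h0]
  linarith

end Walks

end

end QuantumSpin

namespace QuantumSpin

open Filter Topology Matrix MeasureTheory

noncomputable section

/-! ### The Green function of the killed random walk -/

section Resolvent

/-- The decay rate of the one-dimensional resolvent `(b - q A)⁻¹`. -/
def decayRate (q b : ℝ) : ℝ := 2 * q / (b + Real.sqrt (b ^ 2 - 4 * q ^ 2))

/-- The value at the origin of the one-dimensional resolvent `(b - q A)⁻¹`. -/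
def amplitude (q b : ℝ) : ℝ := (Real.sqrt (b ^ 2 - 4 * q ^ 2))⁻¹

variable {q b : ℝ}

theorem sqrt_disc_pos (hq : 0 ≤ q) (hb : 2 * q < b) : 0 < Real.sqrt (b ^ 2 - 4 * q ^ 2) :=
  Real.sqrt_pos.2 (by nlinarith)

theorem decayRate_nonneg (hq : 0 ≤ q) (hb : 2 * q < b) : 0 ≤ decayRate q b := by
  have := sqrt_disc_pos hq hb
  rw [decayRate]
  have : 0 < b := by linarith
  positivity

theorem decayRate_le_one (hq : 0 ≤ q) (hb : 2 * q < b) : decayRate q b ≤ 1 := by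
  have := sqrt_disc_pos hq hb
  rw [decayRate, div_le_one (by linarith)]
  linarith

theorem amplitude_pos (hq : 0 ≤ q) (hb : 2 * q < b) : 0 < amplitude q b :=
  inv_pos.2 (sqrt_disc_pos hq hb)

/-- The decay rate is the smaller root, in the rationalised form that remains valid at `q = 0`. -/
theorem decayRate_quadratic (hq : 0 ≤ q) (hb : 2 * q < b) :
    q * decayRate q b ^ 2 - b * decayRate q b + q = 0 := by
  have h := sqrt_disc_pos hq hb
  have h2 : Real.sqrt (b ^ 2 - 4 * q ^ 2) ^ 2 = b ^ 2 - 4 * q ^ 2 := Real.sq_sqrt (by nlinarith)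
  rw [decayRate]
  generalize Real.sqrt (b ^ 2 - 4 * q ^ 2) = D at *
  have h3 : b + D ≠ 0 := by linarith
  have e : q * (2 * q / (b + D)) ^ 2 - b * (2 * q / (b + D)) + q =
      q * (D ^ 2 - (b ^ 2 - 4 * q ^ 2)) / (b + D) ^ 2 := by field_simp; ring
  rw [e, h2]; simp

theorem amplitude_mul (hq : 0 ≤ q) (hb : 2 * q < b) :
    amplitude q b * (b - 2 * q * decayRate q b) = 1 := by
  have h := sqrt_disc_pos hq hb
  have h2 : Real.sqrt (b ^ 2 - 4 * q ^ 2) ^ 2 = b ^ 2 - 4 * q ^ 2 := Real.sq_sqrt (by nlinarith)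
  have h3 : b + Real.sqrt (b ^ 2 - 4 * q ^ 2) ≠ 0 := by linarith
  rw [decayRate, amplitude]
  field_simp
  linear_combination -h2

/-- Away from the origin this is the quadratic equation of the decay rate times a power. At the
origin both neighbours contribute one factor of the rate, and the amplitude is normalised to leave
`1`. -/
theorem resolvent_one_dim (hq : 0 ≤ q) (hb : 2 * q < b) (n : ℤ) :
    b * (amplitude q b * decayRate q b ^ n.natAbs) = (if n = 0 then 1 else 0) +
      q * (amplitude q b * decayRate q b ^ (n + 1).natAbs +
        amplitude q b * decayRate q b ^ (n - 1).natAbs) := by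
  have key : ∀ m : ℕ, b * (amplitude q b * decayRate q b ^ (m + 1)) =
      q * (amplitude q b * decayRate q b ^ (m + 2) + amplitude q b * decayRate q b ^ m) :=
      fun m => by
    linear_combination (-(amplitude q b * decayRate q b ^ m)) * decayRate_quadratic hq hb
  rcases lt_trichotomy n 0 with h | h | h
  · obtain ⟨m, rfl⟩ : ∃ m : ℕ, n = -(m + 1 : ℤ) := ⟨(-n - 1).toNat, by omega⟩
    have e1 : (-(m + 1 : ℤ)).natAbs = m + 1 := by omega
    have e2 : (-(m + 1 : ℤ) + 1).natAbs = m := by omega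
    have e3 : (-(m + 1 : ℤ) - 1).natAbs = m + 2 := by omega
    rw [if_neg (by omega), e1, e2, e3, key]; ring
  · subst h
    simp only [Int.natAbs_zero, pow_zero, if_true]
    norm_num
    linear_combination amplitude_mul hq hb
  · obtain ⟨m, rfl⟩ : ∃ m : ℕ, n = (m + 1 : ℤ) := ⟨(n - 1).toNat, by omega⟩
    have e1 : (m + 1 : ℤ).natAbs = m + 1 := by omega
    have e2 : (m + 1 + 1 : ℤ).natAbs = m + 2 := by omega
    have e3 : (m + 1 - 1 : ℤ).natAbs = m := by omega
    rw [if_neg (by omega), e1, e2, e3, key]; ring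

end Resolvent

/-! ### Mixed Fourier representation and reflection positivity of walk sums -/

section Green

variable {d : ℕ}

/-- The phase `2π k · x` of the transverse directions. -/
def phase (i : Fin d) (k : {j // j ≠ i} → ℝ) (x : Fin d → ℤ) : ℝ :=
  ∑ j : {j // j ≠ i}, 2 * Real.pi * k j * x j

/-- The symbol of `1 - q A` in the transverse directions. -/
def symbol (i : Fin d) (q : ℝ) (k : {j // j ≠ i} → ℝ) : ℝ :=
  1 - q * ∑ j : {j // j ≠ i}, 2 * Real.cos (2 * Real.pi * k j)

/-- The integrand of the Green function in mixed Fourier representation. -/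
def greenMode (i : Fin d) (q : ℝ) (k : {j // j ≠ i} → ℝ) (x : Fin d → ℤ) : ℝ :=
  amplitude q (symbol i q k) * decayRate q (symbol i q k) ^ (x i).natAbs * Real.cos (phase i k x)

variable {i : Fin d} {q : ℝ}

/-- The `d - 1` transverse cosines remove at most `2q(d - 1)` from `1 > 2dq`. Hence the
one-dimensional resolvent exists at every momentum. -/
theorem lt_symbol (hq : 0 ≤ q) (hq1 : 2 * d * q < 1) (k : {j // j ≠ i} → ℝ) :
    2 * q < symbol i q k := by
  have h1 : ∑ j : {j // j ≠ i}, 2 * Real.cos (2 * Real.pi * k j) ≤ 2 * ((d : ℝ) - 1) := by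
    have hc : (Fintype.card {j // j ≠ i} : ℝ) = d - 1 := by
      rw [Fintype.card_subtype_compl, Fintype.card_subtype_eq, Fintype.card_fin,
        Nat.cast_sub (by have := i.pos; omega)]
      simp
    calc _ ≤ ∑ _j : {j // j ≠ i}, (2 : ℝ) :=
          Finset.sum_le_sum fun j _ => by linarith [Real.cos_le_one (2 * Real.pi * k j)]
      _ = _ := by rw [Finset.sum_const, Finset.card_univ, nsmul_eq_mul, hc]; ring
  rw [symbol]
  nlinarith

theorem continuous_symbol : Continuous (symbol i q) := by
  unfold symbol; fun_prop

theorem continuous_greenMode (hq : 0 ≤ q) (hq1 : 2 * d * q < 1) (x : Fin d → ℤ) :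
    Continuous fun k => greenMode i q k x := by
  have hs : ∀ k, 0 < Real.sqrt (symbol i q k ^ 2 - 4 * q ^ 2) := fun k =>
    sqrt_disc_pos hq (lt_symbol hq hq1 k)
  have h1 : Continuous fun k => amplitude q (symbol i q k) := by
    unfold amplitude
    exact ((((continuous_symbol (i := i) (q := q)).pow 2).sub continuous_const).sqrt).inv₀
      fun k => (hs k).ne'
  have h2 : Continuous fun k => decayRate q (symbol i q k) := by
    unfold decayRate
    refine continuous_const.div (continuous_symbol.add
      (((continuous_symbol.pow 2).sub continuous_const).sqrt)) fun k => ?_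
    have := lt_symbol hq hq1 k
    have := hs k
    linarith
  have h3 : Continuous fun k => Real.cos (phase i k x) := by
    unfold phase; fun_prop
  exact (h1.mul (h2.pow _)).mul h3

theorem phase_add_unitStep_self (k : {j // j ≠ i} → ℝ) (x : Fin d → ℤ) (c : Bool) :
    phase i k (x + unitStep (i, c)) = phase i k x := by
  refine Finset.sum_congr rfl fun j _ => ?_
  simp [unitStep, Pi.single_eq_of_ne j.2]

theorem phase_add_unitStep (k : {j // j ≠ i} → ℝ) (x : Fin d → ℤ) (j : {j // j ≠ i}) (c : Bool) :
    phase i k (x + unitStep (j.1, c)) =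
      phase i k x + 2 * Real.pi * k j * (if c then 1 else -1) := by
  classical
  rw [phase, phase, ← Finset.add_sum_erase _ _ (Finset.mem_univ j),
    ← Finset.add_sum_erase _ (fun l : {j // j ≠ i} => 2 * Real.pi * k l * x l) (Finset.mem_univ j)]
  have : ∑ l ∈ Finset.univ.erase j, 2 * Real.pi * k l * ((x + unitStep (j.1, c)) l.1 : ℤ) =
      ∑ l ∈ Finset.univ.erase j, 2 * Real.pi * k l * x l := by
    refine Finset.sum_congr rfl fun l hl => ?_
    have hne : (l : Fin d) ≠ j := fun h => Finset.ne_of_mem_erase hl (Subtype.ext h)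
    simp [unitStep, Pi.single_eq_of_ne hne]
  rw [this]
  simp only [Pi.add_apply, unitStep, Pi.single_eq_same]
  cases c <;> (push_cast; simp; ring)

/-- A pair of opposite transverse steps multiplies the mode by `2 cos (2π k_j)`. Moved to the left
these terms build the symbol, and the two normal steps leave the one-dimensional resolvent equation.
-/
theorem greenMode_eq (hq : 0 ≤ q) (hq1 : 2 * d * q < 1) (k : {j // j ≠ i} → ℝ) (x : Fin d → ℤ) :
    greenMode i q k x = (if x i = 0 then 1 else 0) * Real.cos (phase i k x) +
      q * ∑ s, greenMode i q k (x + unitStep s) := by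
  have hr := resolvent_one_dim hq (lt_symbol hq hq1 k) (x i)
  have hsum : ∑ s, greenMode i q k (x + unitStep s) =
      (amplitude q (symbol i q k) * decayRate q (symbol i q k) ^ (x i + 1).natAbs +
        amplitude q (symbol i q k) * decayRate q (symbol i q k) ^ (x i - 1).natAbs) *
        Real.cos (phase i k x) +
      amplitude q (symbol i q k) * decayRate q (symbol i q k) ^ (x i).natAbs *
        Real.cos (phase i k x) * ∑ j : {j // j ≠ i}, 2 * Real.cos (2 * Real.pi * k j) := by
    rw [Fintype.sum_prod_type, Fintype.sum_eq_add_sum_subtype_ne _ i, Finset.mul_sum]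
    congr 1
    · rw [Fintype.sum_bool]
      simp only [greenMode, phase_add_unitStep_self]
      simp only [Pi.add_apply, unitStep, Pi.single_eq_same]
      simp only [if_true, Bool.false_eq_true, if_false, ← sub_eq_add_neg]
      ring
    · refine Finset.sum_congr rfl fun j _ => ?_
      rw [Fintype.sum_bool]
      have hi : ∀ c, (x + unitStep (j.1, c)) i = x i := fun c => by
        simp [unitStep, Pi.single_eq_of_ne j.2.symm]
      simp only [greenMode, phase_add_unitStep, hi, if_true, Bool.false_eq_true, if_false, mul_one,
        mul_neg, Real.cos_add, Real.cos_neg, Real.sin_neg]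
      ring
  rw [hsum]
  have e : greenMode i q k x = (symbol i q k *
      (amplitude q (symbol i q k) * decayRate q (symbol i q k) ^ (x i).natAbs)) *
        Real.cos (phase i k x) + q * (amplitude q (symbol i q k) *
        decayRate q (symbol i q k) ^ (x i).natAbs *
        Real.cos (phase i k x) * ∑ j : {j // j ≠ i}, 2 * Real.cos (2 * Real.pi * k j)) := by
    rw [greenMode, symbol]; ring
  rw [e, hr]; ring

/-- The normalised measure on the transverse Brillouin zone. -/
def zone (i : Fin d) : Measure ({j // j ≠ i} → ℝ) :=
  volume.restrict (Set.univ.pi fun _ => Set.Icc 0 1)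

theorem integrable_zone {f : ({j // j ≠ i} → ℝ) → ℝ} (hf : Continuous f) :
    Integrable f (zone i) :=
  hf.continuousOn.integrableOn_compact (isCompact_univ_pi fun _ => isCompact_Icc)

theorem integral_exp_two_pi_mul (n : ℤ) :
    ∫ t in Set.Icc (0 : ℝ) 1, Complex.exp ((2 * Real.pi * t * n : ℝ) * Complex.I) =
      if n = 0 then 1 else 0 := by
  rw [integral_Icc_eq_integral_Ioc, ← intervalIntegral.integral_of_le zero_le_one]
  split_ifs with h
  · subst h; simp
  · have hc : (2 * Real.pi * n * Complex.I : ℂ) ≠ 0 := by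
      simp [h, Real.pi_ne_zero, Complex.I_ne_zero]
    have e : ∀ t : ℝ, Complex.exp ((2 * Real.pi * t * n : ℝ) * Complex.I) =
        Complex.exp ((2 * Real.pi * n * Complex.I : ℂ) * t) := fun t => by
      congr 1; push_cast; ring
    simp only [e]
    rw [integral_exp_mul_complex hc]
    have : Complex.exp ((2 * Real.pi * n * Complex.I : ℂ) * (1 : ℝ)) = 1 := by
      rw [Complex.exp_eq_one_iff]; exact ⟨n, by push_cast; ring⟩
    rw [this]; simp

theorem integral_cos_phase (x : Fin d → ℤ) :
    ∫ k, Real.cos (phase i k x) ∂(zone i) = if ∀ j : {j // j ≠ i}, x j = 0 then 1 else 0 := by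
  have h1 : ∫ k, Complex.exp ((phase i k x : ℝ) * Complex.I) ∂(zone i) =
      if ∀ j : {j // j ≠ i}, x j = 0 then 1 else 0 := by
    have e : ∀ k, Complex.exp ((phase i k x : ℝ) * Complex.I) =
        ∏ j : {j // j ≠ i}, Complex.exp ((2 * Real.pi * k j * x j : ℝ) * Complex.I) := fun k => by
      rw [← Complex.exp_sum, phase, Complex.ofReal_sum, Finset.sum_mul]
    simp only [e]
    rw [zone, volume_pi, Measure.restrict_pi_pi,
      integral_fintype_prod_eq_prod (fun (j : {j // j ≠ i}) (t : ℝ) =>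
        Complex.exp ((2 * Real.pi * t * x j : ℝ) * Complex.I))]
    simp only [integral_exp_two_pi_mul]
    exact Fintype.prod_ite_zero.trans (by simp)
  have h2 : ∀ k, Real.cos (phase i k x) = (Complex.exp ((phase i k x : ℝ) * Complex.I)).re :=
    fun k => (Complex.exp_ofReal_mul_I_re _).symm
  simp only [h2]
  have hint : Integrable (fun k => Complex.exp ((phase i k x : ℝ) * Complex.I)) (zone i) := by
    refine ContinuousOn.integrableOn_compact (isCompact_univ_pi fun _ => isCompact_Icc) ?_
    unfold phase; fun_prop
  have h3 := integral_re hint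
  simp only [RCLike.re_to_complex] at h3
  rw [h3, h1]
  split_ifs <;> simp

/-- The Green function `∑_N q^N A^N` on `ℤ^d`, written as an integral over transverse momenta. -/
def green (i : Fin d) (q : ℝ) (x : Fin d → ℤ) : ℝ := ∫ k, greenMode i q k x ∂(zone i)

theorem green_eq (hq : 0 ≤ q) (hq1 : 2 * d * q < 1) (x : Fin d → ℤ) :
    green i q x = (if x = 0 then 1 else 0) + q * ∑ s, green i q (x + unitStep s) := by
  have hc : Continuous fun k => (if x i = 0 then (1 : ℝ) else 0) * Real.cos (phase i k x) := by
    unfold phase; fun_prop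
  have hm := fun y => integrable_zone (continuous_greenMode (i := i) hq hq1 y)
  have e : (fun k => greenMode i q k x) = fun k =>
      (if x i = 0 then 1 else 0) * Real.cos (phase i k x) +
      q * ∑ s, greenMode i q k (x + unitStep s) := funext fun k => greenMode_eq hq hq1 k x
  rw [green, e, integral_add (integrable_zone hc)
    ((integrable_finsetSum _ fun s _ => hm _).const_mul q), integral_const_mul, integral_const_mul,
    integral_finsetSum _ fun s _ => hm _, integral_cos_phase]
  congr 1
  have hx : x = 0 ↔ x i = 0 ∧ ∀ j : {j // j ≠ i}, x j = 0 := by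
    constructor
    · rintro rfl; simp
    · rintro ⟨h1, h2⟩
      funext j
      by_cases hj : j = i
      · subst hj; exact h1
      · exact h2 ⟨j, hj⟩
  by_cases h1 : x i = 0 <;> by_cases h2 : ∀ j : {j // j ≠ i}, x j = 0 <;> simp [hx, h1, h2]

/-- Boundedness is what the uniqueness result `walkSum_eq_of_resolvent` requires. -/
theorem abs_green_le (hq : 0 ≤ q) (hq1 : 2 * d * q < 1) (x : Fin d → ℤ) :
    |green i q x| ≤ green i q 0 := by
  refine (abs_integral_le_integral_abs).trans (integral_mono
    (integrable_zone (continuous_greenMode hq hq1 x)).abs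
    (integrable_zone (continuous_greenMode hq hq1 0)) fun k => ?_)
  have hb := lt_symbol hq hq1 k
  have h1 := amplitude_pos hq hb
  have h2 := pow_le_one₀ (n := (x i).natAbs) (decayRate_nonneg hq hb) (decayRate_le_one hq hb)
  have h3 := pow_nonneg (decayRate_nonneg hq hb) (x i).natAbs
  have h0 : phase i k 0 = 0 := by simp [phase]
  simp only [greenMode, h0, Pi.zero_apply, Int.natAbs_zero, pow_zero, Real.cos_zero, mul_one,
    abs_mul, abs_of_pos h1, abs_of_nonneg h3]
  calc _ ≤ amplitude q (symbol i q k) * 1 * 1 := by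
        gcongr; exact Real.abs_cos_le_one _
    _ = _ := by ring

/-- The power `r ^ (m (x_i + y_i + 1))` factorises, and the cosine of a difference of phases is `cos
cos + sin sin`: two squares. -/
theorem halfSpacePositive_greenMode (hq : 0 ≤ q) (hq1 : 2 * d * q < 1) (k : {j // j ≠ i} → ℝ)
    (m : ℕ) : HalfSpacePositive i fun x => greenMode i q k ((m : ℤ) • x) := by
  intro ι _ p f hp
  have hb := lt_symbol hq hq1 k
  have hA := amplitude_pos hq hb
  have hr := decayRate_nonneg hq hb
  set r := decayRate q (symbol i q k)
  let c : ι → ℝ := fun a => f a * r ^ (m * (p a i).natAbs) * Real.cos (phase i k ((m : ℤ) • p a))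
  let s : ι → ℝ := fun a => f a * r ^ (m * (p a i).natAbs) * Real.sin (phase i k ((m : ℤ) • p a))
  have key : ∀ a b, f a * f b * greenMode i q k ((m : ℤ) • reflDiff i (p a) (p b)) =
      amplitude q (symbol i q k) * r ^ m * (c a * c b + s a * s b) := by
    intro a b
    have h1 : (((m : ℤ) • reflDiff i (p a) (p b)) i).natAbs =
        m + m * (p a i).natAbs + m * (p b i).natAbs := by
      rw [Pi.smul_apply, reflDiff_self, smul_eq_mul, Int.natAbs_mul, Int.natAbs_natCast]
      have : (p a i + p b i + 1).natAbs = 1 + (p a i).natAbs + (p b i).natAbs := by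
        have := hp a; have := hp b; omega
      rw [this]; ring
    have h2 : phase i k ((m : ℤ) • reflDiff i (p a) (p b)) =
        phase i k ((m : ℤ) • p a) - phase i k ((m : ℤ) • p b) := by
      simp only [phase, ← Finset.sum_sub_distrib]
      refine Finset.sum_congr rfl fun j _ => ?_
      simp only [Pi.smul_apply, reflDiff_of_ne j.2, smul_eq_mul]
      push_cast; ring
    rw [greenMode, h1, h2, Real.cos_sub, pow_add, pow_add]
    simp only [c, s]; ring
  simp only [key, ← Finset.mul_sum, Finset.sum_add_distrib]
  simp only [← Finset.sum_mul]
  exact mul_nonneg (mul_nonneg hA.le (pow_nonneg hr m))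
    (add_nonneg (mul_self_nonneg _) (mul_self_nonneg _))

theorem phase_neg (k : {j // j ≠ i} → ℝ) (x : Fin d → ℤ) : phase i k (-x) = -phase i k x := by
  simp [phase]

theorem phase_flip (k : {j // j ≠ i} → ℝ) (x : Fin d → ℤ) (n : ℤ) :
    phase i k (Function.update x i n) = phase i k x := by
  refine Finset.sum_congr rfl fun j _ => ?_
  rw [Function.update_of_ne j.2]

theorem green_neg (x : Fin d → ℤ) : green i q (-x) = green i q x := by
  simp [green, greenMode, phase_neg]

theorem green_flip (x : Fin d → ℤ) : green i q (Function.update x i (-x i)) = green i q x := by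
  simp [green, greenMode, phase_flip]

/-- The left side does not depend on `i`, so each reflection can be treated in the representation
adapted to its own direction. -/
theorem walkSum_eq_green {lam : ℝ} (h0 : 0 ≤ lam) (h1 : lam < 1) (i : Fin d) (x : Fin d → ℤ) :
    walkSum d lam x = green i (lam / (2 * d)) x := by
  have hd : (0 : ℝ) < d := by exact_mod_cast i.pos
  have hq : 0 ≤ lam / (2 * d) := by positivity
  have hq1 : 2 * d * (lam / (2 * d)) < 1 := by rwa [mul_div_cancel₀ _ (by positivity)]
  rw [walkSum_eq_of_resolvent h0 h1 i.pos (abs_green_le (i := i) hq hq1) (green_eq hq hq1),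
    green_neg]

theorem reflectionPositive_meshWalk {lam : ℝ} (h0 : 0 ≤ lam) (h1 : lam < 1) {m : ℕ} (hm : 1 ≤ m)
    (hd : 1 ≤ d) : ReflectionPositive fun x : Fin d → ℤ => walkSum d lam ((m : ℤ) • x) where
  summable := (summable_walkSum h0 h1).comp_injective (i := fun x : Fin d → ℤ => (m : ℤ) • x)
    (smul_right_injective _ (by exact_mod_cast (by omega : m ≠ 0)))
  flip i x := by
    have : (m : ℤ) • Function.update x i (-x i) =
        Function.update ((m : ℤ) • x) i (-((m : ℤ) • x) i) := by
      funext j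
      by_cases hj : j = i
      · subst hj; simp
      · simp [hj]
    rw [this, walkSum_eq_green h0 h1 i, green_flip, ← walkSum_eq_green h0 h1 i]
  neg x := by
    have i : Fin d := ⟨0, hd⟩
    rw [smul_neg, walkSum_eq_green h0 h1 i, green_neg, ← walkSum_eq_green h0 h1 i]
  pos i := by
    have hd' : (0 : ℝ) < d := by exact_mod_cast hd
    have hq : 0 ≤ lam / (2 * d) := by positivity
    have hq1 : 2 * d * (lam / (2 * d)) < 1 := by rwa [mul_div_cancel₀ _ (by positivity)]
    exact HalfSpacePositive.integral (μ := zone i)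
      (Eventually.of_forall fun k => halfSpacePositive_greenMode hq hq1 k m)
      (fun x _ => integrable_zone (continuous_greenMode hq hq1 _))
      fun x _ => walkSum_eq_green h0 h1 i _

end Green

end

end QuantumSpin

namespace QuantumSpin

open Filter Topology Matrix MeasureTheory

noncomputable section

/-! ### The integral `∫ s^{-1/2} e^{-α s - β / s} ds` -/

section CauchySchlomilch

/-- A primitive of the Gaussian. -/
def gaussPrimitive (x : ℝ) : ℝ := ∫ t in (0 : ℝ)..x, Real.exp (-t ^ 2)

theorem hasDerivAt_gaussPrimitive (x : ℝ) :
    HasDerivAt gaussPrimitive (Real.exp (-x ^ 2)) x := by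
  have hc : Continuous fun t : ℝ => Real.exp (-t ^ 2) := by fun_prop
  exact intervalIntegral.integral_hasDerivAt_right (hc.intervalIntegrable _ _)
    (hc.stronglyMeasurableAtFilter _ _) hc.continuousAt

theorem tendsto_gaussPrimitive_atTop :
    Tendsto gaussPrimitive atTop (𝓝 (Real.sqrt Real.pi / 2)) := by
  have h := integral_gaussian_Ioi 1
  have hi := (integrable_exp_neg_mul_sq (b := 1) one_pos).integrableOn (s := Set.Ioi 0)
  simp only [neg_mul, one_mul, div_one] at h hi
  rw [← h]
  exact intervalIntegral_tendsto_integral_Ioi 0 hi tendsto_id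

theorem gaussPrimitive_neg (x : ℝ) : gaussPrimitive (-x) = -gaussPrimitive x := by
  have := intervalIntegral.integral_comp_neg (a := 0) (b := x) fun t : ℝ => Real.exp (-t ^ 2)
  rw [neg_zero] at this
  rw [gaussPrimitive, gaussPrimitive, intervalIntegral.integral_symm, ← this]
  simp

theorem tendsto_gaussPrimitive_atBot :
    Tendsto gaussPrimitive atBot (𝓝 (-(Real.sqrt Real.pi / 2))) := by
  have := (tendsto_gaussPrimitive_atTop.comp tendsto_neg_atBot_atTop).neg
  refine this.congr fun x => ?_
  simp [gaussPrimitive_neg]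

variable {A B : ℝ}

/-- A primitive of `s^{-1/2} e^{-A² s - B² / s}`. -/
def besselPrimitive (A B s : ℝ) : ℝ :=
  A⁻¹ * (Real.exp (-(2 * A * B)) * gaussPrimitive (A * √s - B / √s) +
    Real.exp (2 * A * B) * gaussPrimitive (A * √s + B / √s))

/-- With `u, w = A√s ∓ B/√s`, both `e^{-2AB} e^{-u²}` and `e^{2AB} e^{-w²}` equal `e^{-A²s - B²/s}`,
and `u' + w' = A / √s` since the parts with `B` cancel. -/
theorem hasDerivAt_besselPrimitive (hA : 0 < A) {s : ℝ} (hs : 0 < s) :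
    HasDerivAt (besselPrimitive A B) ((√s)⁻¹ * Real.exp (-(A ^ 2 * s + B ^ 2 / s))) s := by
  have ht : 0 < √s := Real.sqrt_pos.2 hs
  have hss : √s ^ 2 = s := Real.sq_sqrt hs.le
  have h1 := Real.hasDerivAt_sqrt hs.ne'
  have h2 := h1.inv ht.ne'
  have hu := (hasDerivAt_gaussPrimitive (A * √s - B / √s)).comp s
    ((h1.const_mul A).sub (h2.const_mul B))
  have hw := (hasDerivAt_gaussPrimitive (A * √s + B / √s)).comp s
    ((h1.const_mul A).add (h2.const_mul B))
  refine (((hu.const_mul (Real.exp (-(2 * A * B)))).add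
    (hw.const_mul (Real.exp (2 * A * B)))).const_mul A⁻¹).congr_deriv ?_
  have e0 : A ^ 2 * s + B ^ 2 / s = A ^ 2 * √s ^ 2 + B ^ 2 / √s ^ 2 := by rw [hss]
  have e1 : Real.exp (-(A * √s - B / √s) ^ 2) =
      Real.exp (2 * A * B) * Real.exp (-(A ^ 2 * s + B ^ 2 / s)) := by
    rw [← Real.exp_add]; congr 1
    rw [e0]
    field_simp; ring
  have e2 : Real.exp (-(A * √s + B / √s) ^ 2) =
      Real.exp (-(2 * A * B)) * Real.exp (-(A ^ 2 * s + B ^ 2 / s)) := by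
    rw [← Real.exp_add]; congr 1
    rw [e0]
    field_simp; ring
  rw [e1, e2]
  have e3 : Real.exp (-(2 * A * B)) * Real.exp (2 * A * B) = 1 := by rw [← Real.exp_add]; simp
  generalize Real.exp (-(A ^ 2 * s + B ^ 2 / s)) = E at *
  generalize Real.exp (-(2 * A * B)) = X at *
  generalize Real.exp (2 * A * B) = Y at *
  generalize √s = t at *
  have e4 : A⁻¹ * A = 1 := inv_mul_cancel₀ hA.ne'
  field_simp
  linear_combination (2 * A * t ^ 2 * E) * e3

theorem tendsto_besselPrimitive_atTop (hA : 0 < A) :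
    Tendsto (besselPrimitive A B) atTop (𝓝 (A⁻¹ * (Real.exp (-(2 * A * B)) * (√Real.pi / 2) +
      Real.exp (2 * A * B) * (√Real.pi / 2)))) := by
  have h1 : Tendsto (fun s : ℝ => A * √s) atTop atTop :=
    Real.tendsto_sqrt_atTop.const_mul_atTop hA
  have h2 : Tendsto (fun s : ℝ => B / √s) atTop (𝓝 0) :=
    Real.tendsto_sqrt_atTop.const_div_atTop B
  have hu : Tendsto (fun s : ℝ => A * √s - B / √s) atTop atTop := by
    simpa [sub_eq_add_neg] using h1.atTop_add h2.neg
  have hw : Tendsto (fun s : ℝ => A * √s + B / √s) atTop atTop := h1.atTop_add h2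
  exact (((tendsto_gaussPrimitive_atTop.comp hu).const_mul _).add
    ((tendsto_gaussPrimitive_atTop.comp hw).const_mul _)).const_mul _

theorem tendsto_besselPrimitive_zero (hB : 0 < B) :
    Tendsto (besselPrimitive A B) (𝓝[>] 0)
      (𝓝 (A⁻¹ * (Real.exp (-(2 * A * B)) * (-(√Real.pi / 2)) +
        Real.exp (2 * A * B) * (√Real.pi / 2)))) := by
  have h0 : Tendsto (fun s : ℝ => √s) (𝓝[>] 0) (𝓝[>] 0) := by
    refine tendsto_nhdsWithin_iff.2 ⟨?_, ?_⟩
    · have := Real.continuous_sqrt.tendsto 0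
      rw [Real.sqrt_zero] at this
      exact this.mono_left nhdsWithin_le_nhds
    · filter_upwards [self_mem_nhdsWithin] with s hs using Real.sqrt_pos.2 hs
  have h1 : Tendsto (fun s : ℝ => A * √s) (𝓝[>] 0) (𝓝 0) := by
    simpa using (h0.mono_right nhdsWithin_le_nhds).const_mul A
  have h2 : Tendsto (fun s : ℝ => B / √s) (𝓝[>] 0) atTop := by
    simpa [div_eq_mul_inv] using (tendsto_inv_nhdsGT_zero.comp h0).const_mul_atTop hB
  have hu : Tendsto (fun s : ℝ => A * √s - B / √s) (𝓝[>] 0) atBot := by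
    simpa [sub_eq_add_neg] using h1.add_atBot (tendsto_neg_atTop_atBot.comp h2)
  have hw : Tendsto (fun s : ℝ => A * √s + B / √s) (𝓝[>] 0) atTop := h1.add_atTop h2
  exact (((tendsto_gaussPrimitive_atBot.comp hu).const_mul _).add
    ((tendsto_gaussPrimitive_atTop.comp hw).const_mul _)).const_mul _

theorem integral_bessel_half_sq (hA : 0 < A) (hB : 0 < B) :
    ∫ s in Set.Ioi (0 : ℝ), (√s)⁻¹ * Real.exp (-(A ^ 2 * s + B ^ 2 / s)) =
      √Real.pi / A * Real.exp (-(2 * A * B)) := by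
  set l := A⁻¹ * (Real.exp (-(2 * A * B)) * (-(√Real.pi / 2)) +
        Real.exp (2 * A * B) * (√Real.pi / 2)) with hl
  -- Division by zero gives `besselPrimitive A B 0` the value `0`, so its right limit `l` is put
  -- there instead to have continuity at the endpoint.
  let g : ℝ → ℝ := fun s => if s ≤ 0 then l else besselPrimitive A B s
  have hg : ∀ s : ℝ, 0 < s → g =ᶠ[𝓝 s] besselPrimitive A B := fun s hs => by
    filter_upwards [Ioi_mem_nhds hs] with t ht
    exact if_neg (not_le.2 ht)
  have hcont : ContinuousWithinAt g (Set.Ici 0) 0 := by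
    rw [continuousWithinAt_Ioi_iff_Ici.symm]
    have h0 : g 0 = l := if_pos le_rfl
    rw [ContinuousWithinAt, h0]
    refine (tendsto_besselPrimitive_zero hB).congr' ?_
    filter_upwards [self_mem_nhdsWithin] with t ht
    exact (if_neg (not_le.2 ht)).symm
  have htop := (tendsto_besselPrimitive_atTop (B := B) hA).congr' (f₂ := g) <| by
    filter_upwards [eventually_gt_atTop 0] with t ht
    exact (if_neg (not_le.2 ht)).symm
  rw [integral_Ioi_of_hasDerivAt_of_nonneg hcont
    (fun s hs => (hasDerivAt_besselPrimitive hA hs).congr_of_eventuallyEq (hg s hs))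
    (fun s _ => by positivity) htop, show g 0 = l from if_pos le_rfl, hl]
  ring

end CauchySchlomilch

/-! ### Gaussian mixtures -/

section Mixture

variable {d : ℕ}

theorem exp_neg_div_le {β s : ℝ} (hβ : 0 < β) (hs : 0 < s) (N : ℕ) :
    Real.exp (-(β / s)) ≤ N.factorial / β ^ N * s ^ N := by
  have h := Real.pow_div_factorial_le_exp (β / s) (by positivity) N
  rw [Real.exp_neg]
  refine (inv_anti₀ (by positivity) h).trans_eq ?_
  rw [div_pow]; field_simp

/-- Trading `e^{-β/s}` for `s ^ d` turns the singular `s ^ (-d/2)` into `s ^ (d/2)`, a Gamma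
integrand with parameter `d/2 + 1`. The factor `β ^ (-d)` yields decay `‖x‖ ^ (-2d)` of the
coupling. -/
theorem heat_integrand_le {c β s : ℝ} (hβ : 0 < β) (hs : 0 < s) :
    s ^ (-(d : ℝ) / 2) * Real.exp (-c * s) * Real.exp (-(β / s)) ≤
      d.factorial / β ^ d * (s ^ ((d : ℝ) / 2 + 1 - 1) * Real.exp (-(c * s))) := by
  have h := exp_neg_div_le hβ hs d
  have e : s ^ ((d : ℝ) / 2 + 1 - 1) = s ^ (-(d : ℝ) / 2) * s ^ d := by
    rw [← Real.rpow_natCast s d, ← Real.rpow_add hs]; congr 1; ring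
  rw [e, ← neg_mul]
  calc _ ≤ s ^ (-(d : ℝ) / 2) * Real.exp (-c * s) * (d.factorial / β ^ d * s ^ d) := by gcongr
    _ = _ := by ring

theorem integrableOn_heat {c β : ℝ} (hc : 0 < c) (hβ : 0 < β) :
    IntegrableOn (fun s : ℝ => s ^ (-(d : ℝ) / 2) * Real.exp (-c * s) * Real.exp (-(β / s)))
      (Set.Ioi 0) := by
  refine Integrable.mono' ((integrableOn_rpow_mul_exp_neg_mul
    (s := (d : ℝ) / 2 + 1) (by positivity) hc).const_mul (d.factorial / β ^ d))
    (by fun_prop) ?_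
  filter_upwards [ae_restrict_mem measurableSet_Ioi] with s hs
  have hs' : (0 : ℝ) < s := hs
  rw [Real.norm_of_nonneg (by positivity)]
  exact heat_integrand_le hβ hs

/-- The coupling `∫ s^{-d/2} e^{-c s} e^{-d ‖x‖² / (2 s)} ds`. -/
def heatCoupling (d : ℕ) (c : ℝ) (x : Fin d → ℤ) : ℝ :=
  ∫ s in Set.Ioi (0 : ℝ), s ^ (-(d : ℝ) / 2) * Real.exp (-c * s) *
    Real.exp (-((d / 2 * norm2 x ^ 2) / s))

theorem heatCoupling_nonneg (c : ℝ) (x : Fin d → ℤ) : 0 ≤ heatCoupling d c x := by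
  refine setIntegral_nonneg measurableSet_Ioi fun s hs => ?_
  have hs' : (0 : ℝ) < s := hs
  positivity

theorem norm2_pos {x : Fin d → ℤ} (hx : x ≠ 0) : 0 < norm2 x :=
  (norm_pos_iff.2 hx).trans_le (norm_le_norm2 x)

theorem summable_heatCoupling {c : ℝ} (hc : 0 < c) (hd : 1 ≤ d) :
    Summable (heatCoupling d c) := by
  have hd' : (0 : ℝ) < d := by exact_mod_cast hd
  set I := ∫ s in Set.Ioi (0 : ℝ), s ^ ((d : ℝ) / 2 + 1 - 1) * Real.exp (-(c * s))
  have hI : 0 ≤ I := setIntegral_nonneg measurableSet_Ioi fun s hs => by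
    have hs' : (0 : ℝ) < s := hs
    positivity
  refine summable_of_le_norm_rpow (C := d.factorial / (d / 2) ^ d * I) (s := (2 * d : ℕ))
    (by push_cast; linarith) fun x hx => ?_
  have hx0 : 0 < ‖x‖ := norm_pos_iff.2 hx
  have hx2 := norm2_pos hx
  have hβ : 0 < d / 2 * norm2 x ^ 2 := by positivity
  rw [abs_of_nonneg (heatCoupling_nonneg c x), Real.rpow_neg hx0.le, Real.rpow_natCast]
  calc heatCoupling d c x ≤ d.factorial / (d / 2 * norm2 x ^ 2) ^ d * I := by
        rw [heatCoupling, ← integral_const_mul]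
        exact setIntegral_mono_on (integrableOn_heat hc hβ)
          ((integrableOn_rpow_mul_exp_neg_mul (by positivity) hc).const_mul _) measurableSet_Ioi
          fun s hs => heat_integrand_le hβ hs
    _ ≤ d.factorial / (d / 2 * ‖x‖ ^ 2) ^ d * I := by
        gcongr; exact norm_le_norm2 x
    _ = _ := by rw [mul_pow, pow_mul]; field_simp

/-- The transverse part of a lattice vector. -/
def transverse (i : Fin d) (x : Fin d → ℤ) : EuclideanSpace ℝ {j // j ≠ i} :=
  WithLp.toLp 2 fun j => (x j : ℝ)

theorem norm2_sq_eq (i : Fin d) (x : Fin d → ℤ) :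
    norm2 x ^ 2 = (x i : ℝ) ^ 2 + ‖transverse i x‖ ^ 2 := by
  rw [norm2, Real.sq_sqrt (Finset.sum_nonneg fun _ _ => sq_nonneg _),
    Fintype.sum_eq_add_sum_subtype_ne _ i, EuclideanSpace.real_norm_sq_eq]
  rfl

theorem integral_exp_mul_cos_inner {V : Type*} [NormedAddCommGroup V] [InnerProductSpace ℝ V]
    [FiniteDimensional ℝ V] [MeasurableSpace V] [BorelSpace V] {b : ℝ} (hb : 0 < b) (w : V) :
    ∫ v : V, Real.exp (-b * ‖v‖ ^ 2) * Real.cos (inner ℝ w v) =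
      (Real.pi / b) ^ ((Module.finrank ℝ V : ℝ) / 2) * Real.exp (-(‖w‖ ^ 2 / (4 * b))) := by
  have hb' : 0 < (b : ℂ).re := by simpa using hb
  have h1 := GaussianFourier.integral_cexp_neg_mul_sq_norm_add hb' Complex.I w
  have hi := GaussianFourier.integrable_cexp_neg_mul_sq_norm_add hb' Complex.I w
  have h3 := integral_re hi
  simp only [RCLike.re_to_complex] at h3
  have e : ∀ v : V, (Complex.exp (-(b : ℂ) * ‖v‖ ^ 2 + Complex.I * (inner ℝ w v : ℝ))).re =
      Real.exp (-b * ‖v‖ ^ 2) * Real.cos (inner ℝ w v) := fun v => by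
    have : (-(b : ℂ) * ‖v‖ ^ 2 + Complex.I * (inner ℝ w v : ℝ)) =
        ((-b * ‖v‖ ^ 2 : ℝ) : ℂ) + (inner ℝ w v : ℝ) * Complex.I := by push_cast; ring
    rw [this, Complex.exp_add, ← Complex.ofReal_exp, Complex.re_ofReal_mul,
      Complex.exp_ofReal_mul_I_re]
  simp only [e] at h3
  rw [h3, h1]
  have e2 : ((Real.pi : ℂ) / b) ^ (Module.finrank ℝ V / 2 : ℂ) *
      Complex.exp (Complex.I ^ 2 * ‖w‖ ^ 2 / (4 * b)) =
      (((Real.pi / b) ^ ((Module.finrank ℝ V : ℝ) / 2) *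
        Real.exp (-(‖w‖ ^ 2 / (4 * b))) : ℝ) : ℂ) := by
    rw [Complex.ofReal_mul, Complex.ofReal_cpow (by positivity), Complex.ofReal_exp, Complex.I_sq]
    push_cast
    congr 2
    ring
  rw [e2, Complex.ofReal_re]

end Mixture

end

end QuantumSpin

namespace QuantumSpin

open Filter Topology Matrix MeasureTheory

noncomputable section

/-! ### Reflection positivity of the continuum walk -/

section HeatPositivity

variable {d : ℕ}

/-- The integrand of the heat coupling after Fourier transformation in the transverse directions;
`h` is the height of the lattice vector and `w` its transverse part. -/
def heatMode (i : Fin d) (c h : ℝ) (w v : EuclideanSpace ℝ {j // j ≠ i}) (s : ℝ) : ℝ :=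
  (√s)⁻¹ * Real.exp (-((c + ‖v‖ ^ 2 / (2 * d)) * s + d / 2 * h ^ 2 / s)) * Real.cos (inner ℝ w v)

/-- The normalisation of the transverse Gaussian. -/
def heatConst (d : ℕ) : ℝ := ((2 * Real.pi * d) ^ (((d : ℝ) - 1) / 2))⁻¹

variable {i : Fin d} {c h s : ℝ}

theorem heatConst_nonneg : 0 ≤ heatConst d := by
  rw [heatConst]; positivity

/-- The transverse Gaussian in `w` is the Fourier transform of `e^{-s‖v‖²/(2d)}` in dimension `d -
1`. Its normalisation takes up `s ^ (-(d-1)/2)`, leaving the power `s ^ (-1/2)` for which the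
`s`-integral is elementary. -/
theorem integral_heatMode (hs : 0 < s) (w : EuclideanSpace ℝ {j // j ≠ i}) :
    heatConst d * ∫ v, heatMode i c h w v s = s ^ (-(d : ℝ) / 2) * Real.exp (-c * s) *
      Real.exp (-((d / 2 * (h ^ 2 + ‖w‖ ^ 2)) / s)) := by
  have hd : (0 : ℝ) < d := by exact_mod_cast i.pos
  have hfin : (Module.finrank ℝ (EuclideanSpace ℝ {j // j ≠ i}) : ℝ) = d - 1 := by
    rw [finrank_euclideanSpace, Fintype.card_subtype_compl, Fintype.card_subtype_eq,
      Fintype.card_fin, Nat.cast_sub (by have := i.pos; omega)]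
    simp
  have hb : 0 < s / (2 * d) := by positivity
  have key := integral_exp_mul_cos_inner hb w
  have e : ∀ v, heatMode i c h w v s = ((√s)⁻¹ * Real.exp (-c * s) *
      Real.exp (-(d / 2 * h ^ 2 / s))) * (Real.exp (-(s / (2 * d)) * ‖v‖ ^ 2) *
      Real.cos (inner ℝ w v)) := fun v => by
    rw [heatMode]
    have : Real.exp (-((c + ‖v‖ ^ 2 / (2 * d)) * s + d / 2 * h ^ 2 / s)) =
        Real.exp (-c * s) * Real.exp (-(d / 2 * h ^ 2 / s)) *
          Real.exp (-(s / (2 * d)) * ‖v‖ ^ 2) := by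
      rw [← Real.exp_add, ← Real.exp_add]; congr 1; field_simp; ring
    rw [this]; ring
  simp only [e]
  rw [integral_const_mul, key, hfin]
  have h1 : (Real.pi / (s / (2 * d))) ^ (((d : ℝ) - 1) / 2) =
      (2 * Real.pi * d) ^ (((d : ℝ) - 1) / 2) * s ^ (-(((d : ℝ) - 1) / 2)) := by
    rw [Real.rpow_neg hs.le, ← Real.inv_rpow hs.le, ← Real.mul_rpow (by positivity) (by positivity)]
    congr 1; field_simp
  have h2 : s ^ (-(d : ℝ) / 2) = (√s)⁻¹ * s ^ (-(((d : ℝ) - 1) / 2)) := by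
    rw [Real.sqrt_eq_rpow, ← Real.rpow_neg hs.le, ← Real.rpow_add hs]; congr 1; ring
  have h3 : Real.exp (-((d / 2 * (h ^ 2 + ‖w‖ ^ 2)) / s)) =
      Real.exp (-(d / 2 * h ^ 2 / s)) * Real.exp (-(‖w‖ ^ 2 / (4 * (s / (2 * d))))) := by
    rw [← Real.exp_add]; congr 1; field_simp; ring
  rw [h1, h2, h3, heatConst]
  have : (2 * Real.pi * d) ^ (((d : ℝ) - 1) / 2) ≠ 0 := by positivity
  field_simp

theorem abs_heatMode_le (w v : EuclideanSpace ℝ {j // j ≠ i}) (s : ℝ) :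
    |heatMode i c h w v s| ≤ heatMode i c h 0 v s := by
  rw [heatMode, heatMode, abs_mul, abs_of_nonneg (by positivity), inner_zero_left, Real.cos_zero]
  gcongr
  exact Real.abs_cos_le_one _

theorem measurable_heatMode (w : EuclideanSpace ℝ {j // j ≠ i}) :
    Measurable fun p : ℝ × EuclideanSpace ℝ {j // j ≠ i} => heatMode i c h w p.2 p.1 := by
  unfold heatMode
  fun_prop

theorem integrable_heatMode_zero (hs : 0 < s) :
    Integrable fun v : EuclideanSpace ℝ {j // j ≠ i} => heatMode i c h 0 v s := by
  have hd : (0 : ℝ) < d := by exact_mod_cast i.pos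
  refine .of_integral_ne_zero fun h0 => ?_
  have := integral_heatMode (c := c) (h := h) hs (0 : EuclideanSpace ℝ {j // j ≠ i})
  rw [h0, mul_zero] at this
  have h2 : 0 < s ^ (-(d : ℝ) / 2) * Real.exp (-c * s) * Real.exp (-((d / 2 * (h ^ 2 +
    ‖(0 : EuclideanSpace ℝ {j // j ≠ i})‖ ^ 2)) / s)) := by positivity
  linarith

/-- The nonnegative mode at `w = 0` dominates, and its `v`-integral is a multiple of the heat
integrand at squared distance `h²`. Positive height keeps the latter integrable near `s = 0`. -/
theorem integrable_heatMode (hc : 0 < c) (hh : 0 < h) (w : EuclideanSpace ℝ {j // j ≠ i}) :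
    Integrable (fun p : ℝ × EuclideanSpace ℝ {j // j ≠ i} => heatMode i c h w p.2 p.1)
      ((volume.restrict (Set.Ioi 0)).prod volume) := by
  have hd : (0 : ℝ) < d := by exact_mod_cast i.pos
  have hK : heatConst d ≠ 0 := by rw [heatConst]; positivity
  have h0 : Integrable (fun p : ℝ × EuclideanSpace ℝ {j // j ≠ i} => heatMode i c h 0 p.2 p.1)
      ((volume.restrict (Set.Ioi 0)).prod volume) := by
    rw [integrable_prod_iff (measurable_heatMode 0).aestronglyMeasurable]
    refine ⟨?_, ?_⟩
    · filter_upwards [ae_restrict_mem measurableSet_Ioi] with s hs using integrable_heatMode_zero hs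
    · refine ((integrableOn_heat (d := d) hc (β := d / 2 * h ^ 2) (by positivity)).const_mul
        (heatConst d)⁻¹).congr ?_
      filter_upwards [ae_restrict_mem measurableSet_Ioi] with s hs
      have e : ∀ v, ‖heatMode i c h 0 v s‖ = heatMode i c h 0 v s := fun v =>
        Real.norm_of_nonneg ((abs_nonneg _).trans (abs_heatMode_le 0 v s))
      have := integral_heatMode (c := c) (h := h) hs (0 : EuclideanSpace ℝ {j // j ≠ i})
      simp only [e]
      rw [norm_zero, zero_pow two_ne_zero, add_zero] at this
      rw [← this, inv_mul_cancel_left₀ hK]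
  exact h0.mono' (measurable_heatMode w).aestronglyMeasurable
    (Eventually.of_forall fun p => abs_heatMode_le w p.2 p.1)

/-- The transverse Fourier mode of the heat coupling. -/
def heatProfile (i : Fin d) (c : ℝ) (v : EuclideanSpace ℝ {j // j ≠ i}) (x : Fin d → ℤ) : ℝ :=
  heatConst d * ∫ s in Set.Ioi (0 : ℝ), heatMode i c (x i) (transverse i x) v s

theorem heatCoupling_eq_integral (hc : 0 < c) {x : Fin d → ℤ} (hx : 1 ≤ x i) :
    heatCoupling d c x = ∫ v, heatProfile i c v x := by
  have hx' : (0 : ℝ) < x i := by exact_mod_cast hx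
  simp only [heatProfile]
  rw [integral_const_mul, ← integral_integral_swap (f := fun s v =>
    heatMode i c (x i) (transverse i x) v s) (integrable_heatMode hc hx' _), ← integral_const_mul,
    heatCoupling]
  refine setIntegral_congr_fun measurableSet_Ioi fun s hs => ?_
  simp only [integral_heatMode (Set.mem_Ioi.1 hs), norm2_sq_eq i x]

theorem integrable_heatProfile (hc : 0 < c) {x : Fin d → ℤ} (hx : 1 ≤ x i) :
    Integrable fun v => heatProfile i c v x := by
  have hx' : (0 : ℝ) < x i := by exact_mod_cast hx
  exact (integrable_heatMode hc hx' _).integral_prod_right.const_mul _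

/-- `integral_bessel_half_sq` with `A² = c + ‖v‖²/(2d)` and `B = √(d/2) x_i`: a pure exponential in
the height, as for the lattice Green function. -/
theorem heatProfile_eq (hc : 0 < c) (v : EuclideanSpace ℝ {j // j ≠ i}) {x : Fin d → ℤ}
    (hx : 1 ≤ x i) : heatProfile i c v x = heatConst d * (√Real.pi / √(c + ‖v‖ ^ 2 / (2 * d))) *
      Real.exp (-(2 * √(c + ‖v‖ ^ 2 / (2 * d)) * √(d / 2) * x i)) *
      Real.cos (inner ℝ (transverse i x) v) := by
  have hd : (0 : ℝ) < d := by exact_mod_cast i.pos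
  have hx' : (0 : ℝ) < x i := by exact_mod_cast hx
  have hα : 0 < c + ‖v‖ ^ 2 / (2 * d) := by positivity
  have key := integral_bessel_half_sq (Real.sqrt_pos.2 hα)
    (B := √(d / 2) * x i) (by positivity)
  rw [Real.sq_sqrt hα.le, mul_pow, Real.sq_sqrt (by positivity)] at key
  simp only [heatProfile, heatMode]
  rw [integral_mul_const, key, ← mul_assoc (2 * _)]
  ring

theorem halfSpacePositive_heatProfile (hc : 0 < c) (v : EuclideanSpace ℝ {j // j ≠ i}) :
    HalfSpacePositive i (heatProfile i c v) := by
  refine HalfSpacePositive.congr ?_ fun x hx => heatProfile_eq hc v hx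
  intro ι _ p f _
  set r : ℝ := 2 * √(c + ‖v‖ ^ 2 / (2 * d)) * √(d / 2)
  set A : ℝ := heatConst d * (√Real.pi / √(c + ‖v‖ ^ 2 / (2 * d)))
  have hA : 0 ≤ A := mul_nonneg heatConst_nonneg (by positivity)
  let a : ι → ℝ := fun x => f x * Real.exp (-(r * p x i)) *
      Real.cos (inner ℝ (transverse i (p x)) v)
  let b : ι → ℝ := fun x => f x * Real.exp (-(r * p x i)) *
      Real.sin (inner ℝ (transverse i (p x)) v)
  have key : ∀ x y, f x * f y * (A * Real.exp (-(r * (reflDiff i (p x) (p y) i : ℤ))) *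
      Real.cos (inner ℝ (transverse i (reflDiff i (p x) (p y))) v)) =
      A * Real.exp (-r) * (a x * a y + b x * b y) := by
    intro x y
    have h1 : Real.exp (-(r * (reflDiff i (p x) (p y) i : ℤ))) =
        Real.exp (-r) * Real.exp (-(r * p x i)) * Real.exp (-(r * p y i)) := by
      rw [reflDiff_self, ← Real.exp_add, ← Real.exp_add]; congr 1; push_cast; ring
    have h2 : transverse i (reflDiff i (p x) (p y)) =
        transverse i (p x) - transverse i (p y) := by
      ext j; simp [transverse, reflDiff_of_ne j.2]
    rw [h1, h2, inner_sub_left, Real.cos_sub]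
    simp only [a, b]; ring
  simp only [key, ← Finset.mul_sum, Finset.sum_add_distrib]
  simp only [← Finset.sum_mul]
  exact mul_nonneg (mul_nonneg hA (Real.exp_pos _).le)
    (add_nonneg (mul_self_nonneg _) (mul_self_nonneg _))

theorem halfSpacePositive_heatCoupling (hc : 0 < c) (i : Fin d) :
    HalfSpacePositive i (heatCoupling d c) :=
  HalfSpacePositive.integral (μ := volume)
    (Eventually.of_forall fun v => halfSpacePositive_heatProfile (i := i) hc v)
    (fun _ hx => integrable_heatProfile hc hx) fun _ hx => heatCoupling_eq_integral hc hx

theorem reflectionPositive_heatCoupling (hc : 0 < c) (hd : 1 ≤ d) :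
    ReflectionPositive (heatCoupling d c) where
  summable := summable_heatCoupling hc hd
  flip i x := by simp only [heatCoupling, norm2_flip]
  neg x := by simp only [heatCoupling, norm2_neg]
  pos i := halfSpacePositive_heatCoupling hc i

end HeatPositivity

/-! ### Euclidean power laws -/

section EuclideanPowerLaw

variable {d : ℕ}

/-- The substitution `u = 1/s` with its Jacobian `s ^ (-2)`. -/
theorem inverse_gamma_congr {a β s : ℝ} (hs : 0 < s) :
    (|(-1 : ℝ)| * s ^ ((-1 : ℝ) - 1)) •
      ((s ^ (-1 : ℝ)) ^ (a - 1) * Real.exp (-(β * s ^ (-1 : ℝ)))) =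
      s ^ (-a - 1) * Real.exp (-(β / s)) := by
  rw [← Real.rpow_mul hs.le, Real.rpow_neg_one, ← div_eq_mul_inv, smul_eq_mul, abs_neg, abs_one,
    one_mul, ← mul_assoc, ← Real.rpow_add hs]
  congr 2; ring

theorem integrableOn_inverse_gamma {a β : ℝ} (ha : 0 < a) (hβ : 0 < β) :
    IntegrableOn (fun s : ℝ => s ^ (-a - 1) * Real.exp (-(β / s))) (Set.Ioi 0) := by
  have := (integrableOn_Ioi_comp_rpow_iff (fun u : ℝ => u ^ (a - 1) * Real.exp (-(β * u)))
    (p := -1) (by norm_num)).2 (integrableOn_rpow_mul_exp_neg_mul ha hβ)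
  exact this.congr_fun (fun s hs => inverse_gamma_congr hs) measurableSet_Ioi

theorem integral_inverse_gamma {a β : ℝ} (ha : 0 < a) (hβ : 0 < β) :
    ∫ s in Set.Ioi (0 : ℝ), s ^ (-a - 1) * Real.exp (-(β / s)) = (1 / β) ^ a * Real.Gamma a := by
  have := integral_comp_rpow_Ioi (fun u : ℝ => u ^ (a - 1) * Real.exp (-(β * u)))
    (p := -1) (by norm_num)
  rw [← Real.integral_rpow_mul_exp_neg_mul_Ioi ha hβ, ← this]
  exact setIntegral_congr_fun measurableSet_Ioi fun s hs => (inverse_gamma_congr hs).symm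

/-- The integrand of the representation of Euclidean power laws by heat couplings. -/
def powerMode (d : ℕ) (p β c s : ℝ) : ℝ :=
  c ^ (p - 1) * (s ^ (-(d : ℝ) / 2) * Real.exp (-c * s) * Real.exp (-(β / s)))

theorem integral_powerMode {p β s : ℝ} (hp : 0 < p) (hs : 0 < s) :
    ∫ c in Set.Ioi (0 : ℝ), powerMode d p β c s =
      Real.Gamma p * (s ^ (-((d : ℝ) / 2 + p - 1) - 1) * Real.exp (-(β / s))) := by
  have e : ∀ c, powerMode d p β c s = (s ^ (-(d : ℝ) / 2) * Real.exp (-(β / s))) *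
      (c ^ (p - 1) * Real.exp (-(s * c))) := fun c => by
    rw [powerMode, show -c * s = -(s * c) by ring]; ring
  simp only [e]
  rw [integral_const_mul, Real.integral_rpow_mul_exp_neg_mul_Ioi hp hs, one_div,
    Real.inv_rpow hs.le, ← Real.rpow_neg hs.le]
  have : s ^ (-((d : ℝ) / 2 + p - 1) - 1) = s ^ (-(d : ℝ) / 2) * s ^ (-p) := by
    rw [← Real.rpow_add hs]; congr 1; ring
  rw [this]; ring

theorem integrable_powerMode {p β : ℝ} (hp : 0 < p) (hβ : 0 < β) (hpd : 0 < (d : ℝ) / 2 + p - 1) :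
    Integrable (fun z : ℝ × ℝ => powerMode d p β z.2 z.1)
      ((volume.restrict (Set.Ioi 0)).prod (volume.restrict (Set.Ioi 0))) := by
  have hm : Measurable fun z : ℝ × ℝ => powerMode d p β z.2 z.1 := by
    unfold powerMode; fun_prop
  rw [integrable_prod_iff hm.aestronglyMeasurable]
  refine ⟨?_, ?_⟩
  · filter_upwards [ae_restrict_mem measurableSet_Ioi] with s hs
    have hs' : (0 : ℝ) < s := hs
    refine ((integrableOn_rpow_mul_exp_neg_mul hp hs').const_mul
      (s ^ (-(d : ℝ) / 2) * Real.exp (-(β / s)))).congr (Eventually.of_forall fun c => ?_)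
    simp only [powerMode]
    rw [show -c * s = -(s * c) by ring]; ring
  · refine ((integrableOn_inverse_gamma hpd hβ).const_mul (Real.Gamma p)).congr ?_
    filter_upwards [ae_restrict_mem measurableSet_Ioi] with s hs
    have hs' : (0 : ℝ) < s := hs
    rw [← integral_powerMode hp hs']
    refine setIntegral_congr_fun measurableSet_Ioi fun c hc => ?_
    have hc' : (0 : ℝ) < c := hc
    exact (Real.norm_of_nonneg (by unfold powerMode; positivity)).symm

/-- A mixture of heat couplings with weight `c ^ (p - 1) dc`: the `c`-integral contributes `Γ(p) s ^
(-p)`, and the `s`-integral then gives a power of `‖x‖₂²`. -/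
theorem reflectionPositive_euclideanPowerLaw {σ : ℝ} (hσ : (d : ℝ) < σ) (hd : 1 ≤ d) :
    ReflectionPositive fun x : Fin d → ℤ => norm2 x ^ (-σ) where
  summable := by
    refine summable_of_le_norm_rpow (C := 1) hσ fun x hx => ?_
    have hx0 : 0 < ‖x‖ := norm_pos_iff.2 hx
    have h1 := norm_le_norm2 x
    rw [one_mul, abs_of_nonneg (Real.rpow_nonneg (hx0.le.trans h1) _)]
    exact Real.rpow_le_rpow_of_nonpos hx0 h1 (by linarith [Nat.cast_nonneg (α := ℝ) d])
  flip i x := by rw [norm2_flip]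
  neg x := by rw [norm2_neg]
  pos i := by
    have hd' : (0 : ℝ) < d := by exact_mod_cast hd
    -- Chosen so that the resulting power `‖x‖₂ ^ (-(d + 2p - 2))` has exponent `-σ`; `C` below
    -- removes the constants `(d/2) ^ (-σ/2) Γ(p) Γ(σ/2)`.
    set p : ℝ := (σ - d) / 2 + 1 with hp_def
    have hp : 0 < p := by linarith
    have hpd : (d : ℝ) / 2 + p - 1 = σ / 2 := by rw [hp_def]; ring
    have hσ2 : 0 < σ / 2 := by linarith
    set C : ℝ := (d / 2) ^ (σ / 2) / (Real.Gamma p * Real.Gamma (σ / 2)) with hC_def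
    have hG1 := Real.Gamma_pos_of_pos hp
    have hG2 := Real.Gamma_pos_of_pos hσ2
    have hC : 0 ≤ C := by positivity
    have hx0 : ∀ x : Fin d → ℤ, 1 ≤ x i → 0 < norm2 x := fun x hx =>
      norm2_pos fun h => by rw [h] at hx; simp at hx
    have hmode : ∀ (x : Fin d → ℤ) c, c ^ (p - 1) * heatCoupling d c x =
        ∫ s in Set.Ioi (0 : ℝ), powerMode d p (d / 2 * norm2 x ^ 2) c s := fun x c => by
      simp only [heatCoupling, powerMode]
      rw [integral_const_mul]
    have hβ : ∀ x : Fin d → ℤ, 1 ≤ x i → 0 < d / 2 * norm2 x ^ 2 := fun x hx => by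
      have := hx0 x hx
      positivity
    refine HalfSpacePositive.integral (μ := volume.restrict (Set.Ioi 0))
      (F := fun c x => C * (c ^ (p - 1) * heatCoupling d c x)) ?_ (fun x hx => ?_) fun x hx => ?_
    · filter_upwards [ae_restrict_mem measurableSet_Ioi] with c hc
      have hc' : (0 : ℝ) < c := hc
      exact ((halfSpacePositive_heatCoupling hc' i).const_mul
        (Real.rpow_nonneg hc'.le (p - 1))).const_mul hC
    · simp only [hmode]
      exact (integrable_powerMode hp (hβ x hx) (by
        rw [hpd]; exact hσ2)).integral_prod_right.const_mul C
    · simp only [hmode]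
      rw [integral_const_mul, ← integral_integral_swap (f := fun s c =>
        powerMode d p (d / 2 * norm2 x ^ 2) c s)
        (integrable_powerMode hp (hβ x hx) (by rw [hpd]; exact hσ2))]
      have e : ∫ s in Set.Ioi (0 : ℝ), ∫ c in Set.Ioi (0 : ℝ),
          powerMode d p (d / 2 * norm2 x ^ 2) c s =
          Real.Gamma p * ((1 / (d / 2 * norm2 x ^ 2)) ^ (σ / 2) * Real.Gamma (σ / 2)) := by
        rw [← integral_inverse_gamma hσ2 (hβ x hx), ← integral_const_mul]
        refine setIntegral_congr_fun measurableSet_Ioi fun s hs => ?_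
        simp only [integral_powerMode hp (Set.mem_Ioi.1 hs), hpd]
      have h2 : (norm2 x ^ 2) ^ (σ / 2) = norm2 x ^ σ := by
        rw [← Real.rpow_natCast, ← Real.rpow_mul (hx0 x hx).le]; congr 1; push_cast; ring
      have h3 := (Real.rpow_pos_of_pos (hx0 x hx) σ).ne'
      have h4 : ((d : ℝ) / 2) ^ (σ / 2) ≠ 0 := by positivity
      rw [e, one_div, Real.inv_rpow (hβ x hx).le, Real.mul_rpow (by positivity) (by positivity), h2,
        Real.rpow_neg (hx0 x hx).le, hC_def]
      field_simp

end EuclideanPowerLaw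

/-! ### All listed couplings -/

section Listed

variable {d : ℕ}

theorem heatCoupling_eq_listed (c : ℝ) (x : Fin d → ℤ) :
    ∫ s in Set.Ioi (0 : ℝ), s ^ (-(d : ℝ) / 2) * Real.exp (-c * s) *
      Real.exp (-(d / (2 * s)) * norm2 x ^ 2) = heatCoupling d c x := by
  refine setIntegral_congr_fun measurableSet_Ioi fun s hs => ?_
  have hs' : (0 : ℝ) < s := hs
  congr 2; field_simp

theorem Listed.reflectionPositive (hd : 1 ≤ d) {J : (Fin d → ℤ) → ℝ} (hJ : Listed d J)
    (h0 : ∀ x, 0 ≤ J x) : ReflectionPositive J := by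
  cases hJ with
  | nearestNeighbour a =>
    exact reflectionPositive_nearestNeighbour.of_eq_mul (fun x _ => by split_ifs <;> simp)
      (a := a) (fun x _ => by simp) h0
  | yukawa a b hb =>
    exact (reflectionPositive_yukawa hb).of_eq_mul (fun x _ => (Real.exp_pos _).le)
      (fun x _ => rfl) h0
  | powerLaw a s hs _ hJ =>
    refine (reflectionPositive_powerLaw hs).of_eq_mul (fun x _ => ?_) hJ h0
    exact Real.rpow_nonneg ((norm_nonneg x).trans (norm_le_norm1 x)) _
  | randomWalk c lam hl0 hl1 =>
    refine (reflectionPositive_meshWalk hl0 hl1 le_rfl hd).of_eq_mul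
      (fun x _ => walkSum_nonneg hl0 _) (a := c) (fun x _ => by simp) h0
  | meshWalk m hm c lam hl0 hl1 =>
    exact (reflectionPositive_meshWalk hl0 hl1 hm hd).of_eq_mul
      (fun x _ => walkSum_nonneg hl0 _) (fun x _ => rfl) h0
  | continuumWalk a c hc _ hJ =>
    exact (reflectionPositive_heatCoupling hc hd).of_eq_mul (fun x _ => heatCoupling_nonneg c x)
      (fun x hx => by rw [hJ x hx, heatCoupling_eq_listed]) h0
  | euclideanPowerLaw a s hs _ hJ =>
    exact (reflectionPositive_euclideanPowerLaw hs hd).of_eq_mul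
      (fun x _ => Real.rpow_nonneg (Real.sqrt_nonneg _) _) hJ h0

theorem reflectionPositive_of_mem_ferromagnetic (hd : 1 ≤ d) {J : (Fin d → ℤ) → ℝ}
    (hJ : J ∈ Ferromagnetic d) : ReflectionPositive J :=
  convexHull_min (fun _ h => h.1.reflectionPositive hd h.2) convex_reflectionPositive hJ

end Listed

end

end QuantumSpin

namespace QuantumSpin

open Filter Topology Matrix
open scoped Finset

noncomputable section

/-! ### Positive definite functions on `ℤ^κ` have nonnegative sums -/

section Fejer

variable {κ : Type*} [Fintype κ]

theorem tendsto_prod_toNat_sub_abs_div (z : κ → ℤ) :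
    Tendsto (fun N : ℕ => ∏ j, ((((N : ℤ) - |z j|).toNat : ℝ) / N)) atTop (𝓝 1) := by
  have h : ∀ j : κ, Tendsto (fun N : ℕ => ((((N : ℤ) - |z j|).toNat : ℝ) / N)) atTop (𝓝 1) :=
      fun j => by
    have h0 : Tendsto (fun N : ℕ => 1 - ((|z j| : ℤ) : ℝ) / (N : ℝ)) atTop (𝓝 (1 - 0)) :=
      tendsto_const_nhds.sub (tendsto_const_div_atTop_nhds_zero_nat _)
    rw [sub_zero] at h0
    refine h0.congr' ?_
    filter_upwards [eventually_ge_atTop (|z j|).toNat, eventually_gt_atTop 0] with N hN hN0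
    have e : ((((N : ℤ) - |z j|).toNat : ℕ) : ℤ) = N - |z j| := Int.toNat_of_nonneg (by omega)
    have e' : ((((N : ℤ) - |z j|).toNat : ℕ) : ℝ) = N - ((|z j| : ℤ) : ℝ) := by exact_mod_cast e
    rw [e']
    have : (N : ℝ) ≠ 0 := by exact_mod_cast hN0.ne'
    field_simp
  simpa using tendsto_finsetProd Finset.univ fun j _ => h j

variable [DecidableEq κ]

theorem card_filter_sub_mem_cube (N : ℕ) (z : κ → ℤ) :
    #{u ∈ Fintype.piFinset fun _ : κ => Finset.Ico (0 : ℤ) N |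
      u - z ∈ Fintype.piFinset fun _ : κ => Finset.Ico (0 : ℤ) N} =
    ∏ j, ((N : ℤ) - |z j|).toNat := by
  have e : {u ∈ Fintype.piFinset fun _ : κ => Finset.Ico (0 : ℤ) N |
      u - z ∈ Fintype.piFinset fun _ : κ => Finset.Ico (0 : ℤ) N} =
      Fintype.piFinset fun j : κ => Finset.Ico (max 0 (z j)) (min N (N + z j)) := by
    ext u
    simp only [Finset.mem_filter, Fintype.mem_piFinset, Finset.mem_Ico, Pi.sub_apply, ← forall_and]
    exact forall_congr' fun j => by omega
  rw [e, Fintype.card_piFinset]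
  refine Finset.prod_congr rfl fun j _ => ?_
  rw [Int.card_Ico]
  congr 1
  rcases abs_cases (z j) with h | h <;> omega

/-- A summable function on `ℤ^κ` that is positive semidefinite, tested on indicators of finite sets
only, has a nonnegative sum. -/
theorem tsum_nonneg_of_sum_sub_nonneg {F : (κ → ℤ) → ℝ} (hF : Summable F)
    (hpos : ∀ T : Finset (κ → ℤ), 0 ≤ ∑ u ∈ T, ∑ w ∈ T, F (u - w)) : 0 ≤ ∑' z, F z := by
  -- Collect the pairs by their difference `z`.
  have key : ∀ T : Finset (κ → ℤ), ∑ u ∈ T, ∑ w ∈ T, F (u - w) =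
      ∑' z, (#{u ∈ T | u - z ∈ T} : ℝ) * F z := fun T => by
    have h1 : ∀ u, ∑ w ∈ T, F (u - w) = ∑' z, if u - z ∈ T then F z else 0 := fun u => by
      rw [← (Equiv.subLeft u).tsum_eq]
      simp only [Equiv.subLeft_apply, sub_sub_cancel]
      rw [tsum_eq_sum (s := T) fun w hw => if_neg hw]
      exact Finset.sum_congr rfl fun w hw => (if_pos hw).symm
    simp only [h1]
    rw [← Summable.tsum_finsetSum]
    · refine tsum_congr fun z => ?_
      rw [← Finset.sum_filter, Finset.sum_const, nsmul_eq_mul]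
    · exact fun u _ => (hF.norm.indicator {z | u - z ∈ T}).of_norm_bounded fun z => by
        by_cases h : u - z ∈ T <;> simp [h]
  -- For cubes of side `N` the pair counts divided by the volume are Fejér weights in `[0, 1]`
  -- tending to `1`; dominated convergence applies.
  have lim : Tendsto (fun N : ℕ => ∑' z, (∏ j, ((((N : ℤ) - |z j|).toNat : ℝ) / N)) * F z) atTop
      (𝓝 (∑' z, F z)) := by
    refine tendsto_tsum_of_dominated_convergence (bound := fun z => ‖F z‖) hF.norm (fun z => ?_) ?_
    · simpa using (tendsto_prod_toNat_sub_abs_div z).mul_const (F z)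
    · refine Eventually.of_forall fun N z => ?_
      rw [norm_mul]
      refine mul_le_of_le_one_left (norm_nonneg _) ?_
      rw [Real.norm_of_nonneg (Finset.prod_nonneg fun j _ => by positivity)]
      refine Finset.prod_le_one (fun j _ => by positivity) fun j _ => ?_
      refine div_le_one_of_le₀ ?_ (Nat.cast_nonneg _)
      have : ((N : ℤ) - |z j|).toNat ≤ N := by have := abs_nonneg (z j); omega
      exact_mod_cast this
  refine ge_of_tendsto' lim fun N => ?_
  have h2 := hpos (Fintype.piFinset fun _ : κ => Finset.Ico (0 : ℤ) N)
  rw [key] at h2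
  have h3 := mul_nonneg (by positivity : (0 : ℝ) ≤ ∏ _j : κ, (N : ℝ)⁻¹) h2
  rw [← tsum_mul_left] at h3
  refine h3.trans_eq (tsum_congr fun z => ?_)
  rw [card_filter_sub_mem_cube, ← mul_assoc, Nat.cast_prod, ← Finset.prod_mul_distrib]
  congr 1
  exact Finset.prod_congr rfl fun j _ => by rw [div_eq_inv_mul]

end Fejer

/-! ### Periodised couplings -/

section Periodise

variable {d : ℕ} {ℓ : ℕ} {J : (Fin d → ℤ) → ℝ}

theorem periodise_add_smul (x z : Fin d → ℤ) :
    periodise ℓ J (x + (ℓ : ℤ) • z) = periodise ℓ J x := by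
  unfold periodise
  rw [← (Equiv.addLeft z).tsum_eq (fun w => J (x + (ℓ : ℤ) • w))]
  exact tsum_congr fun w => by rw [Equiv.coe_addLeft, smul_add, add_assoc]

/-- Reversal of the sign of one coordinate. -/
def flipEquiv (i : Fin d) : (Fin d → ℤ) ≃ (Fin d → ℤ) :=
  Function.Involutive.toPerm (fun x => Function.update x i (-x i)) fun x => by simp

theorem flipEquiv_apply (i : Fin d) (x : Fin d → ℤ) :
    flipEquiv i x = Function.update x i (-x i) := rfl

theorem ReflectionPositive.periodise_flip (hJ : ReflectionPositive J) (i : Fin d)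
    (x : Fin d → ℤ) : periodise ℓ J (Function.update x i (-x i)) = periodise ℓ J x := by
  unfold periodise
  rw [← (flipEquiv i).tsum_eq]
  refine tsum_congr fun z => ?_
  rw [← hJ.flip i (x + _)]
  congr 1
  funext j
  by_cases h : j = i
  · subst h; simp [flipEquiv_apply]; ring
  · simp [flipEquiv_apply, h]

theorem ReflectionPositive.periodise_neg (hJ : ReflectionPositive J)
    (x : Fin d → ℤ) : periodise ℓ J (-x) = periodise ℓ J x := by
  unfold periodise
  rw [← (Equiv.neg _).tsum_eq]
  refine tsum_congr fun z => ?_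
  rw [← hJ.neg (x + _)]
  congr 1
  simp [add_comm]

theorem ReflectionPositive.summable_periodise (hJ : ReflectionPositive J) (hℓ : 0 < ℓ)
    (x : Fin d → ℤ) : Summable fun z : Fin d → ℤ => J (x + (ℓ : ℤ) • z) := by
  refine hJ.summable.comp_injective fun z w h => ?_
  have hℓ' : (ℓ : ℤ) ≠ 0 := by exact_mod_cast hℓ.ne'
  exact smul_right_injective _ hℓ' (add_left_cancel h)

/-- Images displaced by `ℓ n = 2Ln` in the normal direction amount to moving both points by `Ln`, so
each `n` gives a half-space form by itself. Summing over transverse images is summing a positive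
definite function of the transverse shift. -/
theorem ReflectionPositive.sum_periodise_nonneg (hJ : ReflectionPositive J) {L : ℕ} (hL : 0 < L)
    (hℓ : ℓ = 2 * L) (i : Fin d) {ι : Type} [Fintype ι] (p : ι → Fin d → ℤ) (f : ι → ℝ)
    (hp0 : ∀ a, 0 ≤ p a i) (hpL : ∀ a, p a i < L) :
    0 ≤ ∑ a, ∑ b, f a * f b * periodise ℓ J (reflDiff i (p a) (p b)) := by
  have hsum := hJ.summable_periodise (ℓ := ℓ) (by omega)
  set G : (Fin d → ℤ) → ℝ := fun z =>
    ∑ a, ∑ b, f a * f b * J (reflDiff i (p a) (p b) + (ℓ : ℤ) • z) with hG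
  have hGs : Summable G := summable_sum fun a _ => summable_sum fun b _ => (hsum _).mul_left _
  have e : ∑ a, ∑ b, f a * f b * periodise ℓ J (reflDiff i (p a) (p b)) = ∑' z, G z := by
    rw [hG, Summable.tsum_finsetSum fun a _ => summable_sum fun b _ => (hsum _).mul_left _]
    refine Finset.sum_congr rfl fun a _ => ?_
    rw [Summable.tsum_finsetSum fun b _ => (hsum _).mul_left _]
    exact Finset.sum_congr rfl fun b _ => by rw [periodise, tsum_mul_left]
  have hGs' : Summable fun q => G ((Equiv.funSplitAt i ℤ).symm q) :=
    (Equiv.funSplitAt i ℤ).symm.summable_iff.2 hGs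
  rw [e, ← (Equiv.funSplitAt i ℤ).symm.tsum_eq, hGs'.tsum_prod]
  refine tsum_nonneg fun n => tsum_nonneg_of_sum_sub_nonneg (hGs'.prod_factor n) fun T => ?_
  -- New heights `q`. For `n < 0` the image lies on the other side, so the heights are reflected
  -- within the half-box, and evenness of `J` in direction `i` accounts for the sign.
  obtain ⟨q, hq0, hq⟩ : ∃ q : ι → ℤ, (∀ a, 0 ≤ q a) ∧
      ((∀ a b, q a + q b + 1 = p a i + p b i + 1 + ℓ * n) ∨
        ∀ a b, q a + q b + 1 = -(p a i + p b i + 1 + ℓ * n)) := by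
    subst hℓ
    rcases le_or_gt 0 n with hn | hn
    · refine ⟨fun a => p a i + L * n, fun a => ?_, Or.inl fun a b => by push_cast; ring⟩
      have := hp0 a
      positivity
    · refine ⟨fun a => L - 1 - p a i + L * (-n - 1), fun a => ?_,
        Or.inr fun a b => by push_cast; ring⟩
      have h1 := hpL a
      have h2 : (0 : ℤ) ≤ L * (-n - 1) := mul_nonneg (by positivity) (by omega)
      change (0 : ℤ) ≤ L - 1 - p a i + L * (-n - 1)
      omega
  -- All transverse translates of all points at once, weighted by `f` independently of the
  -- translate: this realises the double sum over `T` as one half-space form.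
  let P : ι × T → Fin d → ℤ := fun s j =>
    if h : j = i then q s.1 else p s.1 j + ℓ * (s.2 : {j // j ≠ i} → ℤ) ⟨j, h⟩
  have hP := hJ.pos i (ι × T) P (fun s => f s.1) fun s => by simpa [P] using hq0 s.1
  have hJP : ∀ a b (u w : T), J (reflDiff i (p a) (p b) +
      (ℓ : ℤ) • (Equiv.funSplitAt i ℤ).symm (n, (u : {j // j ≠ i} → ℤ) - w)) =
      J (reflDiff i (P (a, u)) (P (b, w))) := fun a b u w => by
    rcases hq with hq | hq
    · congr 1
      funext j
      by_cases h : j = i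
      · subst h
        simp [reflDiff_self, P, Equiv.funSplitAt, hq a b]
      · simp [reflDiff_of_ne h, P, Equiv.funSplitAt, h]; ring
    · rw [← hJ.flip i (reflDiff i (P (a, u)) (P (b, w)))]
      congr 1
      funext j
      by_cases h : j = i
      · subst h
        have := hq a b
        simp [reflDiff_self, P, Equiv.funSplitAt]
        linarith
      · simp [reflDiff_of_ne h, P, Equiv.funSplitAt, h]; ring
  refine hP.trans_eq ?_
  rw [← Finset.sum_coe_sort T]
  simp only [← Finset.sum_coe_sort T, hG, hJP, Fintype.sum_prod_type]
  rw [Finset.sum_comm]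
  refine Finset.sum_congr rfl fun u _ => ?_
  simp only [Finset.sum_comm (s := (Finset.univ : Finset T))]

end Periodise

end

end QuantumSpin

namespace QuantumSpin

open Filter Topology Matrix
open scoped Finset

noncomputable section

/-! ### Maximisation by reflections -/

section Maximum

variable {Λ h : Type*} [Fintype Λ] [Fintype h]

open Classical in
/-- The number of ordered bonds on which a configuration is constant. -/
def agreement (adj : Λ → Λ → Prop) (v : Λ → ℝ) : ℕ := ∑ x, ∑ y, if adj x y ∧ v x = v y then 1 else 0

/-- The configuration obtained by reflecting the left half to the right. -/
def copyLeft (e : h ⊕ h ≃ Λ) (v : Λ → ℝ) : Λ → ℝ :=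
  fun x => v (e (Sum.elim Sum.inl Sum.inl (e.symm x)))

/-- The configuration obtained by reflecting the right half to the left. -/
def copyRight (e : h ⊕ h ≃ Λ) (v : Λ → ℝ) : Λ → ℝ :=
  fun x => v (e (Sum.elim Sum.inr Sum.inr (e.symm x)))

/-- A reflection across bonds: the halves are isomorphic and only mirror images are joined. -/
structure IsBondReflection (adj : Λ → Λ → Prop) (e : h ⊕ h ≃ Λ) : Prop where
  iff : ∀ a b, adj (e (Sum.inl a)) (e (Sum.inl b)) ↔ adj (e (Sum.inr a)) (e (Sum.inr b))
  left : ∀ a b, adj (e (Sum.inl a)) (e (Sum.inr b)) → a = b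
  right : ∀ a b, adj (e (Sum.inr a)) (e (Sum.inl b)) → a = b

/-- Each copy doubles the agreements inside one half, so the inner bonds balance. Bonds across the
cut join mirror images, hence agree in both copies, whereas `v` fails on at least one. -/
theorem two_mul_agreement_lt {adj : Λ → Λ → Prop} {e : h ⊕ h ≃ Λ} (he : IsBondReflection adj e)
    (v : Λ → ℝ) {a : h} (ha : adj (e (Sum.inl a)) (e (Sum.inr a)))
    (hv : v (e (Sum.inl a)) ≠ v (e (Sum.inr a))) :
    2 * agreement adj v < agreement adj (copyLeft e v) + agreement adj (copyRight e v) := by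
  classical
  have split : ∀ w : Λ → ℝ, agreement adj w =
      ∑ a, ∑ b, (if adj (e (Sum.inl a)) (e (Sum.inl b)) ∧ w (e (Sum.inl a)) = w (e (Sum.inl b))
        then 1 else 0) +
      ∑ a, ∑ b, (if adj (e (Sum.inl a)) (e (Sum.inr b)) ∧ w (e (Sum.inl a)) = w (e (Sum.inr b))
        then 1 else 0) +
      (∑ a, ∑ b, (if adj (e (Sum.inr a)) (e (Sum.inl b)) ∧ w (e (Sum.inr a)) = w (e (Sum.inl b))
        then 1 else 0) +
      ∑ a, ∑ b, (if adj (e (Sum.inr a)) (e (Sum.inr b)) ∧ w (e (Sum.inr a)) = w (e (Sum.inr b))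
        then 1 else 0)) := fun w => by
    unfold agreement
    rw [← e.sum_comp]
    simp_rw [← e.sum_comp (fun y => if _ then 1 else 0), Fintype.sum_sum_type,
      Finset.sum_add_distrib]
  have hl : ∀ a b (w : Λ → ℝ) (σ : h → Λ), (adj (e (Sum.inl a)) (e (Sum.inr b)) ∧
      w (σ a) = w (σ b)) ↔ adj (e (Sum.inl a)) (e (Sum.inr b)) := fun a b w σ =>
    and_iff_left_of_imp fun hab => by rw [he.left a b hab]
  have hr : ∀ a b (w : Λ → ℝ) (σ : h → Λ), (adj (e (Sum.inr a)) (e (Sum.inl b)) ∧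
      w (σ a) = w (σ b)) ↔ adj (e (Sum.inr a)) (e (Sum.inl b)) := fun a b w σ =>
    and_iff_left_of_imp fun hab => by rw [he.right a b hab]
  have ite_le : ∀ (p q : Prop), (if p ∧ q then 1 else 0) ≤ if p then 1 else 0 := fun p q => by
    split_ifs <;> simp_all
  have h1 : ∑ a, ∑ b, (if adj (e (Sum.inl a)) (e (Sum.inr b)) ∧
      v (e (Sum.inl a)) = v (e (Sum.inr b)) then 1 else 0) <
      ∑ a, ∑ b, if adj (e (Sum.inl a)) (e (Sum.inr b)) then 1 else 0 := by
    refine Finset.sum_lt_sum (fun a _ => Finset.sum_le_sum fun b _ => ite_le _ _)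
      ⟨a, Finset.mem_univ _, Finset.sum_lt_sum (fun b _ => ite_le _ _) ⟨a, Finset.mem_univ _, ?_⟩⟩
    simp [ha, hv]
  have h2 : ∑ a, ∑ b, (if adj (e (Sum.inr a)) (e (Sum.inl b)) ∧
      v (e (Sum.inr a)) = v (e (Sum.inl b)) then 1 else 0) ≤
      ∑ a, ∑ b, if adj (e (Sum.inr a)) (e (Sum.inl b)) then 1 else 0 :=
    Finset.sum_le_sum fun a _ => Finset.sum_le_sum fun b _ => ite_le _ _
  rw [split v, split (copyLeft e v), split (copyRight e v)]
  simp only [copyLeft, copyRight, Equiv.symm_apply_apply, Sum.elim_inl, Sum.elim_inr,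
    hl _ _ v (fun a => e (Sum.inl a)), hr _ _ v (fun a => e (Sum.inl a)),
    hl _ _ v (fun a => e (Sum.inr a)), hr _ _ v (fun a => e (Sum.inr a)), he.iff]
  omega

/-- A functional that satisfies the Cauchy–Schwarz inequality for a reflection across each of a
connected family of bonds is maximal at constant configurations. -/
theorem le_of_reflections {Z : (Λ → ℝ) → ℝ} {adj bond : Λ → Λ → Prop}
    (hrefl : ∀ x y, bond x y → ∃ (h : Type) (_ : Fintype h) (e : h ⊕ h ≃ Λ) (a : h),
      e (Sum.inl a) = x ∧ e (Sum.inr a) = y ∧ adj x y ∧ IsBondReflection adj e ∧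
      ∀ v, Z v ^ 2 ≤ Z (copyLeft e v) * Z (copyRight e v) ∧ 0 ≤ Z (copyLeft e v))
    (hconn : ∀ v : Λ → ℝ, (∀ x y, bond x y → v x = v y) → ∃ c, v = fun _ => c)
    (hconst : ∀ c, Z (fun _ => c) = Z 0) (h0 : 0 ≤ Z 0) (v : Λ → ℝ) : Z v ≤ Z 0 := by
  classical
  -- Copying creates no new values, so this finite set is stable under all reflections and a
  -- maximiser exists without any compactness or decay.
  set S : Finset (Λ → ℝ) := Fintype.piFinset fun _ => Finset.univ.image v
  have hS : ∀ (w : Λ → ℝ) (σ : Λ → Λ), w ∈ S → (fun x => w (σ x)) ∈ S := fun w σ hw =>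
    Fintype.mem_piFinset.2 fun x => Fintype.mem_piFinset.1 hw (σ x)
  have hvS : v ∈ S := Fintype.mem_piFinset.2 fun x => Finset.mem_image_of_mem _ (Finset.mem_univ _)
  obtain ⟨u, huS, hu⟩ := S.exists_max_image Z ⟨v, hvS⟩
  refine (hu v hvS).trans ?_
  rcases le_or_gt (Z u) 0 with hneg | hM
  · exact hneg.trans h0
  -- Ties among the maximisers are broken by the number of agreements.
  obtain ⟨w, hw, hwN⟩ := {w ∈ S | Z w = Z u}.exists_max_image (agreement adj)
    ⟨u, Finset.mem_filter.2 ⟨huS, rfl⟩⟩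
  obtain ⟨hwS, hwZ⟩ := Finset.mem_filter.1 hw
  obtain ⟨c, rfl⟩ := hconn w fun x y hxy => by
    by_contra hne
    obtain ⟨h, _, e, a, rfl, rfl, hadj, he, hcs⟩ := hrefl x y hxy
    have hlt := two_mul_agreement_lt he w hadj hne
    have hl : copyLeft e w ∈ S := hS w _ hwS
    have hr : copyRight e w ∈ S := hS w _ hwS
    obtain ⟨h1, h2⟩ := hcs w
    have h3 := hu _ hl
    have h4 := hu _ hr
    rw [hwZ] at h1
    -- With maximum `M > 0`, the bounds `M² ≤ Z_L Z_R`, `0 ≤ Z_L ≤ M` and `Z_R ≤ M` force equality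
    -- in both.
    have h5 : Z (copyLeft e w) = Z u := le_antisymm h3 (by
      have := mul_le_mul_of_nonneg_left h4 h2
      nlinarith)
    have h6 : Z (copyRight e w) = Z u := le_antisymm h4 (by rw [h5] at h1; nlinarith)
    have h7 := hwN _ (Finset.mem_filter.2 ⟨hl, h5⟩)
    have h8 := hwN _ (Finset.mem_filter.2 ⟨hr, h6⟩)
    omega
  rw [← hwZ, hconst]

end Maximum

/-! ### Reflections of the torus -/

section Torus

variable {d ℓ : ℕ}

/-- Nearest neighbours on the torus. -/
def TorusAdj (x y : Box d ℓ) : Prop := ∃ z : Fin d → ℤ, norm1 (diff x y + (ℓ : ℤ) • z) = 1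

/-- Congruence modulo `ℓ` in each coordinate. -/
def LatticeModEq (ℓ : ℕ) (u w : Fin d → ℤ) : Prop := ∃ z : Fin d → ℤ, u = w + (ℓ : ℤ) • z

theorem LatticeModEq.periodise_eq {J : (Fin d → ℤ) → ℝ} {u w : Fin d → ℤ}
    (h : LatticeModEq ℓ u w) : periodise ℓ J u = periodise ℓ J w := by
  obtain ⟨z, rfl⟩ := h
  exact periodise_add_smul w z

theorem LatticeModEq.torusAdj_iff {x y : Box d ℓ} {w : Fin d → ℤ}
    (h : LatticeModEq ℓ (diff x y) w) :
    TorusAdj x y ↔ ∃ z : Fin d → ℤ, norm1 (w + (ℓ : ℤ) • z) = 1 := by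
  obtain ⟨z, hz⟩ := h
  constructor
  · rintro ⟨t, ht⟩
    exact ⟨z + t, by rwa [smul_add, ← add_assoc, ← hz]⟩
  · rintro ⟨t, ht⟩
    exact ⟨t - z, by rw [hz, smul_sub, add_assoc, add_sub_cancel]; exact ht⟩

theorem diff_swap (x y : Box d ℓ) : diff y x = -diff x y := by
  funext j; simp [diff]

theorem TorusAdj.symm {x y : Box d ℓ} (h : TorusAdj x y) : TorusAdj y x := by
  obtain ⟨z, hz⟩ := h
  exact ⟨-z, by rw [diff_swap, smul_neg, ← neg_add, norm1_neg, hz]⟩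

theorem Fin.exists_val_add (a b : Fin ℓ) :
    ∃ t : ℤ, (((a + b : Fin ℓ) : ℕ) : ℤ) = (a : ℕ) + (b : ℕ) + ℓ * t := by
  refine ⟨-(((a : ℕ) + b) / ℓ : ℕ), ?_⟩
  have := Nat.mod_add_div ((a : ℕ) + b) ℓ
  rw [Fin.val_add]
  zify at this ⊢
  linarith

theorem latticeModEq_diff_add (x y c : Box d ℓ) :
    LatticeModEq ℓ (diff (x + c) (y + c)) (diff x y) := by
  choose s hs using fun j => Fin.exists_val_add (x j) (c j)
  choose t ht using fun j => Fin.exists_val_add (y j) (c j)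
  refine ⟨s - t, funext fun j => ?_⟩
  simp only [diff, Pi.add_apply, Pi.smul_apply, Pi.sub_apply, smul_eq_mul, hs, ht]
  ring

/-- The sites of the box in the lower half in direction `i`. -/
abbrev HalfBox (d ℓ : ℕ) (i : Fin d) : Type := {x : Box d ℓ // 2 * (x i : ℕ) < ℓ}

/-- Reflection of the box in direction `i`. -/
def mirror (i : Fin d) (x : Box d ℓ) : Box d ℓ := Function.update x i (Fin.rev (x i))

theorem mirror_self (i : Fin d) (x : Box d ℓ) : mirror i x i = Fin.rev (x i) := by simp [mirror]

theorem mirror_of_ne {i j : Fin d} (h : j ≠ i) (x : Box d ℓ) : mirror i x j = x j := by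
  simp [mirror, h]

theorem mirror_mirror (i : Fin d) (x : Box d ℓ) : mirror i (mirror i x) = x := by
  simp [mirror]

theorem bijective_mirror (hℓ : Even ℓ) (i : Fin d) :
    Function.Bijective (Sum.elim (fun a : HalfBox d ℓ i => a.1)
      fun a : HalfBox d ℓ i => mirror i a.1) := by
  have hlt : ∀ a b : HalfBox d ℓ i, a.1 ≠ mirror i b.1 := fun a b hab => by
    have h1 := a.2
    have h2 := b.2
    rw [hab, mirror_self, Fin.val_rev] at h1
    obtain ⟨L, rfl⟩ := hℓ
    omega
  constructor
  · rintro (a | a) (b | b) hab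
    · exact congrArg _ (Subtype.ext hab)
    · exact absurd hab (hlt a b)
    · exact absurd hab.symm (hlt b a)
    · refine congrArg _ (Subtype.ext ?_)
      rw [← mirror_mirror i a.1, ← mirror_mirror i b.1]
      exact congrArg _ hab
  · intro y
    by_cases hy : 2 * (y i : ℕ) < ℓ
    · exact ⟨Sum.inl ⟨y, hy⟩, rfl⟩
    · refine ⟨Sum.inr ⟨mirror i y, ?_⟩, mirror_mirror i y⟩
      rw [mirror_self, Fin.val_rev]
      obtain ⟨L, rfl⟩ := hℓ
      have := (y i).2
      omega

theorem Fin.cast_val_rev (a : Fin ℓ) : (((Fin.rev a : Fin ℓ) : ℕ) : ℤ) = ℓ - 1 - (a : ℕ) := by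
  have := a.2
  rw [Fin.val_rev]
  omega

/-- A site of the box as an element of `ℤ^d`. -/
def toLattice (x : Box d ℓ) : Fin d → ℤ := fun j => ((x j : ℕ) : ℤ)

/-- A reflection of the circle has two cuts. Heights `A`, `B` in the lower half can meet across the
bottom (`z = 0`, both `0`) or across the top (`z = -1`, both `m/2 - 1`). -/
theorem ne_zero_and_eq_of_abs_le_one {A B m z : ℤ} (hA : 0 ≤ A) (hA' : 2 * A + 2 ≤ m) (hB : 0 ≤ B)
    (hB' : 2 * B + 2 ≤ m) (h : |A + B + 1 + m * z| ≤ 1) : A + B + 1 + m * z ≠ 0 ∧ A = B := by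
  obtain ⟨h1, h2⟩ := abs_le.1 h
  have hz : z = 0 ∨ z = -1 := by
    by_contra hc
    rcases (by omega : z ≤ -2 ∨ 1 ≤ z) with h | h
    · have : m * z ≤ m * (-2) := mul_le_mul_of_nonneg_left h (by omega)
      omega
    · have : m * 1 ≤ m * z := mul_le_mul_of_nonneg_left h (by omega)
      omega
  rcases hz with rfl | rfl <;> omega

/-- The normal displacement is nonzero and uses up the whole norm, so the transverse ones vanish
modulo `ℓ`, hence vanish. -/
theorem eq_of_norm1_reflDiff_eq_one (hℓ : Even ℓ) {i : Fin d} {a b : HalfBox d ℓ i}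
    {z : Fin d → ℤ}
    (hz : norm1 (reflDiff i (toLattice a.1) (toLattice b.1) + (ℓ : ℤ) • z) = 1) : a = b := by
  set u := reflDiff i (toLattice a.1) (toLattice b.1) + (ℓ : ℤ) • z with hu
  have hui : u i = (a.1 i : ℕ) + (b.1 i : ℕ) + 1 + ℓ * z i := by
    simp [hu, reflDiff_self, toLattice]
  have huj : ∀ j, j ≠ i → u j = (a.1 j : ℕ) - (b.1 j : ℕ) + ℓ * z j := fun j hj => by
    simp [hu, reflDiff_of_ne hj, toLattice]
  have ha := a.2
  have hb := b.2
  have hsplit : |u i| + ∑ j ∈ Finset.univ.erase i, |u j| = 1 := by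
    rw [← hz, norm1, Finset.add_sum_erase _ (fun j => |u j|) (Finset.mem_univ i)]
  have hrest := Finset.sum_nonneg (s := Finset.univ.erase i) fun j _ => abs_nonneg (u j)
  obtain ⟨hne, hi⟩ := ne_zero_and_eq_of_abs_le_one (A := (a.1 i : ℕ)) (B := (b.1 i : ℕ)) (m := ℓ)
    (z := z i) (by positivity) (by obtain ⟨L, hL⟩ := hℓ; omega) (by positivity)
    (by obtain ⟨L, hL⟩ := hℓ; omega) (by rw [← hui]; omega)
  have hzero : ∀ j, j ≠ i → u j = 0 := fun j hj => by
    have := Int.one_le_abs (hui ▸ hne)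
    have h := (Finset.sum_eq_zero_iff_of_nonneg fun j _ => abs_nonneg (u j)).1
      (by omega : ∑ j ∈ Finset.univ.erase i, |u j| = 0) j
      (Finset.mem_erase.2 ⟨hj, Finset.mem_univ _⟩)
    exact abs_eq_zero.1 h
  refine Subtype.ext (funext fun j => Fin.ext ?_)
  by_cases hj : j = i
  · subst hj
    exact_mod_cast hi
  · have h1 := huj j hj
    rw [hzero j hj] at h1
    have h2 := (a.1 j).2
    have h3 := (b.1 j).2
    have h5 : z j = 0 := by
      by_contra hc
      rcases lt_or_gt_of_ne hc with h | h
      · have : (ℓ : ℤ) * z j ≤ ℓ * (-1) := mul_le_mul_of_nonneg_left (by omega) (by positivity)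
        omega
      · have : (ℓ : ℤ) * 1 ≤ ℓ * z j := mul_le_mul_of_nonneg_left (by omega) (by positivity)
        omega
    rw [h5] at h1
    omega

variable [NeZero ℓ]

/-- The decomposition of the torus into two halves that are mirror images of each other. -/
def reflectionEquiv (hℓ : Even ℓ) (i : Fin d) (c : Box d ℓ) :
    HalfBox d ℓ i ⊕ HalfBox d ℓ i ≃ Box d ℓ :=
  (Equiv.ofBijective _ (bijective_mirror hℓ i)).trans (Equiv.addRight c)

theorem reflectionEquiv_inl (hℓ : Even ℓ) (i : Fin d) (c : Box d ℓ) (a : HalfBox d ℓ i) :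
    reflectionEquiv hℓ i c (Sum.inl a) = a.1 + c := rfl

theorem reflectionEquiv_inr (hℓ : Even ℓ) (i : Fin d) (c : Box d ℓ) (a : HalfBox d ℓ i) :
    reflectionEquiv hℓ i c (Sum.inr a) = mirror i a.1 + c := rfl

theorem latticeModEq_inl_inl (hℓ : Even ℓ) (i : Fin d) (c : Box d ℓ) (a b : HalfBox d ℓ i) :
    LatticeModEq ℓ (diff (reflectionEquiv hℓ i c (Sum.inl a)) (reflectionEquiv hℓ i c (Sum.inl b)))
      (diff a.1 b.1) :=
  latticeModEq_diff_add _ _ _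

theorem latticeModEq_inr_inr (hℓ : Even ℓ) (i : Fin d) (c : Box d ℓ) (a b : HalfBox d ℓ i) :
    LatticeModEq ℓ (diff (reflectionEquiv hℓ i c (Sum.inr a)) (reflectionEquiv hℓ i c (Sum.inr b)))
      (Function.update (diff a.1 b.1) i (-diff a.1 b.1 i)) := by
  obtain ⟨z, hz⟩ := latticeModEq_diff_add (mirror i a.1) (mirror i b.1) c
  refine ⟨z, hz.trans (congrArg (· + _) (funext fun j => ?_))⟩
  by_cases h : j = i
  · subst h
    simp only [diff, mirror_self, Fin.cast_val_rev, Function.update_self]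
    ring
  · simp [diff, mirror_of_ne h, h]

theorem latticeModEq_inl_inr (hℓ : Even ℓ) (i : Fin d) (c : Box d ℓ) (a b : HalfBox d ℓ i) :
    LatticeModEq ℓ (diff (reflectionEquiv hℓ i c (Sum.inl a)) (reflectionEquiv hℓ i c (Sum.inr b)))
      (reflDiff i (toLattice a.1) (toLattice b.1)) := by
  obtain ⟨z, hz⟩ := latticeModEq_diff_add a.1 (mirror i b.1) c
  -- In the box the mirror of height `b` is `ℓ - 1 - b`, not `-1 - b`: one period too high.
  refine ⟨z - Pi.single i 1, hz.trans (funext fun j => ?_)⟩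
  by_cases h : j = i
  · subst h
    simp only [diff, mirror_self, Fin.cast_val_rev, Pi.add_apply, Pi.smul_apply, Pi.sub_apply,
      Pi.single_eq_same, smul_eq_mul, reflDiff_self, toLattice]
    ring
  · simp [diff, mirror_of_ne h, h, reflDiff_of_ne h, toLattice]

theorem isBondReflection_reflectionEquiv (hℓ : Even ℓ) (i : Fin d) (c : Box d ℓ) :
    IsBondReflection TorusAdj (reflectionEquiv hℓ i c) where
  iff a b := by
    rw [(latticeModEq_inl_inl hℓ i c a b).torusAdj_iff,
      (latticeModEq_inr_inr hℓ i c a b).torusAdj_iff]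
    refine (flipEquiv i).exists_congr fun z => ?_
    rw [← norm1_flip i]
    refine iff_of_eq (congrArg (fun u => norm1 u = 1) (funext fun j => ?_))
    by_cases h : j = i
    · subst h; simp [flipEquiv_apply]; ring
    · simp [flipEquiv_apply, h]
  left a b h := by
    obtain ⟨z, hz⟩ := (latticeModEq_inl_inr hℓ i c a b).torusAdj_iff.1 h
    exact eq_of_norm1_reflDiff_eq_one hℓ hz
  right a b h := by
    obtain ⟨z, hz⟩ := (latticeModEq_inl_inr hℓ i c b a).torusAdj_iff.1 h.symm
    exact (eq_of_norm1_reflDiff_eq_one hℓ hz).symm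

theorem Fin.val_nsmul_one (m : ℕ) : ((m • (1 : Fin ℓ) : Fin ℓ) : ℕ) = m % ℓ := by
  induction m with
  | zero => simp
  | succ m ih => rw [succ_nsmul, Fin.val_add, ih, Fin.val_one', Nat.add_mod m 1]

theorem Box.eq_const_of_eq_add_single {v : Box d ℓ → ℝ}
    (h : ∀ x i, v (x + Pi.single i 1) = v x) : ∃ c, v = fun _ => c := by
  have h1 : ∀ (x : Box d ℓ) i (t : Fin ℓ), v (x + Pi.single i t) = v x := fun x i t => by
    have h2 : ∀ m : ℕ, v (x + m • Pi.single i 1) = v x := fun m => by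
      induction m with
      | zero => simp
      | succ m ih => rw [succ_nsmul, ← add_assoc, h, ih]
    have ht : t = (t : ℕ) • (1 : Fin ℓ) :=
      Fin.ext (by rw [Fin.val_nsmul_one, Nat.mod_eq_of_lt t.2])
    rw [ht, Pi.single_smul', h2]
  refine ⟨v 0, funext fun x => ?_⟩
  have h3 : ∀ s : Finset (Fin d), v (∑ i ∈ s, Pi.single i (x i)) = v 0 := fun s => by
    induction s using Finset.induction_on with
    | empty => simp
    | insert i s hi ih => rw [Finset.sum_insert hi, add_comm, h1, ih]
  rw [← h3 Finset.univ, Finset.univ_sum_single]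

end Torus

end

end QuantumSpin

namespace QuantumSpin

open Filter Topology Matrix

noncomputable section

/-! ### Reflection positivity of the partition function on the torus -/

section Partition

variable {d ℓ : ℕ}

/-- The couplings on the box entering the Boltzmann weight. -/
def boxCoupling (ℓ : ℕ) (β : ℝ) (J : Fin 3 → (Fin d → ℤ) → ℝ) (i : Fin 3) (x y : Box d ℓ) : ℝ :=
  β * periodise ℓ (J i) (diff x y)

theorem Admissible.reflectionPositive (hd : 1 ≤ d) {J : Fin 3 → (Fin d → ℤ) → ℝ}
    (hJ : Admissible J) (i : Fin 3) : ReflectionPositive fun x => conjSign i * J i x := by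
  fin_cases i
  · simpa [conjSign] using reflectionPositive_of_mem_ferromagnetic hd hJ.mem_one
  · have := reflectionPositive_of_mem_ferromagnetic hd hJ.mem_two
    simpa [conjSign, Pi.neg_def] using this
  · simpa [conjSign] using reflectionPositive_of_mem_ferromagnetic hd hJ.mem_three

theorem conjSign_mul_boxCoupling (β : ℝ) (J : Fin 3 → (Fin d → ℤ) → ℝ) (i : Fin 3)
    (x y : Box d ℓ) : conjSign i * boxCoupling ℓ β J i x y =
      β * periodise ℓ (fun x => conjSign i * J i x) (diff x y) := by
  simp only [boxCoupling, periodise, tsum_mul_left]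
  ring

theorem boxCoupling_eq {β : ℝ} {J : Fin 3 → (Fin d → ℤ) → ℝ} {i : Fin 3} {x y x' y' : Box d ℓ}
    (h : periodise ℓ (fun x => conjSign i * J i x) (diff x y) =
      periodise ℓ (fun x => conjSign i * J i x) (diff x' y')) :
    boxCoupling ℓ β J i x y = boxCoupling ℓ β J i x' y' := by
  rw [← one_mul (boxCoupling ℓ β J i x y), ← one_mul (boxCoupling ℓ β J i x' y'),
    ← conjSign_mul_self i, mul_assoc, mul_assoc, conjSign_mul_boxCoupling,
    conjSign_mul_boxCoupling, h]

theorem boxCoupling_comm {J : Fin 3 → (Fin d → ℤ) → ℝ}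
    (hJ : ∀ i, ReflectionPositive fun x => conjSign i * J i x) (β : ℝ) (i : Fin 3)
    (x y : Box d ℓ) : boxCoupling ℓ β J i x y = boxCoupling ℓ β J i y x :=
  boxCoupling_eq (by rw [diff_swap, (hJ i).periodise_neg])

/-- The Gaussian prefactor is the exponential of a scalar operator, which commutes with everything
and so can be moved into the exponent. -/
theorem modifiedPartitionFunction_eq {J : Fin 3 → (Fin d → ℤ) → ℝ}
    (hJ : ∀ i, ReflectionPositive fun x => conjSign i * J i x) (n : ℕ) (β : ℝ)
    (v : Box d ℓ → ℝ) : modifiedPartitionFunction n J β v =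
      (NormedSpace.exp (exponent n (boxCoupling ℓ β J) v)).trace.re := by
  have hfield : ∀ x, ∑ y, boxCoupling ℓ β J 2 x y * (v y - v x) = β * laplacian (J 2) v x :=
    fun x => by
      simp only [boxCoupling, laplacian, Finset.mul_sum, mul_assoc]
  have e : exponent n (boxCoupling ℓ β J) v = -(β : ℂ) • fieldHamiltonian n J v +
      algebraMap ℂ (Operator d ℓ n)
        ((1 / 4 * β * ∑ x, v x * laplacian (J 2) v x : ℝ) : ℂ) := by
    rw [exponent_eq _ (boxCoupling_comm hJ β 2), Algebra.algebraMap_eq_smul_one]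
    congr 1
    · simp only [hfield]
      rw [neg_smul]
      simp only [fieldHamiltonian, periodicHamiltonian, smul_sub, smul_neg, neg_sub,
        sub_neg_eq_add, Finset.smul_sum, smul_smul, boxCoupling, Complex.ofReal_mul]
      exact add_comm _ _
    · simp only [hfield]
      rw [mul_assoc, Finset.mul_sum (a := β)]
      simp only [mul_left_comm]
  rw [e, Matrix.exp_add_of_commute _ _ (Algebra.commute_algebraMap_right _ _),
    Matrix.algebraMap_eq_diagonal,
    Matrix.exp_diagonal]
  have : NormedSpace.exp (algebraMap ℂ ((Box d ℓ → Fin n) → ℂ)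
      ((1 / 4 * β * ∑ x, v x * laplacian (J 2) v x : ℝ) : ℂ)) =
      fun _ => ((Real.exp (1 / 4 * β * ∑ x, v x * laplacian (J 2) v x) : ℝ) : ℂ) := by
    funext σ
    rw [Pi.coe_exp, Complex.ofReal_exp, Complex.exp_eq_exp_ℂ]
    rfl
  rw [this, ← Matrix.smul_one_eq_diagonal, Matrix.mul_smul, mul_one, Matrix.trace_smul,
    smul_eq_mul, Complex.re_ofReal_mul]
  rfl

theorem modifiedPartitionFunction_const (n : ℕ) (J : Fin 3 → (Fin d → ℤ) → ℝ) (β c : ℝ) :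
    modifiedPartitionFunction n J β (fun _ : Box d ℓ => c) =
      modifiedPartitionFunction n J β (0 : Box d ℓ → ℝ) := by
  simp [modifiedPartitionFunction, partitionFunction, fieldHamiltonian, laplacian]

theorem modifiedPartitionFunction_sq_le [NeZero ℓ] (hℓ : Even ℓ) {J : Fin 3 → (Fin d → ℤ) → ℝ}
    (hJ : ∀ i, ReflectionPositive fun x => conjSign i * J i x) {n : ℕ} (hn : 0 < n) {β : ℝ}
    (hβ : 0 ≤ β) (k : Fin d) (c : Box d ℓ) (v : Box d ℓ → ℝ) :
    modifiedPartitionFunction n J β v ^ 2 ≤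
      modifiedPartitionFunction n J β (copyLeft (reflectionEquiv hℓ k c) v) *
        modifiedPartitionFunction n J β (copyRight (reflectionEquiv hℓ k c) v) ∧
    0 ≤ modifiedPartitionFunction n J β (copyLeft (reflectionEquiv hℓ k c) v) := by
  simp only [modifiedPartitionFunction_eq hJ]
  refine trace_exp_exponent_sq_le hn (reflectionEquiv hℓ k c) (boxCoupling ℓ β J)
    (boxCoupling_comm hJ β) (fun i a b => boxCoupling_eq ?_) (fun i => ?_) v
  · rw [(latticeModEq_inl_inl hℓ k c a b).periodise_eq,
      (latticeModEq_inr_inr hℓ k c a b).periodise_eq,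
      (hJ i).periodise_flip]
  · have hform : ∀ a b : HalfBox d ℓ k, conjSign i * boxCoupling ℓ β J i
        (reflectionEquiv hℓ k c (Sum.inl a)) (reflectionEquiv hℓ k c (Sum.inr b)) =
        β * periodise ℓ (fun x => conjSign i * J i x)
          (reflDiff k (toLattice a.1) (toLattice b.1)) := fun a b => by
      rw [conjSign_mul_boxCoupling, (latticeModEq_inl_inr hℓ k c a b).periodise_eq]
    obtain ⟨L, hL⟩ := hℓ
    have hL0 : 0 < L := by have := NeZero.pos ℓ; omega
    refine Matrix.PosSemidef.of_dotProduct_mulVec_nonneg ?_ fun f => ?_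
    · ext a b
      simp only [Matrix.conjTranspose_apply, Matrix.of_apply, hform, star_trivial]
      -- Exchanging the points negates only the transverse components, which is the composition of a
      -- flip and a full negation.
      rw [← (hJ i).periodise_flip k, ← (hJ i).periodise_neg]
      congr 2
      funext j
      by_cases h : j = k
      · subst h; simp [reflDiff_self]; ring
      · simp [reflDiff_of_ne h, h]
    · have := mul_nonneg hβ ((hJ i).sum_periodise_nonneg hL0 (hL.trans (two_mul L).symm) k
        (fun a : HalfBox d ℓ k => toLattice a.1) f (fun a => by simp [toLattice])
        (fun a => by have := a.2; simp only [toLattice]; omega))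
      refine this.trans_eq ?_
      simp only [dotProduct, Matrix.mulVec, Matrix.of_apply, hform, Finset.mul_sum, Pi.star_apply,
        star_trivial]
      exact Finset.sum_congr rfl fun a _ => Finset.sum_congr rfl fun b _ => by ring

theorem exists_reflectionEquiv_eq [NeZero ℓ] (hℓ : Even ℓ) (x : Box d ℓ) (k : Fin d) :
    ∃ (c : Box d ℓ) (a : HalfBox d ℓ k), reflectionEquiv hℓ k c (Sum.inl a) = x + Pi.single k 1 ∧
      reflectionEquiv hℓ k c (Sum.inr a) = x ∧ TorusAdj (x + Pi.single k 1) x := by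
  -- The bottom cut, between the heights `0` and `ℓ - 1 ≡ -1`, is translated by `x k + 1` so as to
  -- lie between `x k` and `x k + 1`.
  let a : HalfBox d ℓ k := ⟨Function.update x k 0, by simpa using NeZero.pos ℓ⟩
  let c : Box d ℓ := Pi.single k (x k + 1)
  have h1 : reflectionEquiv hℓ k c (Sum.inl a) = x + Pi.single k 1 := by
    rw [reflectionEquiv_inl]
    funext j
    by_cases h : j = k
    · subst h; simp [a, c]
    · simp [a, c, h]
  have h2 : reflectionEquiv hℓ k c (Sum.inr a) = x := by
    rw [reflectionEquiv_inr]
    funext j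
    by_cases h : j = k
    · subst h
      have h0 : Fin.rev (0 : Fin ℓ) + 1 = 0 := by
        refine Fin.ext ?_
        rw [Fin.val_add, Fin.val_rev, Fin.val_one', Nat.add_mod_mod]
        have := NeZero.pos ℓ
        simp [Nat.sub_add_cancel this]
      simp only [Pi.add_apply, mirror_self, a, c, Function.update_self, Pi.single_eq_same]
      rw [add_comm (x j), ← add_assoc, h0, zero_add]
    · simp [mirror_of_ne h, a, c, h]
  refine ⟨c, a, h1, h2, ?_⟩
  have h3 := (latticeModEq_inl_inr hℓ k c a a).torusAdj_iff
  rw [h1, h2] at h3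
  refine h3.2 ⟨0, ?_⟩
  have h4 : reflDiff k (toLattice a.1) (toLattice a.1) = Pi.single k 1 := by
    funext j
    by_cases h : j = k
    · subst h; simp [reflDiff_self, toLattice, a]
    · simp [reflDiff_of_ne h, h]
  rw [smul_zero, add_zero, h4, norm1, Finset.sum_eq_single k] <;> simp +contextual

end Partition

end

end QuantumSpin

theorem corollary5p3 (d ℓ n : ℕ) (hd : 1 ≤ d) (hℓ : 0 < ℓ) (hℓ_even : Even ℓ) (hn : 2 ≤ n)
    (β : ℝ) (hβ : 0 ≤ β) (J : Fin 3 → (Fin d → ℤ) → ℝ) (hJ : QuantumSpin.Admissible J)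
    (v : QuantumSpin.Box d ℓ → ℝ) :
    QuantumSpin.modifiedPartitionFunction n J β v ≤
      QuantumSpin.modifiedPartitionFunction n J β (0 : QuantumSpin.Box d ℓ → ℝ) := by
  have : NeZero ℓ := ⟨hℓ.ne'⟩
  have hrp := hJ.reflectionPositive hd
  have hcs := QuantumSpin.modifiedPartitionFunction_sq_le hℓ_even hrp (by omega : 0 < n) hβ
  refine QuantumSpin.le_of_reflections (adj := QuantumSpin.TorusAdj)
    -- Bonds in the positive directions already connect the torus; agreements are counted over the
    -- full symmetric adjacency.
    (bond := fun y x => ∃ k, y = x + Pi.single k 1) ?_ (fun v hv => ?_)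
    (QuantumSpin.modifiedPartitionFunction_const n J β) ?_ v
  · rintro _ x ⟨k, rfl⟩
    obtain ⟨c, a, h1, h2, h3⟩ := QuantumSpin.exists_reflectionEquiv_eq hℓ_even x k
    exact ⟨_, inferInstance, _, a, h1, h2, h3,
      QuantumSpin.isBondReflection_reflectionEquiv hℓ_even k c,
      hcs k c⟩
  · exact QuantumSpin.Box.eq_const_of_eq_add_single fun x k => hv _ _ ⟨k, rfl⟩
  -- Copying the zero field gives the zero field, so nonnegativity of `Z̃(0)` is the second part of
  -- the Cauchy–Schwarz statement.
  · exact (hcs ⟨0, hd⟩ 0 0).2
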